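/- Let $\mathscr X=\mathbb K_1\times\mathbb K_2$, where each $\mathbb K_i$ is either $\mathbb R$ or $\mathbb T=\mathbb R/2\pi\mathbb Z$, with the Euclidean product metric $|x-y|$, and let $\mathcal P(\mathscr X)$ be the set of Borel probability measures on $\mathscr X$. For $\nu_1,\nu_2\in\mathcal P(\mathscr X)$ put $$d_W(\nu_1,\nu_2)=\sup\Big\{\int_{\mathscr X}\psi\,d(\nu_2-\nu_1):\ \psi\in C_b(\mathscr X),\ \|\psi\|_{\mathrm{Lip}}\le 1\Big\}\in[0,\infty].$$ Let $V$ assign to each $\nu\in\mathcal P(\mathscr X)$ a velocity field $V[\nu]=(V^1[\nu],V^2[\nu]):\mathscr X\to\mathbb R^2$ such that for some constants $C_1,C_2,C_3>0$ and all $\nu,\nu_1,\nu_2\in\mathcal P(\mathscr X)$, $x,y\in\mathscr X$: - (A1) $\|V[\nu]\|_{L^\infty}\le C_1$; - (A2) $|V[\nu](x)-V[\nu](y)|\le C_2|x-y|$; - (A3) $\|V[\nu_1]-V[\nu_2]\|_{L^\infty}\le C_3\,d_W(\nu_1,\nu_2)$. Let $\mu_0\in\mathcal P(\mathscr X)$ have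 compact support. A *measure-valued solution* of $\partial_t\mu+\nabla\cdot(V[\mu]\mu)=0$ with initial value $\mu_0$ is a weakly continuous family $(\mu_t)_{t\ge0}$ in $\mathcal P(\mathscr X)$ (that is, $t\mapsto\int g\,d\mu_t$ is continuous for all $g\in C_0(\mathscr X)$) such that for every $\varphi\in C_c^\infty(\mathscr X\times[0,\infty))$ the inner integral below is an integrable function of $t$ and $$\int_0^\infty\!\!\int_{\mathscr X}\big(\partial_t\varphi(x,t)+V[\mu_t](x)\cdot\nabla\varphi(x,t)\big)\,d\mu_t(x)\,dt+\int_{\mathscr X}\varphi(x,0)\,d\mu_0(x)=0 .$$ Lax–Friedrichs scheme: take uniform meshes of $\mathbb K_1$ and $\mathbb K_2$ with nodes $x_i$, $y_j$ and mesh lengths $\Delta x,\Delta y>0$ (on $\mathbb T$, with a whole number of cells and periodic indexing) and a time step $\Delta t$. Let $\phi_{i,j}(x,y)=\max\!\big(0,1-\tfrac{|x-x_i|}{\Delta x}\big)\max\!\big(0,1-\tfrac{|y-y_j|}{\Delta y}\big)$ and $\mu^0_{i,j}=\int\phi_{i,j}\,d\mu_0$, and, with $\mu^n=\sum_{i,j}\mu^n_{i,j}\delta_{(x_i,y_j)}$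 and $V^k[\mu^n]_{i,j}=V^k[\mu^n](x_i,y_j)$, $$\mu^{n+1}_{i,j}=\frac{\mu^n_{i-1,j}+\mu^n_{i+1,j}+\mu^n_{i,j-1}+\mu^n_{i,j+1}}4-\Delta t\,\frac{V^1[\mu^n]_{i+1,j}\mu^n_{i+1,j}-V^1[\mu^n]_{i-1,j}\mu^n_{i-1,j}}{2\Delta x}-\Delta t\,\frac{V^2[\mu^n]_{i,j+1}\mu^n_{i,j+1}-V^2[\mu^n]_{i,j-1}\mu^n_{i,j-1}}{2\Delta y}.$$ Put $t^n=n\Delta t$ and $$\mu^{\Delta x,\Delta y}_t=\frac{t^{n+1}-t}{\Delta t}\mu^n+\frac{t-t^n}{\Delta t}\mu^{n+1}\qquad\text{for } t\in[t^n,t^{n+1}).$$ **Theorem.** There is exactly one measure-valued solution $(\mu_t)_{t\ge0}$ with initial value $\mu_0$. Let $\lambda_0>0$ be fixed and let the meshes and time steps satisfy the CFL condition $$\lambda_0\le\frac{\Delta t}{\min(\Delta x,\Delta y)}\,C_1\le\frac12 .$$ Then for every $T>0$, once $\Delta x$, $\Delta y$, $\Delta x^2/\Delta y$ and $\Delta y^2/\Delta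 x$ are small enough, the scheme is well defined and every $\mu_t^{\Delta x,\Delta y}$ with $t\in[0,T]$ is a probability measure, and $$\sup_{t\in[0,T]}d_W\big(\mu^{\Delta x,\Delta y}_t,\mu_t\big)\to0\qquad\text{as }\Delta x,\ \Delta y,\ \frac{\Delta x^2}{\Delta y},\ \frac{\Delta y^2}{\Delta x}\to0 .$$ In particular this holds as $\Delta x,\Delta y\to0$ with $\Delta x/\Delta y$ bounded above and below. The convergence is uniform in the position of the nodes and in the admissible $\Delta t$. -/

import Mathlib

open MeasureTheory Set Filter Topology
open scoped ENNReal ContDiff ZeroAtInfty BoundedContinuousFunction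

noncomputable section

namespace LaxFriedrichs

/-- The two possible one-dimensional factors of the domain. -/
inductive Factor
  | line
  | torus

/-- The space named by a factor: `ℝ`, or `𝕋 = ℝ / 2πℤ`. -/
def Factor.Carrier : Factor → Type
  | .line => ℝ
  | .torus => AddCircle (2 * Real.pi)

/-- The usual absolute value on `ℝ`; on `𝕋` the distance to `2πℤ`. -/
instance (K : Factor) : NormedAddCommGroup K.Carrier :=
  match K with
  | .line => inferInstanceAs (NormedAddCommGroup ℝ)
  | .torus => inferInstanceAs (NormedAddCommGroup (AddCircle (2 * Real.pi)))

instance (K : Factor) : MeasurableSpace K.Carrier := borel K.Carrier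

instance (K : Factor) : BorelSpace K.Carrier := ⟨rfl⟩

instance (K : Factor) : SecondCountableTopology K.Carrier :=
  match K with
  | .line => inferInstanceAs (SecondCountableTopology ℝ)
  | .torus => inferInstanceAs (SecondCountableTopology (AddCircle (2 * Real.pi)))

/-- The canonical projection `ℝ → 𝕂`: the identity of `ℝ`, or reduction modulo `2π`. -/
def Factor.proj : (K : Factor) → ℝ → K.Carrier
  | .line => fun x => x
  | .torus => fun x => (QuotientAddGroup.mk x : AddCircle (2 * Real.pi))

/-- The domain `𝕂₁ × 𝕂₂` with the Euclidean product metric. -/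
abbrev Domain (K₁ K₂ : Factor) : Type := WithLp 2 (K₁.Carrier × K₂.Carrier)

/-- The vector space `ℝ²` with the Euclidean norm, in which the velocity takes its values. -/
abbrev Vec : Type := WithLp 2 (ℝ × ℝ)

/-- The point of the domain with given coordinates. -/
abbrev pt {K₁ K₂ : Factor} (x : K₁.Carrier) (y : K₂.Carrier) : Domain K₁ K₂ :=
  WithLp.toLp 2 (x, y)

/-- The 1-Wasserstein distance: the supremum of `∫ ψ d(ν₂ - ν₁)` over the bounded continuous `ψ`
with Lipschitz constant at most one. It may be infinite. (The supremum is nonnegative because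
`ψ = 0` is admissible, so that taking the nonnegative part of each member does not change it.) -/
def dW {X : Type*} [PseudoMetricSpace X] [MeasurableSpace X] (ν₁ ν₂ : Measure X) : ℝ≥0∞ :=
  ⨆ (ψ : X →ᵇ ℝ) (_ : LipschitzWith 1 ψ), ENNReal.ofReal (∫ x, ψ x ∂ν₂ - ∫ x, ψ x ∂ν₁)

section Equation

variable {K₁ K₂ : Factor}

/-! A nonlocal velocity is a map `V : Measure (Domain K₁ K₂) → Domain K₁ K₂ → Vec`; only its values
`V ν` at probability measures `ν` matter. -/

/-- `‖V[ν]‖_∞ ≤ C` for all probability measures `ν`. -/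
def VelocityBound (V : Measure (Domain K₁ K₂) → Domain K₁ K₂ → Vec) (C : ℝ) : Prop :=
  ∀ ν : Measure (Domain K₁ K₂), IsProbabilityMeasure ν → ∀ x, ‖V ν x‖ ≤ C

/-- `|V[ν](x) - V[ν](y)| ≤ C |x - y|` for all probability measures `ν`. -/
def VelocityLipschitzInSpace (V : Measure (Domain K₁ K₂) → Domain K₁ K₂ → Vec) (C : ℝ) : Prop :=
  ∀ ν : Measure (Domain K₁ K₂), IsProbabilityMeasure ν →
    ∀ x y, ‖V ν x - V ν y‖ ≤ C * dist x y

/-- `‖V[ν₁] - V[ν₂]‖_∞ ≤ C d_W(ν₁, ν₂)` for all probability measures `ν₁`, `ν₂`. -/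
def VelocityLipschitzInMeasure (V : Measure (Domain K₁ K₂) → Domain K₁ K₂ → Vec) (C : ℝ) : Prop :=
  ∀ ν₁ ν₂ : Measure (Domain K₁ K₂), IsProbabilityMeasure ν₁ → IsProbabilityMeasure ν₂ →
    ∀ x, ENNReal.ofReal ‖V ν₁ x - V ν₂ x‖ ≤ ENNReal.ofReal C * dW ν₁ ν₂

/-- Test functions on `𝕂₁ × 𝕂₂ × ℝ₊`: compactly supported functions on `𝕂₁ × 𝕂₂ × ℝ` (to be
restricted to nonnegative times) whose lift to `ℝ × ℝ × ℝ` is smooth. -/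
def IsTestFunction (φ : Domain K₁ K₂ → ℝ → ℝ) : Prop :=
  ContDiff ℝ ∞ (fun p : ℝ × ℝ × ℝ => φ (pt (K₁.proj p.1) (K₂.proj p.2.1)) p.2.2) ∧
    HasCompactSupport (fun p : Domain K₁ K₂ × ℝ => φ p.1 p.2)

/-- The partial derivative in the first space variable. -/
def partialX (φ : Domain K₁ K₂ → ℝ → ℝ) (z : Domain K₁ K₂) (t : ℝ) : ℝ :=
  deriv (fun h : ℝ => φ (pt (z.fst + K₁.proj h) z.snd) t) 0

/-- The partial derivative in the second space variable. -/
def partialY (φ : Domain K₁ K₂ → ℝ → ℝ) (z : Domain K₁ K₂) (t : ℝ) : ℝ :=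
  deriv (fun h : ℝ => φ (pt z.fst (z.snd + K₂.proj h)) t) 0

/-- The partial derivative in time. -/
def partialT (φ : Domain K₁ K₂ → ℝ → ℝ) (z : Domain K₁ K₂) (t : ℝ) : ℝ :=
  deriv (fun s : ℝ => φ z s) t

/-- `∫ ∂_t φ(x, t) + V[μ_t](x) · ∇φ(x, t) dμ_t(x)`, the inner integral of the weak formulation. -/
def weakIntegrand (V : Measure (Domain K₁ K₂) → Domain K₁ K₂ → Vec)
    (μ : ℝ → Measure (Domain K₁ K₂)) (φ : Domain K₁ K₂ → ℝ → ℝ) (t : ℝ) : ℝ :=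
  ∫ z, (partialT φ z t
    + ((V (μ t) z).fst * partialX φ z t + (V (μ t) z).snd * partialY φ z t)) ∂(μ t)

/-- `μ = (μ_t)_{t ≥ 0}` is a measure-valued solution of `∂_t μ + ∇ · (V[μ] μ) = 0` with initial
value `μ₀`: a weakly continuous family of probability measures that satisfies the equation and the
initial condition in the sense of distributions. Values of `μ` at negative times play no role. -/
structure IsMeasureValuedSolution (V : Measure (Domain K₁ K₂) → Domain K₁ K₂ → Vec)
    (μ₀ : Measure (Domain K₁ K₂)) (μ : ℝ → Measure (Domain K₁ K₂)) : Prop where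
  prob : ∀ t, 0 ≤ t → IsProbabilityMeasure (μ t)
  weak_cont : ∀ g : C₀(Domain K₁ K₂, ℝ), ContinuousOn (fun t => ∫ z, g z ∂(μ t)) (Ici 0)
  integrable : ∀ φ : Domain K₁ K₂ → ℝ → ℝ, IsTestFunction φ →
    IntegrableOn (weakIntegrand V μ φ) (Ioi 0)
  weak_eq : ∀ φ : Domain K₁ K₂ → ℝ → ℝ, IsTestFunction φ →
    (∫ t in Ioi 0, weakIntegrand V μ φ t) + ∫ z, φ z 0 ∂μ₀ = 0

end Equation

section Scheme

/-- A uniform mesh of `𝕂` with mesh length `step` and nodes `x_i = origin + i * step` (cell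
midpoints). On the torus a whole number `cells` of cells makes up one period; on the line `cells`
is not used. -/
structure Mesh (K : Factor) where
  step : ℝ
  step_pos : 0 < step
  origin : ℝ
  cells : ℕ
  fits : K = Factor.torus → (cells : ℝ) * step = 2 * Real.pi

/-- The node `x_i`. On the torus it depends on `i` modulo the number of cells only, so that a
family over `ℤ` built from the nodes is periodic. -/
def Mesh.node {K : Factor} (m : Mesh K) (i : ℤ) : K.Carrier :=
  K.proj (m.origin + i * m.step)

/-- The index set: `ℤ` on the line and `{1, …, N}` on the torus with `N` cells. -/
def Mesh.index {K : Factor} (m : Mesh K) : Set ℤ :=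
  match K with
  | .line => Set.univ
  | .torus => Set.Icc 1 (m.cells : ℤ)

/-- The hat function centred at `x_i`, which vanishes at distance at least `step` from `x_i`. -/
def Mesh.hat {K : Factor} (m : Mesh K) (i : ℤ) (x : K.Carrier) : ℝ :=
  max 0 (1 - dist x (m.node i) / m.step)

variable {K₁ K₂ : Factor}

/-- The measure `∑_{i,j} w_{i,j} δ_{(x_i, y_j)}` (with nonnegative weights `w_{i,j}`). -/
def gridMeasure (m₁ : Mesh K₁) (m₂ : Mesh K₂) (w : ℤ → ℤ → ℝ) : Measure (Domain K₁ K₂) :=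
  Measure.sum fun p : m₁.index × m₂.index =>
    ENNReal.ofReal (w p.1 p.2) • Measure.dirac (pt (m₁.node p.1) (m₂.node p.2))

/-- The weights `μ_{i,j}^n` of the unstaggered two-dimensional Lax–Friedrichs scheme. -/
def weight (V : Measure (Domain K₁ K₂) → Domain K₁ K₂ → Vec) (μ₀ : Measure (Domain K₁ K₂))
    (m₁ : Mesh K₁) (m₂ : Mesh K₂) (Δt : ℝ) : ℕ → ℤ → ℤ → ℝ
  | 0 => fun i j => ∫ z, m₁.hat i z.fst * m₂.hat j z.snd ∂μ₀
  | n + 1 => fun i j =>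
      let w := weight V μ₀ m₁ m₂ Δt n
      let v : ℤ → ℤ → Vec := fun k l => V (gridMeasure m₁ m₂ w) (pt (m₁.node k) (m₂.node l))
      (w (i - 1) j + w (i + 1) j + w i (j - 1) + w i (j + 1)) / 4
        - Δt * (((v (i + 1) j).fst * w (i + 1) j - (v (i - 1) j).fst * w (i - 1) j)
            / (2 * m₁.step))
        - Δt * (((v i (j + 1)).snd * w i (j + 1) - (v i (j - 1)).snd * w i (j - 1))
            / (2 * m₂.step))

/-- The measure `μ^n = ∑_{i,j} μ_{i,j}^n δ_{(x_i, y_j)}`. -/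
def stepMeasure (V : Measure (Domain K₁ K₂) → Domain K₁ K₂ → Vec) (μ₀ : Measure (Domain K₁ K₂))
    (m₁ : Mesh K₁) (m₂ : Mesh K₂) (Δt : ℝ) (n : ℕ) : Measure (Domain K₁ K₂) :=
  gridMeasure m₁ m₂ (weight V μ₀ m₁ m₂ Δt n)

/-- The approximate solution, interpolated linearly between the times `t^n = n Δt`: for
`t ∈ [t^n, t^{n+1})` it is `(t^{n+1} - t) / Δt · μ^n + (t - t^n) / Δt · μ^{n+1}`. -/
def approx (V : Measure (Domain K₁ K₂) → Domain K₁ K₂ → Vec) (μ₀ : Measure (Domain K₁ K₂))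
    (m₁ : Mesh K₁) (m₂ : Mesh K₂) (Δt : ℝ) (t : ℝ) : Measure (Domain K₁ K₂) :=
  let n := ⌊t / Δt⌋₊
  ENNReal.ofReal ((((n : ℝ) + 1) * Δt - t) / Δt) • stepMeasure V μ₀ m₁ m₂ Δt n
    + ENNReal.ofReal ((t - n * Δt) / Δt) • stepMeasure V μ₀ m₁ m₂ Δt (n + 1)

/-- The CFL condition `λ₀ ≤ C₁ Δt / min(Δx, Δy) ≤ 1/2`. -/
def CFL (C₁ lam₀ : ℝ) (m₁ : Mesh K₁) (m₂ : Mesh K₂) (Δt : ℝ) : Prop :=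
  lam₀ ≤ Δt / min m₁.step m₂.step * C₁ ∧ Δt / min m₁.step m₂.step * C₁ ≤ 1 / 2

end Scheme

end LaxFriedrichs

end

namespace LaxFriedrichs

/-! ### The covering of the domain by the plane -/

/-! The domain is a quotient group of the plane, so a map at bounded distance from the identity can
be written `x + cover (D x)` with a bounded continuous vector field `D`. The particle positions then
solve an autonomous equation `D' = F(D)` in a Banach space, where `F(D)(x)` is the velocity of the
pushed-forward measure at the displaced point. By (A2) and (A3) `F` is Lipschitz with constant `C₂ +
C₃`, by (A1) it is bounded (`exists_velocity_operator`), so a global solution starts from `D = 0`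
(`exists_global_solution`), and the push-forwards of `μ₀` solve the equation
(`isMeasureValuedSolution_of_flow`).

Uniqueness does not need the characteristics of an arbitrary solution `ν`. Testing with regularized
functions shows that if a Lipschitz function of space and time grows at rate at most `M` along the
velocity field, so does its integral against `ν` (`integral_sub_le_of_characteristic`). For `ψ(z +
(a + h - s) V[ν_a](z))` this says that every solution agrees with an explicit Euler step up to
`O(h²)` (`IsMeasureValuedSolution.integral_sub_euler_le`). Two solutions drift apart by a factor `1
+ (C₂ + C₃) h` per step, up to `O(h²)`; with `t / h` steps and `h → 0` their distance vanishes.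

For convergence, the scheme is read as a Markov chain: the mass at `z` jumps to one of four
neighbours, with probabilities that are nonnegative by the CFL condition, with mean `Δt V[μⁿ](z)`
and second moment `(Δx² + Δy²)/2` (`sum_jumpProb_mul_norm_sq`). A coupling of the particles with
`μⁿ` is carried along by these jumps. Its mean square distance `e` obeys `e' ≤ (1 + A Δt) e + O(Δt³)
+ (Δx² + Δy²)/2` (`IsCoupled.succ`, `isCoupled_solution`): the centred noise enters through its
variance only, and the velocity error is controlled by `d_W ≤ √e`. Over `T/Δt` steps the noise adds
up to order `(Δx² + Δy²)/Δt`, which by the lower CFL bound is of order `(Δx² + Δy²)/min(Δx, Δy)`.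
The mesh conditions make exactly this quantity small (`sq_add_sq_div_min_le`). -/

theorem Factor.proj_add (K : Factor) (x y : ℝ) : K.proj (x + y) = K.proj x + K.proj y := by
  cases K <;> rfl

theorem Factor.proj_zero (K : Factor) : K.proj 0 = 0 := by
  cases K <;> rfl

theorem Factor.norm_proj_le (K : Factor) (x : ℝ) : ‖K.proj x‖ ≤ |x| := by
  cases K
  · exact le_of_eq (Real.norm_eq_abs x)
  · exact (QuotientAddGroup.norm_mk_le_norm (S := AddSubgroup.zmultiples (2 * Real.pi)) (m := x))

theorem Factor.exists_lift (K : Factor) (k : K.Carrier) : ∃ x : ℝ, K.proj x = k ∧ |x| = ‖k‖ := by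
  cases K
  · exact ⟨k, rfl, rfl⟩
  · have hp : (0 : ℝ) < 2 * Real.pi := by positivity
    have : Fact ((0 : ℝ) < 2 * Real.pi) := ⟨hp⟩
    obtain ⟨y, rfl⟩ := QuotientAddGroup.mk_surjective k
    -- Removing the nearest whole number of periods leaves the representative of least absolute
    -- value.
    refine ⟨y - round ((2 * Real.pi)⁻¹ * y) * (2 * Real.pi), ?_, ?_⟩
    · change ((y - round ((2 * Real.pi)⁻¹ * y) * (2 * Real.pi) : ℝ) : AddCircle (2 * Real.pi)) = y
      rw [AddCircle.coe_sub, ← zsmul_eq_mul, AddCircle.coe_zsmul, AddCircle.coe_period]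
      simp
    · exact (AddCircle.norm_eq (p := 2 * Real.pi) (x := y)).symm

instance (K : Factor) : ProperSpace K.Carrier :=
  match K with
  | .line => inferInstanceAs (ProperSpace ℝ)
  | .torus =>
    haveI : Fact ((0 : ℝ) < 2 * Real.pi) := ⟨by positivity⟩
    inferInstanceAs (ProperSpace (AddCircle (2 * Real.pi)))

variable {K₁ K₂ : Factor}

/-- The covering map of the domain by the plane. -/
noncomputable def cover : Vec →+ Domain K₁ K₂ where
  toFun v := pt (K₁.proj v.fst) (K₂.proj v.snd)
  map_zero' := by simp [Factor.proj_zero, pt]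
  map_add' v w := by
    simp only [WithLp.add_fst, WithLp.add_snd, Factor.proj_add, pt]
    rfl

theorem norm_cover_le (v : Vec) : ‖(cover v : Domain K₁ K₂)‖ ≤ ‖v‖ := by
  rw [WithLp.prod_norm_eq_of_L2, WithLp.prod_norm_eq_of_L2]
  apply Real.sqrt_le_sqrt
  have h1 := K₁.norm_proj_le v.fst
  have h2 := K₂.norm_proj_le v.snd
  gcongr
  · exact h1
  · exact h2

/-- Shortest representatives in each coordinate. Applied to a difference of two points, it realizes
their distance as the length of a plane vector, so that estimates can be made upstairs and brought
back with `norm_cover_le`. -/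
theorem exists_cover_eq (z : Domain K₁ K₂) : ∃ v : Vec, cover v = z ∧ ‖v‖ = ‖z‖ := by
  obtain ⟨x, hx, hx'⟩ := K₁.exists_lift z.fst
  obtain ⟨y, hy, hy'⟩ := K₂.exists_lift z.snd
  refine ⟨WithLp.toLp 2 (x, y), ?_, ?_⟩
  · change pt (K₁.proj x) (K₂.proj y) = z
    rw [hx, hy]
    rfl
  · rw [WithLp.prod_norm_eq_of_L2, WithLp.prod_norm_eq_of_L2]
    simp only [Real.norm_eq_abs]
    rw [← hx', ← hy']
    rfl

theorem dist_add_cover_le (x y : Domain K₁ K₂) (v w : Vec) :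
    dist (x + cover v) (y + cover w) ≤ dist x y + ‖v - w‖ := by
  have : (x + cover v) - (y + cover w) = (x - y) + cover (v - w) := by
    rw [map_sub]; abel
  rw [dist_eq_norm, this, dist_eq_norm]
  exact (norm_add_le _ _).trans (add_le_add le_rfl (norm_cover_le _))

theorem dist_add_cover_self_le (x : Domain K₁ K₂) (v w : Vec) :
    dist (x + cover v) (x + cover w) ≤ ‖v - w‖ := by
  simpa using dist_add_cover_le x x v w

theorem continuous_cover : Continuous (cover : Vec → Domain K₁ K₂) := by
  refine (LipschitzWith.of_dist_le_mul (K := 1) fun v w => ?_).continuous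
  rw [dist_eq_norm, ← map_sub, dist_eq_norm, NNReal.coe_one, one_mul]
  exact norm_cover_le _

theorem isCompact_closedBall_domain (z : Domain K₁ K₂) (R : ℝ) :
    IsCompact (Metric.closedBall z R) := by
  have : ProperSpace (Domain K₁ K₂) := by
    have h : Topology.IsInducing (WithLp.homeomorphProd 2 K₁.Carrier K₂.Carrier) :=
      (WithLp.homeomorphProd 2 K₁.Carrier K₂.Carrier).isInducing
    -- Euclidean balls lie in products of balls of the factors, and the Euclidean and the product
    -- metric give the same topology.
    refine ProperSpace.of_isCompact_closedBall_of_le 0 fun x r _ => ?_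
    have hsub : Metric.closedBall x r ⊆ (WithLp.homeomorphProd 2 K₁.Carrier K₂.Carrier) ⁻¹'
        (Metric.closedBall x.fst r ×ˢ Metric.closedBall x.snd r) := by
      intro y hy
      rw [Metric.mem_closedBall, dist_eq_norm] at hy
      refine ⟨?_, ?_⟩
      · rw [Metric.mem_closedBall, dist_eq_norm]
        exact (WithLp.norm_fst_le (p := 2) _ (y - x)).trans hy
      · rw [Metric.mem_closedBall, dist_eq_norm]
        exact (WithLp.norm_snd_le (p := 2) _ (y - x)).trans hy
    refine IsCompact.of_isClosed_subset ?_ Metric.isClosed_closedBall hsub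
    exact (Homeomorph.isCompact_preimage _).2
      ((isCompact_closedBall _ _).prod (isCompact_closedBall _ _))
  exact isCompact_closedBall z R

end LaxFriedrichs

namespace LaxFriedrichs

/-! ### The Wasserstein distance -/

section Wasserstein

variable {X : Type*} [PseudoMetricSpace X] [MeasurableSpace X]

theorem dW_le_ofReal {ν₁ ν₂ : Measure X} {w : ℝ}
    (h : ∀ ψ : X →ᵇ ℝ, LipschitzWith 1 ψ → ∫ x, ψ x ∂ν₂ - ∫ x, ψ x ∂ν₁ ≤ w) :
    dW ν₁ ν₂ ≤ ENNReal.ofReal w :=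
  iSup₂_le fun ψ hψ => ENNReal.ofReal_le_ofReal (h ψ hψ)

/-- Division by `K` makes `ψ` admissible. Since `w ≥ 0`, the truncation in `ENNReal.ofReal` loses
nothing when the bound is read back in `ℝ`. -/
theorem integral_sub_le_of_dW_le {ν₁ ν₂ : Measure X} {w : ℝ} (hw : 0 ≤ w)
    (h : dW ν₁ ν₂ ≤ ENNReal.ofReal w) {ψ : X → ℝ} {B K : ℝ} (hK : 0 < K) (hB : ∀ x, |ψ x| ≤ B)
    (hψ : ∀ x y, |ψ x - ψ y| ≤ K * dist x y) : ∫ x, ψ x ∂ν₂ - ∫ x, ψ x ∂ν₁ ≤ K * w := by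
  have hlip : LipschitzWith 1 fun x => K⁻¹ * ψ x := by
    refine LipschitzWith.of_dist_le_mul fun x y => ?_
    rw [Real.dist_eq, ← mul_sub, abs_mul, abs_of_pos (inv_pos.2 hK), NNReal.coe_one, one_mul,
      inv_mul_le_iff₀ hK]
    exact hψ x y
  let f : X →ᵇ ℝ := BoundedContinuousFunction.ofNormedAddCommGroup (fun x => K⁻¹ * ψ x)
    hlip.continuous (K⁻¹ * B) fun x => by
      rw [norm_mul, Real.norm_eq_abs, Real.norm_eq_abs, abs_of_pos (inv_pos.2 hK)]
      gcongr
      exact hB x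
  have h1 : ENNReal.ofReal (∫ x, f x ∂ν₂ - ∫ x, f x ∂ν₁) ≤ ENNReal.ofReal w :=
    (le_iSup₂ (f := fun (ψ : X →ᵇ ℝ) (_ : LipschitzWith 1 ψ) =>
      ENNReal.ofReal (∫ x, ψ x ∂ν₂ - ∫ x, ψ x ∂ν₁)) f hlip).trans h
  have h2 := (ENNReal.ofReal_le_ofReal_iff hw).1 h1
  have h3 : ∀ ν : Measure X, ∫ x, f x ∂ν = K⁻¹ * ∫ x, ψ x ∂ν := fun ν => integral_const_mul _ _
  rw [h3, h3, ← mul_sub, inv_mul_le_iff₀ hK] at h2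
  exact h2

theorem integral_sub_le_of_dW_le_of_lipschitz {ν₁ ν₂ : Measure X} {w : ℝ} (hw : 0 ≤ w)
    (h : dW ν₁ ν₂ ≤ ENNReal.ofReal w) {ψ : X →ᵇ ℝ} (hψ : LipschitzWith 1 ψ) :
    ∫ x, ψ x ∂ν₂ - ∫ x, ψ x ∂ν₁ ≤ w := by
  have := integral_sub_le_of_dW_le hw h one_pos (fun x => ψ.norm_coe_le_norm x) fun x y => by
    simpa [Real.dist_eq] using hψ.dist_le_mul x y
  simpa using this

/-- Dropping the negative part of `h` leaves a lower integral, which is monotone without any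
integrability of `d`. -/
theorem integral_le_of_lintegral_ofReal_le {Ω : Type*} [MeasurableSpace Ω] {π : Measure Ω}
    {h d : Ω → ℝ} {w : ℝ} (hw : 0 ≤ w) (hint : Integrable h π) (hd : ∀ q, h q ≤ d q)
    (hπ : ∫⁻ q, ENNReal.ofReal (d q) ∂π ≤ ENNReal.ofReal w) : ∫ q, h q ∂π ≤ w := by
  rw [integral_eq_lintegral_pos_part_sub_lintegral_neg_part hint]
  have : (∫⁻ q, ENNReal.ofReal (h q) ∂π).toReal ≤ w := by
    refine ENNReal.toReal_le_of_le_ofReal hw ?_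
    exact (lintegral_mono fun q => ENNReal.ofReal_le_ofReal (hd q)).trans hπ
  linarith [ENNReal.toReal_nonneg (a := ∫⁻ q, ENNReal.ofReal (-h q) ∂π)]

/-- The easy half of Kantorovich duality: a coupling, given as a pair of random variables, bounds
the distance by its mean cost. -/
theorem dW_map_le [OpensMeasurableSpace X] {Ω : Type*} [MeasurableSpace Ω] {π : Measure Ω}
    [IsFiniteMeasure π] {f g : Ω → X} (hf : Measurable f) (hg : Measurable g) {w : ℝ}
    (hw : 0 ≤ w) (h : ∫⁻ q, ENNReal.ofReal (dist (f q) (g q)) ∂π ≤ ENNReal.ofReal w) :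
    dW (π.map f) (π.map g) ≤ ENNReal.ofReal w := by
  refine dW_le_ofReal fun ψ hψ => ?_
  have hm := ψ.continuous.measurable
  rw [integral_map hf.aemeasurable hm.aestronglyMeasurable,
    integral_map hg.aemeasurable hm.aestronglyMeasurable]
  have hi : ∀ {f : Ω → X}, Measurable f → Integrable (fun q => ψ (f q)) π := fun hf =>
    Integrable.of_bound (hm.comp hf).aestronglyMeasurable ‖ψ‖
      (.of_forall fun q => ψ.norm_coe_le_norm _)
  rw [← integral_sub (hi hg) (hi hf)]
  refine integral_le_of_lintegral_ofReal_le hw ((hi hg).sub (hi hf)) (fun q => ?_) h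
  have := hψ.dist_le_mul (g q) (f q)
  rw [Real.dist_eq, NNReal.coe_one, one_mul, dist_comm] at this
  exact (le_abs_self _).trans this

theorem dW_map_le_of_dist_le [OpensMeasurableSpace X] {Ω : Type*} [MeasurableSpace Ω]
    {π : Measure Ω} [IsProbabilityMeasure π] {f g : Ω → X} (hf : Measurable f) (hg : Measurable g)
    {w : ℝ} (hw : 0 ≤ w) (h : ∀ q, dist (f q) (g q) ≤ w) :
    dW (π.map f) (π.map g) ≤ ENNReal.ofReal w := by
  refine dW_map_le hf hg hw ?_
  refine (lintegral_mono fun q => ENNReal.ofReal_le_ofReal (h q)).trans ?_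
  simp

/-- Thickened indicators of closed sets are Lipschitz and decrease to the indicators, so closed sets
get equal mass; they form a π-system that generates the Borel sets. -/
theorem eq_of_dW_eq_zero [BorelSpace X] {ν₁ ν₂ : Measure X} [IsProbabilityMeasure ν₁]
    [IsProbabilityMeasure ν₂] (h : dW ν₁ ν₂ = 0) : ν₁ = ν₂ := by
  have key : ∀ (F : Set X) {δ : ℝ} (hδ : 0 < δ),
      ∫ x, (thickenedIndicator hδ F x : ℝ) ∂ν₂ = ∫ x, (thickenedIndicator hδ F x : ℝ) ∂ν₁ := by
    intro F δ hδ
    have hb : ∀ x, |(thickenedIndicator hδ F x : ℝ)| ≤ 1 := fun x => by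
      simpa using thickenedIndicator_le_one hδ F x
    have hl : ∀ x y, |(thickenedIndicator hδ F x : ℝ) - thickenedIndicator hδ F y|
        ≤ δ⁻¹ * dist x y := fun x y => by
      have := (lipschitzWith_thickenedIndicator hδ F).dist_le_mul x y
      rwa [NNReal.dist_eq, NNReal.coe_inv, Real.coe_toNNReal _ hδ.le] at this
    have h0 : dW ν₁ ν₂ ≤ ENNReal.ofReal 0 := by simp [h]
    have h1 := integral_sub_le_of_dW_le le_rfl h0 (inv_pos.2 hδ) hb hl
    -- The supremum is one-sided; the negated function supplies the other inequality.
    have h2 := integral_sub_le_of_dW_le (ψ := fun x => -(thickenedIndicator hδ F x : ℝ)) le_rfl h0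
      (inv_pos.2 hδ) (fun x => by rw [abs_neg]; exact hb x) fun x y => by
        rw [← neg_sub', abs_neg]; exact hl x y
    rw [integral_neg, integral_neg] at h2
    linarith
  refine ext_of_generate_finite {s : Set X | IsClosed s}
    (by rw [BorelSpace.measurable_eq (α := X), borel_eq_generateFrom_isClosed])
    isPiSystem_isClosed (fun F hF => ?_) (by simp)
  have hp : ∀ n : ℕ, (0 : ℝ) < 1 / ((n : ℝ) + 1) := fun n => by positivity
  have hlim := tendsto_one_div_add_atTop_nhds_zero_nat (𝕜 := ℝ)
  have h1 := tendsto_integral_thickenedIndicator_of_isClosed ν₁ hF hp hlim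
  have h2 := tendsto_integral_thickenedIndicator_of_isClosed ν₂ hF hp hlim
  simp_rw [key] at h2
  exact (measureReal_eq_measureReal_iff).1 (tendsto_nhds_unique h1 h2)

end Wasserstein

end LaxFriedrichs

namespace LaxFriedrichs

/-! ### Global solutions of autonomous Lipschitz equations -/

/-- A bounded field cannot leave the ball of radius `C (n + 1)` within time `n + 1`, so
Picard–Lindelöf applies on every interval, and uniqueness glues the solutions. -/
theorem exists_global_solution {E : Type*} [NormedAddCommGroup E] [NormedSpace ℝ E]
    [CompleteSpace E] {F : E → E} {K : NNReal} (hF : LipschitzWith K F) {C : ℝ} (hC : 0 ≤ C)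
    (hb : ∀ x, ‖F x‖ ≤ C) (x₀ : E) :
    ∃ γ : ℝ → E, γ 0 = x₀ ∧ ∀ t, HasDerivAt γ (F (γ t)) t := by
  have hloc : ∀ n : ℕ, ∃ α : ℝ → E, α 0 = x₀ ∧
      ∀ t ∈ Ioo (-((n : ℝ) + 1)) (n + 1), HasDerivAt α (F (α t)) t := by
    intro n
    have hn : (0 : ℝ) ≤ n + 1 := by positivity
    have hpl : IsPicardLindelof (fun _ => F) (tmin := -((n : ℝ) + 1)) (tmax := n + 1)
        ⟨0, by simp only [mem_Icc]; constructor <;> linarith⟩ x₀ (⟨C, hC⟩ * ⟨n + 1, hn⟩) 0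
        ⟨C, hC⟩ K := by
      refine IsPicardLindelof.of_time_independent (fun x _ => hb x) hF.lipschitzOnWith ?_
      exact le_of_eq (by simp; rfl)
    obtain ⟨α, h0, hα⟩ := hpl.exists_eq_forall_mem_Icc_hasDerivWithinAt₀
    exact ⟨α, h0, fun t ht => (hα t (Ioo_subset_Icc_self ht)).hasDerivAt (Icc_mem_nhds ht.1 ht.2)⟩
  choose α h0 hα using hloc
  have heq : ∀ m n : ℕ, m ≤ n → EqOn (α m) (α n) (Ioo (-((m : ℝ) + 1)) (m + 1)) := by
    intro m n hmn
    have hmn' : (m : ℝ) ≤ n := by exact_mod_cast hmn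
    have hm : (0 : ℝ) ≤ m := m.cast_nonneg
    refine ODE_solution_unique_of_mem_Ioo (v := fun _ => F) (s := fun _ => univ) (K := K) (t₀ := 0)
      (fun t _ => hF.lipschitzOnWith) ⟨by linarith, by linarith⟩ (fun t ht => ⟨hα m t ht, trivial⟩)
      (fun t ht => ⟨hα n t ⟨by linarith [ht.1], by linarith [ht.2]⟩, trivial⟩) ?_
    rw [h0, h0]
  -- The `n`-th solution lives on `|t| < n + 1`, so the index `⌈|t|⌉₊` always puts `t` in the
  -- interior.
  refine ⟨fun t => α ⌈|t|⌉₊ t, by simp [h0], fun t => ?_⟩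
  have hmem : ∀ s : ℝ, s ∈ Ioo (-((⌈|s|⌉₊ : ℝ) + 1)) (⌈|s|⌉₊ + 1) := fun s => by
    have := Nat.le_ceil |s|
    exact abs_lt.1 (by linarith)
  refine (hα ⌈|t|⌉₊ t (hmem t)).congr_of_eventuallyEq ?_
  filter_upwards [Ioo_mem_nhds (hmem t).1 (hmem t).2] with s hs
  rcases le_total ⌈|s|⌉₊ ⌈|t|⌉₊ with h | h
  · exact heq _ _ h (hmem s)
  · exact (heq _ _ h hs).symm

section Solution

variable {E : Type*} [NormedAddCommGroup E] [NormedSpace ℝ E] {F : E → E} {γ : ℝ → E}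

theorem norm_sub_le_of_solution {C : ℝ} (hb : ∀ x, ‖F x‖ ≤ C)
    (hγ : ∀ t, HasDerivAt γ (F (γ t)) t) (s t : ℝ) : ‖γ t - γ s‖ ≤ C * |t - s| :=
  Convex.norm_image_sub_le_of_norm_hasDerivWithin_le (s := univ)
    (fun x _ => (hγ x).hasDerivWithinAt) (fun _ _ => hb _) convex_univ (mem_univ _) (mem_univ _)

/-- Mean value inequality for `γ s - s • F (γ t)`, whose derivative `F (γ s) - F (γ t)` has size at
most `K C h`. -/
theorem norm_sub_euler_le_of_solution {K : NNReal} (hF : LipschitzWith K F) {C : ℝ}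
    (hb : ∀ x, ‖F x‖ ≤ C) (hγ : ∀ t, HasDerivAt γ (F (γ t)) t) (t : ℝ) {h : ℝ} (hh : 0 ≤ h) :
    ‖γ (t + h) - γ t - h • F (γ t)‖ ≤ K * C * h ^ 2 := by
  have hC : 0 ≤ C := (norm_nonneg _).trans (hb (γ t))
  have hder : ∀ s ∈ Icc t (t + h), HasDerivWithinAt (fun s => γ s - s • F (γ t))
      (F (γ s) - (1 : ℝ) • F (γ t)) (Icc t (t + h)) s := fun s _ =>
    ((hγ s).sub ((hasDerivAt_id s).smul_const _)).hasDerivWithinAt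
  have := Convex.norm_image_sub_le_of_norm_hasDerivWithin_le (C := K * (C * h)) hder
    (fun s hs => ?_) (convex_Icc _ _) (left_mem_Icc.2 (by linarith)) (right_mem_Icc.2 (by linarith))
  · rw [add_sub_cancel_left, Real.norm_eq_abs, abs_of_nonneg hh] at this
    calc _ = ‖γ (t + h) - (t + h) • F (γ t) - (γ t - t • F (γ t))‖ := by
          congr 1; rw [add_smul]; abel
      _ ≤ _ := this
      _ = _ := by ring
  · rw [one_smul]
    refine (hF.norm_sub_le _ _).trans ?_
    refine mul_le_mul_of_nonneg_left ((norm_sub_le_of_solution hb hγ t s).trans ?_) K.2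
    refine mul_le_mul_of_nonneg_left ?_ hC
    rw [abs_of_nonneg (by linarith [hs.1])]
    linarith [hs.2]

end Solution

/-! ### The characteristic flow -/

variable {K₁ K₂ : Factor} {V : Measure (Domain K₁ K₂) → Domain K₁ K₂ → Vec}

theorem VelocityLipschitzInMeasure.norm_sub_le {C₃ : ℝ} (hC₃ : 0 ≤ C₃)
    (hA3 : VelocityLipschitzInMeasure V C₃) {ν₁ ν₂ : Measure (Domain K₁ K₂)}
    [h₁ : IsProbabilityMeasure ν₁] [h₂ : IsProbabilityMeasure ν₂] {w : ℝ} (hw : 0 ≤ w)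
    (h : dW ν₁ ν₂ ≤ ENNReal.ofReal w) (x : Domain K₁ K₂) : ‖V ν₁ x - V ν₂ x‖ ≤ C₃ * w := by
  have := (hA3 ν₁ ν₂ h₁ h₂ x).trans (mul_le_mul_right h _)
  rw [← ENNReal.ofReal_mul hC₃] at this
  exact (ENNReal.ofReal_le_ofReal_iff (by positivity)).1 this

theorem VelocityLipschitzInSpace.continuous {C₂ : ℝ}
    (hA2 : VelocityLipschitzInSpace V C₂) (ν : Measure (Domain K₁ K₂))
    [h : IsProbabilityMeasure ν] : Continuous (V ν) := by
  refine (LipschitzWith.of_dist_le_mul (K := C₂.toNNReal) fun x y => ?_).continuous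
  rw [dist_eq_norm]
  exact (hA2 ν h x y).trans (mul_le_mul_of_nonneg_right (Real.le_coe_toNNReal _) dist_nonneg)

/-- Displacement of a point of the domain. -/
noncomputable def shift (D : Domain K₁ K₂ →ᵇ Vec) (x : Domain K₁ K₂) : Domain K₁ K₂ :=
  x + cover (D x)

theorem continuous_shift (D : Domain K₁ K₂ →ᵇ Vec) : Continuous (shift D) :=
  continuous_id.add (continuous_cover.comp D.continuous)

theorem dist_shift_le (D D' : Domain K₁ K₂ →ᵇ Vec) (x : Domain K₁ K₂) :
    dist (shift D x) (shift D' x) ≤ ‖D - D'‖ :=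
  (dist_add_cover_self_le _ _ _).trans ((D - D').norm_coe_le_norm x)

theorem isProbabilityMeasure_map_shift (μ₀ : Measure (Domain K₁ K₂)) [IsProbabilityMeasure μ₀]
    (D : Domain K₁ K₂ →ᵇ Vec) : IsProbabilityMeasure (μ₀.map (shift D)) :=
  Measure.isProbabilityMeasure_map (continuous_shift D).aemeasurable

/-- The nonlocal equation becomes an ordinary one for the displacement field. The Lipschitz constant
has a share `C₂` from the moved point and a share `C₃` from the moved measure; the latter because
the two displacements themselves couple the push-forwards at distance `‖D - D'‖`. -/
theorem exists_velocity_operator {C₁ C₂ C₃ : ℝ} (hC₁ : 0 < C₁) (hC₂ : 0 < C₂) (hC₃ : 0 < C₃)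
    (hA1 : VelocityBound V C₁) (hA2 : VelocityLipschitzInSpace V C₂)
    (hA3 : VelocityLipschitzInMeasure V C₃) (μ₀ : Measure (Domain K₁ K₂))
    [IsProbabilityMeasure μ₀] :
    ∃ F : (Domain K₁ K₂ →ᵇ Vec) → (Domain K₁ K₂ →ᵇ Vec),
      (∀ D x, F D x = V (μ₀.map (shift D)) (shift D x)) ∧
      LipschitzWith (C₂ + C₃).toNNReal F ∧ ∀ D, ‖F D‖ ≤ C₁ := by
  have hprob := isProbabilityMeasure_map_shift μ₀
  refine ⟨fun D => BoundedContinuousFunction.ofNormedAddCommGroup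
    (fun x => V (μ₀.map (shift D)) (shift D x))
    ((hA2.continuous _).comp (continuous_shift D)) C₁ fun x => hA1 _ (hprob D) _,
    fun D x => rfl, ?_, fun D => ?_⟩
  · refine LipschitzWith.of_dist_le_mul fun D D' => ?_
    rw [Real.coe_toNNReal _ (by positivity)]
    refine (BoundedContinuousFunction.dist_le (by positivity)).2 fun x => ?_
    change dist (V (μ₀.map (shift D)) (shift D x)) (V (μ₀.map (shift D')) (shift D' x)) ≤ _
    have hw : dW (μ₀.map (shift D)) (μ₀.map (shift D')) ≤ ENNReal.ofReal ‖D - D'‖ :=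
      dW_map_le_of_dist_le (continuous_shift D).measurable (continuous_shift D').measurable
        (norm_nonneg _) (dist_shift_le D D')
    have h1 := hA3.norm_sub_le hC₃.le (norm_nonneg _) hw (shift D' x)
    have h2 := (hA2 _ (hprob D) (shift D x) (shift D' x)).trans
      (mul_le_mul_of_nonneg_left (dist_shift_le D D' x) hC₂.le)
    rw [dist_eq_norm D, add_mul]
    exact (dist_triangle _ (V (μ₀.map (shift D)) (shift D' x)) _).trans
      (add_le_add (by rwa [dist_eq_norm]) (by rwa [dist_eq_norm]))
  · exact BoundedContinuousFunction.norm_ofNormedAddCommGroup_le _ hC₁.le fun x => hA1 _ (hprob D) _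

end LaxFriedrichs

namespace LaxFriedrichs

/-! ### Derivatives of test functions -/

variable {K₁ K₂ : Factor}

/-- The lift to `ℝ × ℝ × ℝ` of a function on the domain and time. -/
noncomputable def lift (φ : Domain K₁ K₂ → ℝ → ℝ) (p : ℝ × ℝ × ℝ) : ℝ :=
  φ (pt (K₁.proj p.1) (K₂.proj p.2.1)) p.2.2

/-- The derivative of `φ` in the space-time direction `(v, 1)`. -/
noncomputable def directional (φ : Domain K₁ K₂ → ℝ → ℝ) (z : Domain K₁ K₂) (t : ℝ) (v : Vec) : ℝ :=
  partialT φ z t + (v.fst * partialX φ z t + v.snd * partialY φ z t)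

/-- Translation by `proj h` lifts to addition of `h`, so the partial derivatives are the values of
the derivative of the lift on the coordinate vectors; linearity gives the rest. -/
theorem directional_cover {φ : Domain K₁ K₂ → ℝ → ℝ} (hφ : ContDiff ℝ ∞ (lift φ)) (w v : Vec)
    (t : ℝ) :
    directional φ (cover w) t v = fderiv ℝ (lift φ) (w.fst, w.snd, t) (v.fst, v.snd, 1) := by
  have hd : HasFDerivAt (lift φ) (fderiv ℝ (lift φ) (w.fst, w.snd, t)) (w.fst, w.snd, t) :=
    (hφ.differentiable (by simp)).differentiableAt.hasFDerivAt
  set L := fderiv ℝ (lift φ) (w.fst, w.snd, t) with hL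
  have hX : partialX φ (cover w) t = L (1, 0, 0) := by
    have h1 : HasDerivAt (fun h : ℝ => (w.fst + h, w.snd, t)) ((1 : ℝ), (0 : ℝ), (0 : ℝ)) 0 :=
      ((hasDerivAt_id (0 : ℝ)).const_add _).prodMk (hasDerivAt_const _ _)
    have h2 := HasFDerivAt.comp_hasDerivAt (0 : ℝ) (by simpa using hd) h1
    refine HasDerivAt.deriv (h2.congr_of_eventuallyEq (.of_forall fun h => ?_))
    simp only [Function.comp, lift, Factor.proj_add]
    rfl
  have hY : partialY φ (cover w) t = L (0, 1, 0) := by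
    have h1 : HasDerivAt (fun h : ℝ => (w.fst, w.snd + h, t)) ((0 : ℝ), (1 : ℝ), (0 : ℝ)) 0 :=
      (hasDerivAt_const _ _).prodMk (((hasDerivAt_id (0 : ℝ)).const_add _).prodMk
        (hasDerivAt_const _ _))
    have h2 := HasFDerivAt.comp_hasDerivAt (0 : ℝ) (by simpa using hd) h1
    refine HasDerivAt.deriv (h2.congr_of_eventuallyEq (.of_forall fun h => ?_))
    simp only [Function.comp, lift, Factor.proj_add]
    rfl
  have hT : partialT φ (cover w) t = L (0, 0, 1) := by
    have h1 : HasDerivAt (fun h : ℝ => (w.fst, w.snd, h)) ((0 : ℝ), (0 : ℝ), (1 : ℝ)) t :=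
      (hasDerivAt_const _ _).prodMk ((hasDerivAt_const _ _).prodMk (hasDerivAt_id t))
    exact (HasFDerivAt.comp_hasDerivAt t hd h1).deriv
  rw [directional, hX, hY, hT]
  have : ((v.fst, v.snd, 1) : ℝ × ℝ × ℝ)
      = v.fst • (1, 0, 0) + v.snd • (0, 1, 0) + (0, 0, 1) := by simp
  rw [this, map_add, map_add, map_smul, map_smul, smul_eq_mul, smul_eq_mul]
  ring

theorem hasDerivAt_directional {φ : Domain K₁ K₂ → ℝ → ℝ} (hφ : ContDiff ℝ ∞ (lift φ))
    (x : Domain K₁ K₂) {γ : ℝ → Vec} {v : Vec} {t : ℝ} (hγ : HasDerivAt γ v t) :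
    HasDerivAt (fun s => φ (x + cover (γ s)) s) (directional φ (x + cover (γ t)) t v) t := by
  obtain ⟨u, rfl, -⟩ := exists_cover_eq x
  have hd : HasFDerivAt (lift φ) (fderiv ℝ (lift φ) ((u + γ t).fst, (u + γ t).snd, t))
      ((u + γ t).fst, (u + γ t).snd, t) :=
    (hφ.differentiable (by simp)).differentiableAt.hasFDerivAt
  have hpath : HasDerivAt (fun s => ((u + γ s).fst, (u + γ s).snd, s)) (v.fst, v.snd, (1 : ℝ)) t := by
    have h1 := hγ.const_add u
    have hf : HasDerivAt (fun s => (u + γ s).fst) v.fst t :=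
      (WithLp.fstL 2 ℝ ℝ ℝ).hasFDerivAt.comp_hasDerivAt t h1
    have hs : HasDerivAt (fun s => (u + γ s).snd) v.snd t :=
      (WithLp.sndL 2 ℝ ℝ ℝ).hasFDerivAt.comp_hasDerivAt t h1
    exact hf.prodMk (hs.prodMk (hasDerivAt_id t))
  have hfinal := HasFDerivAt.comp_hasDerivAt t hd hpath
  rw [← map_add, directional_cover hφ]
  refine hfinal.congr_of_eventuallyEq (.of_forall fun s => ?_)
  simp only [Function.comp, ← map_add]
  rfl

theorem hasDerivAt_directional_line {φ : Domain K₁ K₂ → ℝ → ℝ} (hφ : ContDiff ℝ ∞ (lift φ))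
    (z : Domain K₁ K₂) (t : ℝ) (v : Vec) :
    HasDerivAt (fun r => φ (z + cover (r • v)) (t + r)) (directional φ z t v) 0 := by
  have h : HasDerivAt (fun s : ℝ => (s - t) • v) v (t + 0) := by
    simpa using ((hasDerivAt_id (t + 0)).sub_const t).smul_const v
  have h1 := HasDerivAt.comp_const_add t 0 (hasDerivAt_directional hφ z h)
  simpa using h1

/-- Only one-sided difference quotients are needed. Growth bounds for functions that are merely
Lipschitz therefore pass to their mollifications without differentiating the former. -/
theorem directional_le {φ : Domain K₁ K₂ → ℝ → ℝ} (hφ : ContDiff ℝ ∞ (lift φ))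
    {z : Domain K₁ K₂} {t : ℝ} {v : Vec} {M ε : ℝ} (hε : 0 < ε)
    (h : ∀ r, 0 < r → r < ε → φ (z + cover (r • v)) (t + r) - φ z t ≤ M * r) :
    directional φ z t v ≤ M := by
  have h1 := (hasDerivAt_directional_line hφ z t v).tendsto_slope_zero_right
  refine le_of_tendsto h1 ?_
  filter_upwards [Ioo_mem_nhdsGT hε] with r hr
  have h2 := h r hr.1 hr.2
  simp only [zero_add, zero_smul, map_zero, add_zero, smul_eq_mul]
  rw [inv_mul_le_iff₀ hr.1, mul_comm]
  exact h2

/-- Joint continuity of a function on the domain and time whose lift is continuous. -/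
theorem continuous_of_continuous_lift {φ : Domain K₁ K₂ → ℝ → ℝ} (hφ : Continuous (lift φ)) :
    Continuous fun p : Domain K₁ K₂ × ℝ => φ p.1 p.2 := by
  rw [continuous_iff_continuousAt]
  rintro ⟨z, t⟩
  obtain ⟨u, rfl, -⟩ := exists_cover_eq z
  rw [Metric.continuousAt_iff]
  intro ε hε
  have h1 : Continuous fun p : Vec × ℝ => lift φ (p.1.fst, p.1.snd, p.2) := by fun_prop
  obtain ⟨δ, hδ, h⟩ := Metric.continuousAt_iff.1 (h1.continuousAt (x := (u, t))) ε hε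
  refine ⟨δ, hδ, ?_⟩
  rintro ⟨z', t'⟩ hz
  obtain ⟨w, hw, hw'⟩ := exists_cover_eq (z' - cover u)
  have hz' : z' = cover (u + w) := by rw [map_add, hw]; abel
  rw [hz']
  refine h (x := (u + w, t')) ?_
  rw [Prod.dist_eq, max_lt_iff] at hz ⊢
  refine ⟨?_, hz.2⟩
  have := hz.1
  rw [dist_eq_norm] at this ⊢
  simpa [hw'] using this

/-- Each partial derivative is the derivative of a jointly continuous function with respect to a
parameter, hence measurable on the quotient. -/
theorem measurable_directional {φ : Domain K₁ K₂ → ℝ → ℝ}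
    (hφ : Continuous fun p : Domain K₁ K₂ × ℝ => φ p.1 p.2) {b : Domain K₁ K₂ → Vec}
    (hb : Measurable b) (t : ℝ) : Measurable fun z => directional φ z t (b z) := by
  have hproj : ∀ K : Factor, Continuous K.proj := fun K => by
    refine (LipschitzWith.of_dist_le_mul (K := 1) fun x y => ?_).continuous
    have : K.proj x = K.proj (x - y) + K.proj y := by rw [← Factor.proj_add]; simp
    rw [dist_eq_norm, this, add_sub_cancel_right, NNReal.coe_one, one_mul]
    exact K.norm_proj_le _
  have h1 := hproj K₁
  have h2 := hproj K₂
  have hT : Measurable fun z => partialT φ z t :=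
    (measurable_deriv_with_param (f := fun (z : Domain K₁ K₂) s => φ z s) hφ).comp
      (measurable_id.prodMk measurable_const)
  have hX : Measurable fun z => partialX φ z t :=
    (measurable_deriv_with_param
      (f := fun (z : Domain K₁ K₂) h => φ (pt (z.fst + K₁.proj h) z.snd) t)
      (hφ.comp (f := fun p : Domain K₁ K₂ × ℝ => (pt (p.1.fst + K₁.proj p.2) p.1.snd, t))
        (by fun_prop))).comp (measurable_id.prodMk measurable_const)
  have hY : Measurable fun z => partialY φ z t :=
    (measurable_deriv_with_param
      (f := fun (z : Domain K₁ K₂) h => φ (pt z.fst (z.snd + K₂.proj h)) t)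
      (hφ.comp (f := fun p : Domain K₁ K₂ × ℝ => (pt p.1.fst (p.1.snd + K₂.proj p.2), t))
        (by fun_prop))).comp (measurable_id.prodMk measurable_const)
  have hb1 : Measurable fun z => (b z).fst := (WithLp.fstL 2 ℝ ℝ ℝ).continuous.measurable.comp hb
  have hb2 : Measurable fun z => (b z).snd := (WithLp.sndL 2 ℝ ℝ ℝ).continuous.measurable.comp hb
  exact hT.add ((hb1.mul hX).add (hb2.mul hY))

theorem directional_eq_zero {φ : Domain K₁ K₂ → ℝ → ℝ} (hφ : IsTestFunction φ)
    {z : Domain K₁ K₂} {t : ℝ}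
    (h : (z, t) ∉ tsupport fun p : Domain K₁ K₂ × ℝ => φ p.1 p.2) (v : Vec) :
    directional φ z t v = 0 := by
  have h1 := hasDerivAt_directional_line hφ.1 z t v
  have h2 : ∀ᶠ r : ℝ in 𝓝 0, φ (z + cover (r • v)) (t + r) = 0 := by
    have hc : Continuous fun r : ℝ => (z + cover (r • v), t + r) :=
      (continuous_const.add (continuous_cover.comp (by fun_prop))).prodMk (by fun_prop)
    have h3 := (notMem_tsupport_iff_eventuallyEq.1 h)
    have h4 : Tendsto (fun r : ℝ => (z + cover (r • v), t + r)) (𝓝 0) (𝓝 (z, t)) := by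
      simpa using hc.tendsto 0
    exact h4.eventually h3
  exact h1.unique ((hasDerivAt_const (0 : ℝ) (0 : ℝ)).congr_of_eventuallyEq h2)

theorem IsTestFunction.exists_bound {φ : Domain K₁ K₂ → ℝ → ℝ} (hφ : IsTestFunction φ) :
    ∃ R, 0 < R ∧ (∀ z t, R < |t| → φ z t = 0) ∧ (∀ z t v, R < |t| → directional φ z t v = 0) ∧
      (∀ z t v, |directional φ z t v| ≤ R * (1 + ‖v‖)) := by
  obtain ⟨R₀, hR₀⟩ := hφ.2.isCompact.isBounded.subset_closedBall (0 : Domain K₁ K₂ × ℝ)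
  have hmem : ∀ z t, (z, t) ∈ tsupport (fun p : Domain K₁ K₂ × ℝ => φ p.1 p.2) →
      ‖z‖ ≤ R₀ ∧ |t| ≤ R₀ := fun z t h => by
    simpa [Prod.norm_def] using hR₀ h
  -- On a torus the lift is periodic rather than compactly supported. A bound on one ball suffices,
  -- since each point of the support has a lift of the same norm.
  obtain ⟨C, hC⟩ := (isCompact_closedBall (0 : ℝ × ℝ × ℝ) R₀).exists_bound_of_continuousOn
    ((hφ.1.continuous_fderiv (by simp)).continuousOn)
  refine ⟨max 1 (max R₀ C), by positivity, fun z t ht => ?_, fun z t v ht => ?_, fun z t v => ?_⟩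
  · refine image_eq_zero_of_notMem_tsupport (f := fun p : Domain K₁ K₂ × ℝ => φ p.1 p.2)
      (x := (z, t)) fun h => ?_
    exact absurd (hmem z t h).2 (not_le.2 (lt_of_le_of_lt (by simp) ht))
  · refine directional_eq_zero hφ (fun h => ?_) v
    exact absurd (hmem z t h).2 (not_le.2 (lt_of_le_of_lt (by simp) ht))
  · by_cases h : (z, t) ∈ tsupport (fun p : Domain K₁ K₂ × ℝ => φ p.1 p.2)
    · obtain ⟨w, rfl, hw⟩ := exists_cover_eq z
      obtain ⟨h1, h2⟩ := hmem _ _ h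
      rw [← hw] at h1
      rw [directional_cover hφ.1]
      have hb := hC (w.fst, w.snd, t) (by
        rw [mem_closedBall_zero_iff, Prod.norm_def, Prod.norm_def]
        exact max_le ((WithLp.norm_fst_le _ w).trans h1)
          (max_le ((WithLp.norm_snd_le _ w).trans h1) h2))
      have hv : ‖((v.fst, v.snd, 1) : ℝ × ℝ × ℝ)‖ ≤ 1 + ‖v‖ := by
        rw [Prod.norm_def, Prod.norm_def]
        have := WithLp.norm_fst_le (p := 2) _ v
        have := WithLp.norm_snd_le (p := 2) _ v
        have := norm_nonneg v
        refine max_le (by dsimp only; linarith) (max_le (by dsimp only; linarith) ?_)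
        rw [norm_one]; linarith
      refine ((fderiv ℝ (lift φ) (w.fst, w.snd, t)).le_opNorm _).trans ?_
      exact mul_le_mul (hb.trans (by simp)) hv (norm_nonneg _) (by positivity)
    · rw [directional_eq_zero hφ h, abs_zero]
      positivity

end LaxFriedrichs

namespace LaxFriedrichs

/-! ### Existence of a solution -/

variable {K₁ K₂ : Factor} {V : Measure (Domain K₁ K₂) → Domain K₁ K₂ → Vec}

theorem continuous_shift_uncurry {D : ℝ → (Domain K₁ K₂ →ᵇ Vec)} (hD : Continuous D) :
    Continuous fun p : Domain K₁ K₂ × ℝ => shift (D p.2) p.1 :=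
  continuous_fst.add (continuous_cover.comp ((hD.comp continuous_snd).eval continuous_fst))

/-- After the change of variables to `μ₀` and Fubini, the inner integral over time is that of the
derivative of `φ` along one particle path; it equals `-φ x 0` because `φ` vanishes at late times. -/
theorem isMeasureValuedSolution_of_flow {C₁ C₂ : ℝ} (hA1 : VelocityBound V C₁)
    (hA2 : VelocityLipschitzInSpace V C₂) (μ₀ : Measure (Domain K₁ K₂)) [IsProbabilityMeasure μ₀]
    {F : (Domain K₁ K₂ →ᵇ Vec) → (Domain K₁ K₂ →ᵇ Vec)}
    (hF : ∀ D x, F D x = V (μ₀.map (shift D)) (shift D x)) {D : ℝ → (Domain K₁ K₂ →ᵇ Vec)}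
    (hD0 : D 0 = 0) (hD : ∀ t, HasDerivAt D (F (D t)) t) :
    IsMeasureValuedSolution V μ₀ fun t => μ₀.map (shift (D t)) := by
  have hprob := isProbabilityMeasure_map_shift μ₀
  have hDc : Continuous D := continuous_iff_continuousAt.2 fun t => (hD t).continuousAt
  have hjoint := continuous_shift_uncurry hDc
  have key : ∀ φ : Domain K₁ K₂ → ℝ → ℝ, IsTestFunction φ →
      IntegrableOn (weakIntegrand V (fun t => μ₀.map (shift (D t))) φ) (Ioi 0) ∧
      (∫ t in Ioi 0, weakIntegrand V (fun t => μ₀.map (shift (D t))) φ t) + ∫ z, φ z 0 ∂μ₀ = 0 := by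
    intro φ hφ
    obtain ⟨R, hR, hφR, hdR, hdb⟩ := hφ.exists_bound
    have hφc := continuous_of_continuous_lift hφ.1.continuous
    have hder : ∀ x t, HasDerivAt (fun s => φ (shift (D s) x) s)
        (directional φ (shift (D t) x) t (F (D t) x)) t := by
      intro x t
      have h : HasDerivAt (fun s => D s x) (F (D t) x) t :=
        (BoundedContinuousFunction.evalCLM ℝ x : (Domain K₁ K₂ →ᵇ Vec) →L[ℝ] Vec).hasFDerivAt
          |>.comp_hasDerivAt t (hD t)
      exact hasDerivAt_directional hφ.1 x h
    set H : ℝ → Domain K₁ K₂ → ℝ := fun t x => directional φ (shift (D t) x) t (F (D t) x) with hH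
    -- `H` is the time derivative of a jointly continuous function of position and time, which gives
    -- joint measurability at once.
    have hHm : Measurable fun p : ℝ × Domain K₁ K₂ => H p.1 p.2 := by
      have := (measurable_deriv_with_param (f := fun (x : Domain K₁ K₂) s => φ (shift (D s) x) s)
        (hφc.comp (hjoint.prodMk continuous_snd))).comp measurable_swap
      convert this using 1
      exact funext fun p => (hder p.2 p.1).deriv.symm
    have hHb : ∀ t x, ‖H t x‖ ≤ R * (1 + C₁) := fun t x => by
      refine (hdb _ _ _).trans ?_
      gcongr
      rw [hF]
      exact hA1 _ (hprob _) _
    have hw : ∀ t, weakIntegrand V (fun t => μ₀.map (shift (D t))) φ t = ∫ x, H t x ∂μ₀ := by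
      intro t
      have h1 : Measurable fun z => directional φ z t (V (μ₀.map (shift (D t))) z) :=
        measurable_directional hφc (hA2.continuous _ (h := hprob _)).measurable t
      have := integral_map (μ := μ₀) (continuous_shift (D t)).aemeasurable h1.aestronglyMeasurable
      simp only [hH, hF]
      exact this
    have hzero : ∀ t ∈ Ioi (0 : ℝ) \ Ioc 0 R,
        weakIntegrand V (fun t => μ₀.map (shift (D t))) φ t = 0 := by
      intro t ht
      have : R < |t| := by
        by_contra hcon
        exact ht.2 ⟨ht.1, (le_abs_self t).trans (not_lt.1 hcon)⟩
      rw [hw]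
      simp only [hH, hdR _ _ _ this, integral_zero]
    have hint : Integrable (fun p : ℝ × Domain K₁ K₂ => H p.1 p.2)
        ((volume.restrict (Ioc 0 R)).prod μ₀) :=
      Integrable.of_bound hHm.aestronglyMeasurable (R * (1 + C₁))
        (.of_forall fun p => hHb p.1 p.2)
    have hion : IntegrableOn (weakIntegrand V (fun t => μ₀.map (shift (D t))) φ) (Ioc 0 R) := by
      simp_rw [funext hw]
      exact hint.integral_prod_left
    refine ⟨hion.of_forall_sdiff_eq_zero measurableSet_Ioi hzero, ?_⟩
    rw [setIntegral_eq_of_subset_of_forall_sdiff_eq_zero measurableSet_Ioi Ioc_subset_Ioi_self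
      hzero]
    simp_rw [hw]
    rw [integral_integral_swap hint]
    have hftc : ∀ x, ∫ t in Ioc 0 R, H t x = -φ x 0 := by
      intro x
      have hm : Measurable fun t => H t x := hHm.comp (measurable_id.prodMk measurable_const)
      rw [← intervalIntegral.integral_of_le hR.le,
        intervalIntegral.integral_eq_sub_of_hasDerivAt (fun t _ => hder x t)]
      · have hcont : Continuous fun t => φ (shift (D t) x) t :=
          continuous_iff_continuousAt.2 fun t => (hder x t).continuousAt
        -- The vanishing is known for times beyond `R` only; continuity extends it to `R`.
        have hend : φ (shift (D R) x) R = 0 := by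
          refine tendsto_nhds_unique (hcont.continuousWithinAt (s := Ioi R) (x := R)).tendsto
            (tendsto_const_nhds.congr' ?_)
          filter_upwards [self_mem_nhdsWithin] with t ht
          exact (hφR _ _ (lt_of_lt_of_le ht (le_abs_self t))).symm
        have h0 : shift (D 0) x = x := by simp [shift, hD0]
        rw [hend, h0, zero_sub]
      · rw [intervalIntegrable_iff_integrableOn_Ioc_of_le hR.le]
        exact Integrable.of_bound hm.aestronglyMeasurable (R * (1 + C₁))
          (.of_forall fun t => hHb t x)
    simp_rw [hftc]
    rw [integral_neg, neg_add_cancel]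
  refine ⟨fun t _ => hprob _, fun g => ?_, fun φ hφ => (key φ hφ).1, fun φ hφ => (key φ hφ).2⟩
  have h1 : ∀ t, ∫ z, g z ∂(μ₀.map (shift (D t))) = ∫ x, g (shift (D t) x) ∂μ₀ := fun t =>
    integral_map (continuous_shift _).aemeasurable g.continuous.aestronglyMeasurable
  simp_rw [h1]
  refine Continuous.continuousOn (continuous_of_dominated (bound := fun _ => ‖g.toBCF‖)
    (fun t => (g.continuous.comp (continuous_shift _)).aestronglyMeasurable)
    (fun t => .of_forall fun x => g.toBCF.norm_coe_le_norm _) (integrable_const _)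
    (.of_forall fun x => ?_))
  exact g.continuous.comp (hjoint.comp (continuous_const.prodMk continuous_id))

end LaxFriedrichs

namespace LaxFriedrichs

/-! ### Smooth steps -/

/-- A smooth step from `0` to `1` over the interval `[b, b + k]`. -/
noncomputable def smoothStep (b k t : ℝ) : ℝ := Real.smoothTransition ((t - b) / k)

theorem contDiff_smoothStep (b k : ℝ) : ContDiff ℝ ∞ (smoothStep b k) :=
  Real.smoothTransition.contDiff.comp ((contDiff_id.sub contDiff_const).div_const _)

theorem differentiable_smoothStep (b k : ℝ) : Differentiable ℝ (smoothStep b k) :=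
  (contDiff_smoothStep b k).differentiable (by simp)

theorem continuous_deriv_smoothStep (b k : ℝ) : Continuous (deriv (smoothStep b k)) :=
  (contDiff_smoothStep b k).continuous_deriv (by simp)

theorem monotone_smoothStep (b : ℝ) {k : ℝ} (hk : 0 < k) : Monotone (smoothStep b k) :=
  fun s t hst => Real.smoothTransition.monotone (by gcongr)

theorem smoothStep_nonneg (b k t : ℝ) : 0 ≤ smoothStep b k t := Real.smoothTransition.nonneg _

theorem smoothStep_le_one (b k t : ℝ) : smoothStep b k t ≤ 1 := Real.smoothTransition.le_one _

theorem smoothStep_eq_zero {b k t : ℝ} (hk : 0 < k) (ht : t ≤ b) : smoothStep b k t = 0 :=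
  Real.smoothTransition.zero_of_nonpos (div_nonpos_of_nonpos_of_nonneg (by linarith) hk.le)

theorem smoothStep_eq_one {b k t : ℝ} (hk : 0 < k) (ht : b + k ≤ t) : smoothStep b k t = 1 :=
  Real.smoothTransition.one_of_one_le ((one_le_div₀ hk).2 (by linarith))

theorem smoothStep_le_of_le {a b k t : ℝ} (hk : 0 < k) (hab : a ≤ b) :
    smoothStep b k t ≤ smoothStep a k t :=
  Real.smoothTransition.monotone (by gcongr)

theorem deriv_smoothStep_of_lt {b k t : ℝ} (hk : 0 < k) (ht : t < b) :
    deriv (smoothStep b k) t = 0 := by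
  have : smoothStep b k =ᶠ[𝓝 t] fun _ => 0 := by
    filter_upwards [Iio_mem_nhds ht] with s hs
    exact smoothStep_eq_zero hk (le_of_lt hs)
  rw [this.deriv_eq, deriv_const]

theorem deriv_smoothStep_of_gt {b k t : ℝ} (hk : 0 < k) (ht : b + k < t) :
    deriv (smoothStep b k) t = 0 := by
  have : smoothStep b k =ᶠ[𝓝 t] fun _ => 1 := by
    filter_upwards [Ioi_mem_nhds ht] with s hs
    exact smoothStep_eq_one hk (le_of_lt hs)
  rw [this.deriv_eq, deriv_const]

/-- The point `b` belongs neither to the half-open interval nor to the range of the strict lemmas;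
being a null set, it is excluded. -/
theorem deriv_smoothStep_mul_eq_zero {g : ℝ → ℝ} {b k : ℝ} (hk : 0 < k) :
    ∀ t ∈ Ioi (0 : ℝ) \ Ioc b (b + k), t ≠ b → deriv (smoothStep b k) t * g t = 0 := by
  intro t ht htb
  rcases lt_or_gt_of_ne htb with h | h
  · rw [deriv_smoothStep_of_lt hk h, zero_mul]
  · rw [deriv_smoothStep_of_gt hk, zero_mul]
    by_contra hcon
    exact ht.2 ⟨h, not_lt.1 hcon⟩

theorem setIntegral_deriv_smoothStep_mul {g : ℝ → ℝ} {b k : ℝ} (hb : 0 ≤ b) (hk : 0 < k) :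
    ∫ t in Ioi 0, deriv (smoothStep b k) t * g t
      = ∫ t in b..(b + k), deriv (smoothStep b k) t * g t := by
  rw [intervalIntegral.integral_of_le (by linarith)]
  refine setIntegral_eq_of_subset_of_ae_sdiff_eq_zero measurableSet_Ioi.nullMeasurableSet
    (fun t ht => lt_of_le_of_lt hb ht.1) ?_
  filter_upwards [Measure.ae_ne volume b] with t htb ht
  exact deriv_smoothStep_mul_eq_zero hk t ht htb

theorem integrableOn_deriv_smoothStep_mul {g : ℝ → ℝ} (hg : ContinuousOn g (Ici 0)) {b k : ℝ}
    (hb : 0 ≤ b) (hk : 0 < k) :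
    IntegrableOn (fun t => deriv (smoothStep b k) t * g t) (Ioi 0) := by
  have h1 : IntegrableOn (fun t => deriv (smoothStep b k) t * g t) (Ioc b (b + k)) := by
    refine (ContinuousOn.integrableOn_Icc ?_).mono_set Ioc_subset_Icc_self
    exact (continuous_deriv_smoothStep b k).continuousOn.mul
      (hg.mono fun t ht => hb.trans ht.1)
  refine h1.of_ae_sdiff_eq_zero measurableSet_Ioi.nullMeasurableSet ?_
  filter_upwards [Measure.ae_ne volume b] with t htb ht
  exact deriv_smoothStep_mul_eq_zero hk t ht htb

/-- The derivative of the step is a probability density on `[b, b + k]`. It sees `g` only to the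
right of `b`, so that `b = 0` is allowed. -/
theorem abs_integral_deriv_smoothStep_mul_sub_le {g : ℝ → ℝ} (hg : ContinuousOn g (Ici 0))
    {b k η : ℝ} (hb : 0 ≤ b) (hk : 0 < k) (hη : ∀ t ∈ Icc b (b + k), |g t - g b| ≤ η) :
    |(∫ t in Ioi 0, deriv (smoothStep b k) t * g t) - g b| ≤ η := by
  have hbk : b ≤ b + k := by linarith
  have hd : ∫ t in b..(b + k), deriv (smoothStep b k) t = 1 := by
    rw [intervalIntegral.integral_deriv_eq_sub
      (fun t _ => (differentiable_smoothStep b k).differentiableAt)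
      ((continuous_deriv_smoothStep b k).intervalIntegrable _ _),
      smoothStep_eq_one hk le_rfl, smoothStep_eq_zero hk le_rfl, sub_zero]
  have hgi : IntervalIntegrable (fun t => deriv (smoothStep b k) t * g t) volume b (b + k) := by
    refine ContinuousOn.intervalIntegrable ?_
    rw [uIcc_of_le hbk]
    exact (continuous_deriv_smoothStep b k).continuousOn.mul (hg.mono fun t ht => hb.trans ht.1)
  rw [setIntegral_deriv_smoothStep_mul hb hk]
  have hci : ∀ c : ℝ, IntervalIntegrable (fun t => deriv (smoothStep b k) t * c) volume b (b + k) :=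
    fun c => ((continuous_deriv_smoothStep b k).mul continuous_const).intervalIntegrable _ _
  have h1 : (∫ t in b..(b + k), deriv (smoothStep b k) t * g t) - g b
      = ∫ t in b..(b + k), deriv (smoothStep b k) t * (g t - g b) := by
    simp_rw [mul_sub]
    rw [intervalIntegral.integral_sub hgi (hci _),
      intervalIntegral.integral_mul_const, hd, one_mul]
  rw [h1]
  have h2 : |∫ t in b..(b + k), deriv (smoothStep b k) t * (g t - g b)|
      ≤ ∫ t in b..(b + k), deriv (smoothStep b k) t * η := by
    rw [← Real.norm_eq_abs]
    refine intervalIntegral.norm_integral_le_of_norm_le hbk (.of_forall fun t ht => ?_) (hci η)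
    rw [norm_mul, Real.norm_eq_abs, Real.norm_eq_abs,
      abs_of_nonneg (monotone_smoothStep b hk).deriv_nonneg]
    exact mul_le_mul_of_nonneg_left (hη t (Ioc_subset_Icc_self ht))
      (monotone_smoothStep b hk).deriv_nonneg
  rwa [intervalIntegral.integral_mul_const, hd, one_mul] at h2

theorem tendsto_integral_deriv_smoothStep_mul {g : ℝ → ℝ} (hg : ContinuousOn g (Ici 0)) {b : ℝ}
    (hb : 0 ≤ b) :
    Tendsto (fun k => ∫ t in Ioi 0, deriv (smoothStep b k) t * g t) (𝓝[>] 0) (𝓝 (g b)) := by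
  rw [Metric.tendsto_nhds]
  intro ε hε
  obtain ⟨δ, hδ, h⟩ := Metric.continuousWithinAt_iff.1 (hg b hb) (ε / 2) (half_pos hε)
  filter_upwards [Ioo_mem_nhdsGT hδ] with k hk
  rw [Real.dist_eq]
  refine lt_of_le_of_lt (abs_integral_deriv_smoothStep_mul_sub_le hg hb hk.1 fun t ht => ?_)
    (half_lt_self hε)
  refine (h (hb.trans ht.1) ?_).le
  rw [Real.dist_eq, abs_of_nonneg (by linarith [ht.1])]
  linarith [ht.2, hk.2]

/-! ### The weak formulation with smooth test profiles -/

variable {K₁ K₂ : Factor} {V : Measure (Domain K₁ K₂) → Domain K₁ K₂ → Vec}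

/-- A smooth function of space and time with compact support in space, with bounds on its values
and its Lipschitz constant. -/
structure IsProfile (G : Domain K₁ K₂ → ℝ → ℝ) (B L : ℝ) : Prop where
  contDiff : ContDiff ℝ ∞ (lift G)
  bound : ∀ z s, |G z s| ≤ B
  lipschitz : ∀ z s z' s', |G z s - G z' s'| ≤ L * (dist z z' + |s - s'|)
  support : ∃ R, ∀ z s, R < ‖z‖ → G z s = 0

namespace IsProfile

variable {G : Domain K₁ K₂ → ℝ → ℝ} {B L : ℝ}

theorem continuous (hG : IsProfile G B L) : Continuous fun p : Domain K₁ K₂ × ℝ => G p.1 p.2 :=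
  continuous_of_continuous_lift hG.contDiff.continuous

theorem continuous_left (hG : IsProfile G B L) (t : ℝ) : Continuous fun z => G z t :=
  hG.continuous.comp (continuous_id.prodMk continuous_const)

theorem integrable (hG : IsProfile G B L) (ν : Measure (Domain K₁ K₂)) [IsFiniteMeasure ν]
    (t : ℝ) : Integrable (fun z => G z t) ν :=
  Integrable.of_bound (hG.continuous_left t).aestronglyMeasurable B
    (.of_forall fun z => hG.bound z t)

theorem isTestFunction (hG : IsProfile G B L) {θ : ℝ → ℝ} (hθ : ContDiff ℝ ∞ θ)
    (hc : HasCompactSupport θ) : IsTestFunction fun z t => θ t * G z t := by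
  refine ⟨(hθ.comp (contDiff_snd.comp contDiff_snd)).mul hG.contDiff, ?_⟩
  obtain ⟨R, hR⟩ := hG.support
  refine HasCompactSupport.intro ((isCompact_closedBall_domain 0 R).prod hc.isCompact) ?_
  rintro ⟨z, t⟩ h
  rw [mem_prod, not_and_or] at h
  rcases h with h | h
  · have : R < ‖z‖ := by simpa using h
    simp [hR z t this]
  · simp [image_eq_zero_of_notMem_tsupport h]

theorem directional_mul (hG : IsProfile G B L) {θ : ℝ → ℝ} (hθ : ContDiff ℝ ∞ θ)
    (z : Domain K₁ K₂) (t : ℝ) (v : Vec) :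
    directional (fun z t => θ t * G z t) z t v = deriv θ t * G z t + θ t * directional G z t v := by
  have h1 := hasDerivAt_directional_line (φ := fun z t => θ t * G z t)
    ((hθ.comp (contDiff_snd.comp contDiff_snd)).mul hG.contDiff) z t v
  have h2 := hasDerivAt_directional_line hG.contDiff z t v
  have h3 : HasDerivAt (fun r => θ (t + r)) (deriv θ t) 0 := by
    have : HasDerivAt θ (deriv θ t) (t + 0) := by
      rw [add_zero]
      exact (hθ.differentiable (by simp)).differentiableAt.hasDerivAt
    exact this.comp_const_add t 0
  have h4 := h1.unique (h3.mul h2)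
  simpa using h4

/-- Weak continuity treats the frozen slice `G z t₀`, which is continuous with compact support; the
time Lipschitz bound makes the change of slice uniformly small. -/
theorem continuousOn_integral (hG : IsProfile G B L) {μ₀ : Measure (Domain K₁ K₂)}
    {ν : ℝ → Measure (Domain K₁ K₂)} (hν : IsMeasureValuedSolution V μ₀ ν) :
    ContinuousOn (fun t => ∫ z, G z t ∂(ν t)) (Ici 0) := by
  intro t₀ ht₀
  obtain ⟨R, hR⟩ := hG.support
  have hcs : HasCompactSupport fun z => G z t₀ :=
    HasCompactSupport.intro (isCompact_closedBall_domain 0 R) fun z hz =>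
      hR z t₀ (by simpa using hz)
  let g : C₀(Domain K₁ K₂, ℝ) :=
    ⟨⟨fun z => G z t₀, hG.continuous_left t₀⟩, hcs.is_zero_at_infty⟩
  have h1 : Tendsto (fun t => ∫ z, G z t₀ ∂(ν t)) (𝓝[Ici 0] t₀) (𝓝 (∫ z, G z t₀ ∂(ν t₀))) :=
    hν.weak_cont g t₀ ht₀
  refine tendsto_of_tendsto_of_dist h1 ?_
  have h2 : Tendsto (fun t => L * |t - t₀|) (𝓝[Ici 0] t₀) (𝓝 0) := by
    have : Continuous fun t => L * |t - t₀| := by fun_prop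
    simpa using this.continuousWithinAt (s := Ici 0) (x := t₀) |>.tendsto
  refine squeeze_zero' (.of_forall fun t => dist_nonneg) ?_ h2
  filter_upwards [self_mem_nhdsWithin] with t ht
  have := hν.prob t ht
  rw [dist_comm, Real.dist_eq, ← integral_sub (hG.integrable _ _) (hG.integrable _ _)]
  have h3 := norm_integral_le_of_norm_le_const (μ := ν t) (f := fun z => G z t - G z t₀)
    (C := L * |t - t₀|) (.of_forall fun z => by simpa using hG.lipschitz z t z t₀)
  simpa using h3

/-- Testing with `θ t * G z t`, the product rule separates `deriv θ` from the growth of `G` along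
the velocity, which is replaced by its upper bound since `θ ≥ 0` at positive times. -/
theorem weak_inequality (hG : IsProfile G B L) {C₂ : ℝ}
    (hA2 : VelocityLipschitzInSpace V C₂) {μ₀ : Measure (Domain K₁ K₂)}
    {ν : ℝ → Measure (Domain K₁ K₂)} (hν : IsMeasureValuedSolution V μ₀ ν) {θ : ℝ → ℝ}
    (hθ : ContDiff ℝ ∞ θ) (hc : HasCompactSupport θ) {C₁ : ℝ} (hA1 : VelocityBound V C₁)
    (hθ0 : ∀ t, 0 < t → 0 ≤ θ t) {M : ℝ}
    (hM : ∀ t, 0 < t → θ t ≠ 0 → ∀ z, directional G z t (V (ν t) z) ≤ M) :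
    0 ≤ (∫ t in Ioi 0, deriv θ t * ∫ z, G z t ∂(ν t)) + M * (∫ t in Ioi 0, θ t)
      + θ 0 * ∫ z, G z 0 ∂μ₀ := by
  have htest := hG.isTestFunction hθ hc
  have heq := hν.weak_eq _ htest
  rw [integral_const_mul] at heq
  obtain ⟨R, hR, -, -, hdb⟩ := htest.exists_bound
  have hi1 : IntegrableOn (fun t => deriv θ t * ∫ z, G z t ∂(ν t)) (Ioi 0) := by
    have hcont : ContinuousOn (fun t => deriv θ t * ∫ z, G z t ∂(ν t)) (Ici 0) :=
      (hθ.continuous_deriv (by simp)).continuousOn.mul (hG.continuousOn_integral hν)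
    obtain ⟨T, hT⟩ := hc.deriv.isCompact.isBounded.subset_closedBall 0
    have hK : IntegrableOn (fun t => deriv θ t * ∫ z, G z t ∂(ν t)) (Icc 0 T) :=
      (hcont.mono Icc_subset_Ici_self).integrableOn_Icc
    refine (hK.of_forall_sdiff_eq_zero measurableSet_Ici fun t ht => ?_).mono_set
      Ioi_subset_Ici_self
    rw [image_eq_zero_of_notMem_tsupport (f := deriv θ), zero_mul]
    intro hcon
    have := hT hcon
    rw [mem_closedBall_zero_iff, Real.norm_eq_abs] at this
    exact ht.2 ⟨ht.1, (le_abs_self t).trans this⟩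
  have hi2 : IntegrableOn (fun t => M * θ t) (Ioi 0) :=
    ((hθ.continuous.integrable_of_hasCompactSupport hc).const_mul M).integrableOn
  have hle : ∫ t in Ioi 0, weakIntegrand V ν (fun z t => θ t * G z t) t
      ≤ ∫ t in Ioi 0, (deriv θ t * (∫ z, G z t ∂(ν t)) + M * θ t) := by
    refine setIntegral_mono_on (hν.integrable _ htest) (hi1.add hi2) measurableSet_Ioi
      fun t ht => ?_
    have := hν.prob t (le_of_lt ht)
    have h1 : Integrable (fun z => directional (fun z t => θ t * G z t) z t (V (ν t) z)) (ν t) := by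
      refine Integrable.of_bound (measurable_directional
        (continuous_of_continuous_lift (φ := fun z t => θ t * G z t) htest.1.continuous)
        (hA2.continuous (ν t)).measurable t).aestronglyMeasurable (R * (1 + C₁))
        (.of_forall fun z => (hdb _ _ _).trans ?_)
      gcongr
      exact hA1 _ this _
    have h2 : ∫ z, (deriv θ t * G z t + M * θ t) ∂(ν t)
        = deriv θ t * (∫ z, G z t ∂(ν t)) + M * θ t := by
      rw [integral_add ((hG.integrable _ _).const_mul _) (integrable_const _), integral_const_mul]
      simp
    rw [← h2]
    refine integral_mono h1 (((hG.integrable _ _).const_mul _).add (integrable_const _))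
      fun z => ?_
    change directional (fun z t => θ t * G z t) z t (V (ν t) z) ≤ _
    rw [hG.directional_mul hθ]
    by_cases h : θ t = 0
    · simp [h]
    · rw [mul_comm M]
      have := mul_le_mul_of_nonneg_left (hM t ht h z) (hθ0 t ht)
      linarith
  rw [integral_add hi1 hi2, integral_const_mul] at hle
  linarith

/-- The time factor is a difference of two smooth steps and approximates the indicator of `[a, b]`.
Its support reaches `b + k`, hence the margin `ε` in the growth bound. -/
theorem integral_sub_le (hG : IsProfile G B L) {C₁ C₂ : ℝ} (hA1 : VelocityBound V C₁)
    (hA2 : VelocityLipschitzInSpace V C₂) {μ₀ : Measure (Domain K₁ K₂)}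
    {ν : ℝ → Measure (Domain K₁ K₂)} (hν : IsMeasureValuedSolution V μ₀ ν) {a b M ε : ℝ}
    (ha : 0 ≤ a) (hab : a ≤ b) (hM0 : 0 ≤ M) (hε : 0 < ε)
    (hM : ∀ t, a < t → t ≤ b + ε → ∀ z, directional G z t (V (ν t) z) ≤ M) :
    (∫ z, G z b ∂(ν b)) - ∫ z, G z a ∂(ν a) ≤ M * (b - a) := by
  have hb : 0 ≤ b := ha.trans hab
  have hcont := hG.continuousOn_integral hν
  have hineq : ∀ k ∈ Ioo 0 ε, (∫ t in Ioi 0, deriv (smoothStep b k) t * ∫ z, G z t ∂(ν t))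
      - (∫ t in Ioi 0, deriv (smoothStep a k) t * ∫ z, G z t ∂(ν t)) ≤ M * (b - a + k) := by
    intro k hk
    set θ : ℝ → ℝ := fun t => smoothStep a k t - smoothStep b k t with hθdef
    have hθ : ContDiff ℝ ∞ θ := (contDiff_smoothStep a k).sub (contDiff_smoothStep b k)
    have hzero : ∀ t, t ∉ Icc a (b + k) → θ t = 0 := by
      intro t ht
      rw [mem_Icc, not_and_or, not_le, not_le] at ht
      simp only [hθdef]
      rcases ht with h | h
      · rw [smoothStep_eq_zero hk.1 h.le, smoothStep_eq_zero hk.1 (h.le.trans hab), sub_zero]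
      · rw [smoothStep_eq_one hk.1 h.le, smoothStep_eq_one hk.1 (by linarith), sub_self]
    have hc : HasCompactSupport θ := HasCompactSupport.intro isCompact_Icc hzero
    have h0 : θ 0 = 0 := by
      simp only [hθdef]
      rw [smoothStep_eq_zero hk.1 ha, smoothStep_eq_zero hk.1 hb, sub_zero]
    have h1 := hG.weak_inequality hA2 hν hθ hc hA1
      (fun t _ => sub_nonneg.2 (smoothStep_le_of_le hk.1 hab)) (M := M) (fun t ht hne => by
        have hta : a < t := by
          by_contra hcon
          refine hne ?_
          simp only [hθdef]
          rw [smoothStep_eq_zero hk.1 (not_lt.1 hcon),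
            smoothStep_eq_zero hk.1 ((not_lt.1 hcon).trans hab), sub_zero]
        have htb : t ≤ b + k := by
          by_contra hcon
          exact hne (hzero t fun h => hcon h.2)
        exact hM t hta (by linarith [hk.2]))
    rw [h0, zero_mul, add_zero] at h1
    have hderiv : ∀ t, deriv θ t = deriv (smoothStep a k) t - deriv (smoothStep b k) t := fun t =>
      deriv_sub (differentiable_smoothStep a k).differentiableAt
        (differentiable_smoothStep b k).differentiableAt
    simp_rw [hderiv, sub_mul] at h1
    rw [integral_sub (integrableOn_deriv_smoothStep_mul hcont ha hk.1)
      (integrableOn_deriv_smoothStep_mul hcont hb hk.1)] at h1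
    have hθint : ∫ t in Ioi 0, θ t ≤ b - a + k := by
      have h2 : ∫ t in Ioi 0, θ t = ∫ t in Ioc a (b + k), θ t := by
        refine setIntegral_eq_of_subset_of_forall_sdiff_eq_zero measurableSet_Ioi
          (fun t ht => lt_of_le_of_lt ha ht.1) fun t ht => ?_
        by_cases hta : t ≤ a
        · simp only [hθdef]
          rw [smoothStep_eq_zero hk.1 hta, smoothStep_eq_zero hk.1 (hta.trans hab), sub_zero]
        · exact hzero t fun h => ht.2 ⟨not_le.1 hta, h.2⟩
      rw [h2]
      have h3 : ∫ t in Ioc a (b + k), θ t ≤ ∫ _ in Ioc a (b + k), (1 : ℝ) := by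
        refine setIntegral_mono_on
          ((hθ.continuous.integrable_of_hasCompactSupport hc).integrableOn)
          (by simp) measurableSet_Ioc fun t _ => ?_
        have := smoothStep_le_one a k t
        have := smoothStep_nonneg b k t
        simp only [hθdef]; linarith
      refine h3.trans (le_of_eq ?_)
      have : a ≤ b + k := by linarith [hk.1]
      simp [Measure.real, ENNReal.toReal_ofReal (sub_nonneg.2 this)]
      ring
    have := mul_le_mul_of_nonneg_left hθint hM0
    linarith
  have hlim1 := (tendsto_integral_deriv_smoothStep_mul hcont hb).sub
    (tendsto_integral_deriv_smoothStep_mul hcont ha)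
  have hlim2 : Tendsto (fun k => M * (b - a + k)) (𝓝[>] 0) (𝓝 (M * (b - a))) := by
    have : Continuous fun k => M * (b - a + k) := by fun_prop
    simpa using this.continuousWithinAt (s := Ioi 0) (x := 0) |>.tendsto
  exact le_of_tendsto_of_tendsto hlim1 hlim2 (by
    filter_upwards [Ioo_mem_nhdsGT hε] with k hk using hineq k hk)

/-- The time factor equals one at time zero and drops to zero within time `k`, so the transport term
is `O(k)` and only the initial values remain; a crude growth bound is enough. -/
theorem integral_zero_le (hG : IsProfile G B L) (hL : 0 ≤ L) {C₁ C₂ : ℝ} (hC₁ : 0 ≤ C₁)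
    (hA1 : VelocityBound V C₁) (hA2 : VelocityLipschitzInSpace V C₂)
    {μ₀ : Measure (Domain K₁ K₂)} {ν : ℝ → Measure (Domain K₁ K₂)}
    (hν : IsMeasureValuedSolution V μ₀ ν) :
    ∫ z, G z 0 ∂(ν 0) ≤ ∫ z, G z 0 ∂μ₀ := by
  have hcont := hG.continuousOn_integral hν
  set M := L * (C₁ + 1) with hMdef
  have hM0 : 0 ≤ M := by positivity
  have hM : ∀ t, 0 < t → ∀ z, directional G z t (V (ν t) z) ≤ M := by
    intro t ht z
    refine directional_le hG.contDiff one_pos fun r hr _ => ?_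
    refine (le_abs_self _).trans ((hG.lipschitz _ _ _ _).trans ?_)
    have h1 : dist (z + cover (r • V (ν t) z)) z ≤ r * C₁ := by
      have := dist_add_cover_self_le z (r • V (ν t) z) 0
      rw [map_zero, add_zero, sub_zero, norm_smul, Real.norm_eq_abs, abs_of_pos hr] at this
      exact this.trans (mul_le_mul_of_nonneg_left (hA1 _ (hν.prob t ht.le) z) hr.le)
    have h2 : |t + r - t| = r := by rw [add_sub_cancel_left, abs_of_pos hr]
    rw [h2, hMdef, mul_assoc]
    gcongr
    linarith
  have hineq : ∀ k ∈ Ioo (0 : ℝ) 1, (∫ t in Ioi 0, deriv (smoothStep 0 k) t * ∫ z, G z t ∂(ν t))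
      ≤ M * k + ∫ z, G z 0 ∂μ₀ := by
    intro k hk
    -- The step on `[-2, -1]` only makes the support compact; it equals one for all `t ≥ 0`.
    set θ : ℝ → ℝ := fun t => smoothStep (-2) 1 t - smoothStep 0 k t with hθdef
    have hθ : ContDiff ℝ ∞ θ := (contDiff_smoothStep _ _).sub (contDiff_smoothStep _ _)
    have hzero : ∀ t, t ∉ Icc (-2) k → θ t = 0 := by
      intro t ht
      rw [mem_Icc, not_and_or, not_le, not_le] at ht
      simp only [hθdef]
      rcases ht with h | h
      · rw [smoothStep_eq_zero one_pos h.le, smoothStep_eq_zero hk.1 (by linarith), sub_zero]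
      · rw [smoothStep_eq_one one_pos (by linarith [hk.1]),
          smoothStep_eq_one hk.1 (by linarith), sub_self]
    have hc : HasCompactSupport θ := HasCompactSupport.intro isCompact_Icc hzero
    have hone : ∀ t, 0 ≤ t → smoothStep (-2) 1 t = 1 := fun t ht =>
      smoothStep_eq_one one_pos (by linarith)
    have h0 : θ 0 = 1 := by
      simp only [hθdef]
      rw [smoothStep_eq_zero hk.1 le_rfl, hone 0 le_rfl, sub_zero]
    have h1 := hG.weak_inequality hA2 hν hθ hc hA1
      (fun t ht => by
        simp only [hθdef]
        rw [hone t ht.le]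
        exact sub_nonneg.2 (smoothStep_le_one _ _ _)) (M := M) (fun t ht _ => hM t ht)
    rw [h0, one_mul] at h1
    have hderiv : ∀ t ∈ Ioi (0 : ℝ), deriv θ t * (∫ z, G z t ∂(ν t))
        = -(deriv (smoothStep 0 k) t * ∫ z, G z t ∂(ν t)) := by
      intro t ht
      have : deriv θ t = deriv (smoothStep (-2) 1) t - deriv (smoothStep 0 k) t :=
        deriv_sub (differentiable_smoothStep _ _).differentiableAt
          (differentiable_smoothStep _ _).differentiableAt
      rw [this, deriv_smoothStep_of_gt one_pos (by linarith [mem_Ioi.1 ht])]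
      ring
    rw [setIntegral_congr_fun measurableSet_Ioi hderiv, integral_neg] at h1
    have hθint : ∫ t in Ioi 0, θ t ≤ k := by
      have h2 : ∫ t in Ioi 0, θ t = ∫ t in Ioc 0 k, θ t := by
        refine setIntegral_eq_of_subset_of_forall_sdiff_eq_zero measurableSet_Ioi
          (fun t ht => ht.1) fun t ht => hzero t fun h => ht.2 ⟨ht.1, h.2⟩
      rw [h2]
      have h3 : ∫ t in Ioc 0 k, θ t ≤ ∫ _ in Ioc 0 k, (1 : ℝ) := by
        refine setIntegral_mono_on
          ((hθ.continuous.integrable_of_hasCompactSupport hc).integrableOn)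
          (by simp) measurableSet_Ioc fun t _ => ?_
        have := smoothStep_le_one (-2) 1 t
        have := smoothStep_nonneg 0 k t
        simp only [hθdef]; linarith
      refine h3.trans (le_of_eq ?_)
      simp [Measure.real, hk.1.le]
    have := mul_le_mul_of_nonneg_left hθint hM0
    linarith
  have hlim2 : Tendsto (fun k => M * k + ∫ z, G z 0 ∂μ₀) (𝓝[>] 0) (𝓝 (∫ z, G z 0 ∂μ₀)) := by
    have : Continuous fun k => M * k + ∫ z, G z 0 ∂μ₀ := by fun_prop
    simpa using this.continuousWithinAt (s := Ioi 0) (x := 0) |>.tendsto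
  exact le_of_tendsto_of_tendsto (tendsto_integral_deriv_smoothStep_mul hcont le_rfl) hlim2 (by
    filter_upwards [Ioo_mem_nhdsGT one_pos] with k hk using hineq k hk)

end IsProfile

end LaxFriedrichs

namespace LaxFriedrichs

/-! ### Mollification -/

variable {K₁ K₂ : Factor}

/-- The convolution of a function on the domain and time with a bump function on `ℝ × ℝ × ℝ`. -/
noncomputable def mollify (f : ContDiffBump (0 : ℝ × ℝ × ℝ)) (F : Domain K₁ K₂ → ℝ → ℝ)
    (z : Domain K₁ K₂) (t : ℝ) : ℝ :=
  ∫ y, f.normed volume y * F (z - cover (WithLp.toLp 2 (y.1, y.2.1))) (t - y.2.2)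

/-- The factor 2 absorbs the `√2` between the Euclidean norm of the plane and the maximum norm of `ℝ
× ℝ × ℝ`. -/
theorem norm_cover_toLp_le (y : ℝ × ℝ × ℝ) :
    ‖(cover (WithLp.toLp 2 (y.1, y.2.1)) : Domain K₁ K₂)‖ ≤ 2 * ‖y‖ := by
  refine (norm_cover_le _).trans ?_
  rw [WithLp.prod_norm_eq_of_L2]
  have h1 : |y.1| ≤ ‖y‖ := norm_fst_le y
  have h2 : |y.2.1| ≤ ‖y‖ := (norm_fst_le y.2).trans (norm_snd_le y)
  refine Real.sqrt_le_iff.2 ⟨by positivity, ?_⟩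
  change |y.1| ^ 2 + |y.2.1| ^ 2 ≤ _
  nlinarith [abs_nonneg y.1, abs_nonneg y.2.1, norm_nonneg y]

theorem abs_snd_snd_le (y : ℝ × ℝ × ℝ) : |y.2.2| ≤ ‖y‖ := (norm_snd_le y.2).trans (norm_snd_le y)

section Mollify

variable {F : Domain K₁ K₂ → ℝ → ℝ} (f : ContDiffBump (0 : ℝ × ℝ × ℝ))

theorem continuous_translate (hF : Continuous fun p : Domain K₁ K₂ × ℝ => F p.1 p.2)
    (z : Domain K₁ K₂) (t : ℝ) :
    Continuous fun y : ℝ × ℝ × ℝ => F (z - cover (WithLp.toLp 2 (y.1, y.2.1))) (t - y.2.2) :=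
  hF.comp ((continuous_const.sub (continuous_cover.comp (by fun_prop))).prodMk (by fun_prop))

theorem integrable_normed_mul {h : ℝ × ℝ × ℝ → ℝ} (hh : Continuous h) :
    Integrable fun y => f.normed volume y * h y :=
  (f.continuous_normed.mul hh).integrable_of_hasCompactSupport f.hasCompactSupport_normed.mul_right

theorem integral_normed_mul_le {h : ℝ × ℝ × ℝ → ℝ} (hh : Continuous h) {M : ℝ}
    (hM : ∀ y, ‖y‖ < f.rOut → h y ≤ M) : ∫ y, f.normed volume y * h y ≤ M := by
  have : ∫ y, f.normed volume y * h y ≤ ∫ y, f.normed volume y * M := by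
    refine integral_mono (integrable_normed_mul f hh) (integrable_normed_mul f continuous_const)
      fun y => ?_
    by_cases hy : ‖y‖ < f.rOut
    · exact mul_le_mul_of_nonneg_left (hM y hy) (f.nonneg_normed y)
    · have : f.normed volume y = 0 := by
        rw [← Function.notMem_support, f.support_normed_eq]
        simpa using hy
      simp [this]
  rwa [integral_mul_const, f.integral_normed, one_mul] at this

/-- A difference bound common to all translates passes to their average. Lipschitz constants and
growth rates along characteristics are transferred to the mollification in this way. -/
theorem mollify_sub_le (hF : Continuous fun p : Domain K₁ K₂ × ℝ => F p.1 p.2)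
    {z z' : Domain K₁ K₂} {t t' M : ℝ}
    (h : ∀ y : ℝ × ℝ × ℝ, ‖y‖ < f.rOut → F (z - cover (WithLp.toLp 2 (y.1, y.2.1))) (t - y.2.2)
      - F (z' - cover (WithLp.toLp 2 (y.1, y.2.1))) (t' - y.2.2) ≤ M) :
    mollify f F z t - mollify f F z' t' ≤ M := by
  rw [mollify, mollify, ← integral_sub (integrable_normed_mul f (continuous_translate hF z t))
    (integrable_normed_mul f (continuous_translate hF z' t'))]
  simp_rw [← mul_sub]
  exact integral_normed_mul_le f
    ((continuous_translate hF z t).sub (continuous_translate hF z' t')) h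

theorem abs_mollify_sub_le (hF : Continuous fun p : Domain K₁ K₂ × ℝ => F p.1 p.2)
    {z : Domain K₁ K₂} {t c M : ℝ}
    (h : ∀ y : ℝ × ℝ × ℝ, ‖y‖ < f.rOut →
      |F (z - cover (WithLp.toLp 2 (y.1, y.2.1))) (t - y.2.2) - c| ≤ M) :
    |mollify f F z t - c| ≤ M := by
  have hc : mollify f F z t - c
      = ∫ y, f.normed volume y * (F (z - cover (WithLp.toLp 2 (y.1, y.2.1))) (t - y.2.2) - c) := by
    simp_rw [mul_sub]
    rw [integral_sub (integrable_normed_mul f (continuous_translate hF z t))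
      (integrable_normed_mul f continuous_const), integral_mul_const, f.integral_normed, one_mul,
      mollify]
  have hcont := (continuous_translate hF z t).sub (continuous_const (y := c))
  rw [hc, abs_le]
  refine ⟨?_, integral_normed_mul_le f hcont fun y hy => (abs_le.1 (h y hy)).2⟩
  rw [neg_le, ← integral_neg]
  simp_rw [← mul_neg]
  exact integral_normed_mul_le f hcont.neg fun y hy => neg_le.1 (abs_le.1 (h y hy)).1

/-- Since `cover` is a homomorphism, the lift of the mollification is the ordinary convolution of
the bump with the lift of `F`. -/
theorem contDiff_lift_mollify (hF : Continuous fun p : Domain K₁ K₂ × ℝ => F p.1 p.2) :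
    ContDiff ℝ ∞ (lift (mollify f F)) := by
  have hcov : Continuous fun p : ℝ × ℝ × ℝ =>
      F (cover (WithLp.toLp 2 (p.1, p.2.1))) p.2.2 :=
    hF.comp ((continuous_cover.comp (by fun_prop)).prodMk (by fun_prop))
  have hpair : (volume : Measure (ℝ × ℝ)).IsAddHaarMeasure :=
    Measure.prod.instIsAddHaarMeasure _ _
  have htriple : (volume : Measure (ℝ × ℝ × ℝ)).IsAddHaarMeasure :=
    Measure.prod.instIsAddHaarMeasure _ _
  have h := f.hasCompactSupport_normed.contDiff_convolution_left (μ := volume)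
    (ContinuousLinearMap.mul ℝ ℝ) (f.contDiff_normed (n := ⊤) (μ := volume))
    hcov.locallyIntegrable
  convert h using 1
  ext p
  rw [convolution_def]
  refine integral_congr_ae (.of_forall fun y => ?_)
  have : (cover (WithLp.toLp 2 ((p - y).1, (p - y).2.1)) : Domain K₁ K₂)
      = cover (WithLp.toLp 2 (p.1, p.2.1)) - cover (WithLp.toLp 2 (y.1, y.2.1)) := by
    rw [← map_sub]; rfl
  simp only [ContinuousLinearMap.mul_apply', this]
  rfl

end Mollify

/-! ### Truncation in space -/

/-- A Lipschitz cutoff function, supported in the ball of radius `1 / ε`. -/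
noncomputable def cutoff (ε : ℝ) (z : Domain K₁ K₂) : ℝ := max 0 (1 - ε * ‖z‖)

theorem cutoff_nonneg (ε : ℝ) (z : Domain K₁ K₂) : 0 ≤ cutoff ε z := le_max_left _ _

theorem cutoff_le_one {ε : ℝ} (hε : 0 ≤ ε) (z : Domain K₁ K₂) : cutoff ε z ≤ 1 :=
  max_le zero_le_one (sub_le_self _ (by positivity))

theorem cutoff_eq_zero {ε : ℝ} (hε : 0 < ε) {z : Domain K₁ K₂} (h : ε⁻¹ ≤ ‖z‖) :
    cutoff ε z = 0 := by
  rw [inv_le_iff_one_le_mul₀' hε] at h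
  exact max_eq_left (by linarith)

theorem one_sub_cutoff_le (ε : ℝ) (z : Domain K₁ K₂) : 1 - cutoff ε z ≤ ε * ‖z‖ := by
  have := le_max_right 0 (1 - ε * ‖z‖)
  rw [cutoff]; linarith

theorem abs_cutoff_sub_le {ε : ℝ} (hε : 0 ≤ ε) (z z' : Domain K₁ K₂) :
    |cutoff ε z - cutoff ε z'| ≤ ε * dist z z' := by
  refine (abs_max_sub_max_le_max _ _ _ _).trans ?_
  rw [sub_self, abs_zero, max_eq_right (abs_nonneg _)]
  have h1 : (1 - ε * ‖z‖) - (1 - ε * ‖z'‖) = ε * (‖z'‖ - ‖z‖) := by ring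
  rw [h1, abs_mul, abs_of_nonneg hε, dist_comm, dist_eq_norm]
  exact mul_le_mul_of_nonneg_left (abs_norm_sub_norm_le _ _) hε

section Transport

variable {V : Measure (Domain K₁ K₂) → Domain K₁ K₂ → Vec}

theorem continuous_of_abs_sub_le {F : Domain K₁ K₂ → ℝ → ℝ} {L : ℝ} (hL : 0 ≤ L)
    (h : ∀ z s z' s', |F z s - F z' s'| ≤ L * (dist z z' + |s - s'|)) :
    Continuous fun p : Domain K₁ K₂ × ℝ => F p.1 p.2 := by
  refine (LipschitzWith.of_dist_le_mul (K := (2 * L).toNNReal) fun p q => ?_).continuous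
  rw [Real.coe_toNNReal _ (by positivity), Real.dist_eq, mul_comm 2, mul_assoc]
  refine (h _ _ _ _).trans (mul_le_mul_of_nonneg_left ?_ hL)
  rw [Prod.dist_eq, two_mul, ← Real.dist_eq]
  exact add_le_add (le_max_left _ _) (le_max_right _ _)

/-! ### Regularization -/

/-- The regularization parameter `1 / (n + 1)`. -/
noncomputable def scale (n : ℕ) : ℝ := 1 / ((n : ℝ) + 1)

theorem scale_pos (n : ℕ) : 0 < scale n := by unfold scale; positivity

theorem scale_le_one (n : ℕ) : scale n ≤ 1 := by
  rw [scale, div_le_one (by positivity)]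
  linarith [n.cast_nonneg (α := ℝ)]

theorem tendsto_scale : Tendsto scale atTop (𝓝 0) := tendsto_one_div_add_atTop_nhds_zero_nat

/-- A bump function supported in the ball of radius `scale n / 2`. -/
noncomputable def scaleBump (n : ℕ) : ContDiffBump (0 : ℝ × ℝ × ℝ) :=
  ⟨scale n / 4, scale n / 2, by have := scale_pos n; positivity, by have := scale_pos n; linarith⟩

/-- Truncation in space. -/
noncomputable def truncate (F : Domain K₁ K₂ → ℝ → ℝ) (n : ℕ) (z : Domain K₁ K₂) (s : ℝ) : ℝ :=
  cutoff (scale n) z * F z s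

/-- Truncation in space followed by mollification. -/
noncomputable def regularize (F : Domain K₁ K₂ → ℝ → ℝ) (n : ℕ) : Domain K₁ K₂ → ℝ → ℝ :=
  mollify (scaleBump n) (truncate F n)

theorem norm_cover_le_scale {n : ℕ} {y : ℝ × ℝ × ℝ} (hy : ‖y‖ < (scaleBump n).rOut) :
    ‖(cover (WithLp.toLp 2 (y.1, y.2.1)) : Domain K₁ K₂)‖ ≤ scale n :=
  (norm_cover_toLp_le y).trans (by
    have hy' : ‖y‖ < scale n / 2 := hy
    linarith)

theorem abs_le_scale {n : ℕ} {y : ℝ × ℝ × ℝ} (hy : ‖y‖ < (scaleBump n).rOut) :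
    |y.2.2| ≤ scale n :=
  (abs_snd_snd_le y).trans (by
    have hy' : ‖y‖ < scale n / 2 := hy
    linarith [scale_pos n])

section Regularize

variable {F : Domain K₁ K₂ → ℝ → ℝ} {B L : ℝ}

theorem abs_truncate_le (hbound : ∀ z s, |F z s| ≤ B) (n : ℕ) (z : Domain K₁ K₂) (s : ℝ) :
    |truncate F n z s| ≤ B := by
  rw [truncate, abs_mul, abs_of_nonneg (cutoff_nonneg _ _)]
  calc _ ≤ 1 * B := mul_le_mul (cutoff_le_one (scale_pos n).le z) (hbound z s) (abs_nonneg _)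
        zero_le_one
    _ = B := one_mul B

theorem abs_truncate_sub_le (hbound : ∀ z s, |F z s| ≤ B)
    (hlip : ∀ z s z' s', |F z s - F z' s'| ≤ L * (dist z z' + |s - s'|)) (n : ℕ)
    (z : Domain K₁ K₂) (s : ℝ) (z' : Domain K₁ K₂) (s' : ℝ) :
    |truncate F n z s - truncate F n z' s'| ≤ (L + B) * (dist z z' + |s - s'|) := by
  have hB : 0 ≤ B := (abs_nonneg _).trans (hbound 0 0)
  have h1 : truncate F n z s - truncate F n z' s' = cutoff (scale n) z * (F z s - F z' s')
      + (cutoff (scale n) z - cutoff (scale n) z') * F z' s' := by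
    simp only [truncate]; ring
  rw [h1]
  refine (abs_add_le _ _).trans ?_
  rw [abs_mul, abs_mul, abs_of_nonneg (cutoff_nonneg _ _), add_mul]
  refine add_le_add ?_ ?_
  · calc _ ≤ 1 * (L * (dist z z' + |s - s'|)) :=
          mul_le_mul (cutoff_le_one (scale_pos n).le z) (hlip _ _ _ _) (abs_nonneg _) zero_le_one
      _ = _ := one_mul _
  · rw [mul_comm]
    refine mul_le_mul (hbound _ _) ?_ (abs_nonneg _) hB
    refine (abs_cutoff_sub_le (scale_pos n).le _ _).trans ?_
    have := mul_le_mul_of_nonneg_right (scale_le_one n) (dist_nonneg (x := z) (y := z'))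
    linarith [abs_nonneg (s - s')]

variable (hL : 0 ≤ L) (hbound : ∀ z s, |F z s| ≤ B)
  (hlip : ∀ z s z' s', |F z s - F z' s'| ≤ L * (dist z z' + |s - s'|))

include hL hbound hlip

theorem continuous_truncate (n : ℕ) :
    Continuous fun p : Domain K₁ K₂ × ℝ => truncate F n p.1 p.2 :=
  continuous_of_abs_sub_le (add_nonneg hL ((abs_nonneg _).trans (hbound 0 0)))
    (abs_truncate_sub_le hbound hlip n)

theorem isProfile_regularize (n : ℕ) : IsProfile (regularize F n) B (L + B) := by
  have hcont := continuous_truncate hL hbound hlip n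
  refine ⟨contDiff_lift_mollify _ hcont, fun z s => ?_, fun z s z' s' => ?_,
    -- The cutoff vanishes beyond `(scale n)⁻¹`, and the mollifier moves points by at most `scale
    -- n`.
    ⟨(scale n)⁻¹ + scale n, fun z s hz => ?_⟩⟩
  · simpa [regularize] using abs_mollify_sub_le (scaleBump n) hcont (z := z) (t := s) (c := 0) (M := B)
      fun y _ => by rw [sub_zero]; exact abs_truncate_le hbound _ _ _
  · have h1 : ∀ (z s z' s') (y : ℝ × ℝ × ℝ),
        truncate F n (z - cover (WithLp.toLp 2 (y.1, y.2.1))) (s - y.2.2)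
        - truncate F n (z' - cover (WithLp.toLp 2 (y.1, y.2.1))) (s' - y.2.2)
        ≤ (L + B) * (dist z z' + |s - s'|) := fun z s z' s' y => by
      refine (le_abs_self _).trans
        ((abs_truncate_sub_le hbound hlip n _ _ _ _).trans (le_of_eq ?_))
      rw [dist_sub_right, sub_sub_sub_cancel_right]
    rw [abs_sub_le_iff]
    refine ⟨mollify_sub_le _ hcont fun y _ => h1 _ _ _ _ y, ?_⟩
    rw [dist_comm, abs_sub_comm]
    exact mollify_sub_le _ hcont fun y _ => h1 _ _ _ _ y
  · have := abs_mollify_sub_le (scaleBump n) hcont (z := z) (t := s) (c := 0) (M := 0)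
      fun y hy => by
        rw [truncate, cutoff_eq_zero (scale_pos n), zero_mul, sub_zero, abs_zero]
        have h2 := norm_sub_norm_le z (cover (WithLp.toLp 2 (y.1, y.2.1)))
        linarith [norm_cover_le_scale (K₁ := K₁) (K₂ := K₂) hy]
    simpa [regularize] using this

theorem tendsto_regularize (z : Domain K₁ K₂) (t : ℝ) :
    Tendsto (fun n => regularize F n z t) atTop (𝓝 (F z t)) := by
  have hB : 0 ≤ B := (abs_nonneg _).trans (hbound 0 0)
  rw [tendsto_iff_dist_tendsto_zero]
  have hlim : Tendsto (fun n => L * (scale n + scale n) + B * (scale n * (‖z‖ + scale n))) atTop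
      (𝓝 0) := by
    have hc : Continuous fun x : ℝ => L * (x + x) + B * (x * (‖z‖ + x)) := by fun_prop
    simpa [Function.comp_def] using (hc.tendsto 0).comp tendsto_scale
  refine squeeze_zero (fun n => dist_nonneg) (fun n => ?_) hlim
  rw [Real.dist_eq]
  refine abs_mollify_sub_le _ (continuous_truncate hL hbound hlip n) fun y hy => ?_
  have hy1 := norm_cover_le_scale (K₁ := K₁) (K₂ := K₂) hy
  have hy2 := abs_le_scale hy
  set c : Domain K₁ K₂ := cover (WithLp.toLp 2 (y.1, y.2.1)) with hc
  have h1 : truncate F n (z - c) (t - y.2.2) - F z t = (F (z - c) (t - y.2.2) - F z t)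
      - (1 - cutoff (scale n) (z - c)) * F (z - c) (t - y.2.2) := by
    simp only [truncate]; ring
  rw [h1]
  refine (abs_sub _ _).trans (add_le_add ?_ ?_)
  · refine (hlip _ _ _ _).trans (mul_le_mul_of_nonneg_left (add_le_add ?_ ?_) hL)
    · rwa [dist_eq_norm, sub_sub_cancel_left, norm_neg]
    · rwa [sub_sub_cancel_left, abs_neg]
  · have h0 : 0 ≤ 1 - cutoff (scale n) (z - c) :=
      sub_nonneg.2 (cutoff_le_one (scale_pos n).le _)
    rw [abs_mul, abs_of_nonneg h0, mul_comm]
    refine mul_le_mul (hbound _ _) ?_ h0 hB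
    refine (one_sub_cutoff_le _ _).trans (mul_le_mul_of_nonneg_left ?_ (scale_pos n).le)
    exact (norm_sub_le _ _).trans (by linarith)

theorem tendsto_integral_regularize (ν : Measure (Domain K₁ K₂)) [IsFiniteMeasure ν] (t : ℝ) :
    Tendsto (fun n => ∫ z, regularize F n z t ∂ν) atTop (𝓝 (∫ z, F z t ∂ν)) :=
  tendsto_integral_of_dominated_convergence (fun _ => B)
    (fun n => ((isProfile_regularize hL hbound hlip n).continuous_left t).aestronglyMeasurable)
    (integrable_const _)
    (fun n => .of_forall fun z => (isProfile_regularize hL hbound hlip n).bound z t)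
    (.of_forall fun z => tendsto_regularize hL hbound hlip z t)

/-- The mollifier averages over nearby points but keeps the velocity `v` of the centre, so the
growth of `F` has to be known for this fixed `v` at all points nearby. The varying cutoff costs `B *
(scale n * C₁)`. -/
theorem directional_regularize_le {n : ℕ} {z : Domain K₁ K₂} {t C₁ M : ℝ} {v : Vec}
    (hv : ‖v‖ ≤ C₁) (hM : 0 ≤ M)
    (hchar : ∀ z' s r, dist z' z ≤ scale n → |s - t| ≤ scale n → 0 < r → r < scale n →
      F (z' + cover (r • v)) (s + r) - F z' s ≤ M * r) :
    directional (regularize F n) z t v ≤ M + B * (scale n * C₁) := by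
  have hn := scale_pos n
  have hC₁ := (norm_nonneg v).trans hv
  refine directional_le (isProfile_regularize hL hbound hlip n).contDiff hn fun r hr hre => ?_
  refine mollify_sub_le _ (continuous_truncate hL hbound hlip n) fun y hy => ?_
  have hy1 := norm_cover_le_scale (K₁ := K₁) (K₂ := K₂) hy
  have hy2 := abs_le_scale hy
  set c : Domain K₁ K₂ := cover (WithLp.toLp 2 (y.1, y.2.1)) with hc
  set w : Domain K₁ K₂ := cover (r • v) with hw
  have hwn : ‖w‖ ≤ r * C₁ := by
    refine (norm_cover_le _).trans ?_
    rw [norm_smul, Real.norm_eq_abs, abs_of_pos hr]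
    exact mul_le_mul_of_nonneg_left hv hr.le
  have hzc : z + w - c = (z - c) + w := by abel
  have htc : t + r - y.2.2 = (t - y.2.2) + r := by ring
  rw [hzc, htc]
  have h1 := hchar (z - c) (t - y.2.2) r
    (by rw [dist_eq_norm, sub_sub_cancel_left, norm_neg]; exact hy1)
    (by rw [sub_sub_cancel_left, abs_neg]; exact hy2) hr hre
  have h2 : truncate F n (z - c + w) (t - y.2.2 + r) - truncate F n (z - c) (t - y.2.2)
      = cutoff (scale n) (z - c + w) * (F (z - c + w) (t - y.2.2 + r) - F (z - c) (t - y.2.2))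
      + (cutoff (scale n) (z - c + w) - cutoff (scale n) (z - c)) * F (z - c) (t - y.2.2) := by
    simp only [truncate]; ring
  rw [h2]
  have h4 : cutoff (scale n) (z - c + w)
      * (F (z - c + w) (t - y.2.2 + r) - F (z - c) (t - y.2.2)) ≤ M * r :=
    (mul_le_mul_of_nonneg_left h1 (cutoff_nonneg _ _)).trans
      (mul_le_of_le_one_left (by positivity) (cutoff_le_one hn.le _))
  have h5 : (cutoff (scale n) (z - c + w) - cutoff (scale n) (z - c)) * F (z - c) (t - y.2.2)
      ≤ (scale n * (r * C₁)) * B := by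
    refine (le_abs_self _).trans ?_
    rw [abs_mul]
    refine mul_le_mul ((abs_cutoff_sub_le hn.le _ _).trans ?_) (hbound _ _)
      (abs_nonneg _) (by positivity)
    rw [dist_eq_norm, add_sub_cancel_left]
    exact mul_le_mul_of_nonneg_left hwn hn.le
  calc _ ≤ M * r + (scale n * (r * C₁)) * B := add_le_add h4 h5
    _ = _ := by ring

end Regularize

/-- Removes smoothness and compact support from `IsProfile.integral_sub_le`. The growth condition
allows the velocity to be evaluated at `(x, τ)` and the function at `(z, s)`, within `ε`, at a price
`A * ε`; this and the cutoff error vanish as the regularization is removed. -/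
theorem integral_sub_le_of_characteristic {C₁ C₂ : ℝ} (hC₁ : 0 ≤ C₁) (hA1 : VelocityBound V C₁)
    (hA2 : VelocityLipschitzInSpace V C₂) {μ₀ : Measure (Domain K₁ K₂)}
    {ν : ℝ → Measure (Domain K₁ K₂)} (hν : IsMeasureValuedSolution V μ₀ ν)
    {F : Domain K₁ K₂ → ℝ → ℝ} {B L A M a b : ℝ} (hL : 0 ≤ L) (hA : 0 ≤ A) (hM : 0 ≤ M)
    (ha : 0 ≤ a) (hab : a ≤ b) (hbound : ∀ z s, |F z s| ≤ B)
    (hlip : ∀ z s z' s', |F z s - F z' s'| ≤ L * (dist z z' + |s - s'|))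
    (hchar : ∀ ε, 0 < ε → ε ≤ 1 → ∀ τ, a < τ → τ ≤ b + ε → ∀ x z s r, dist z x ≤ ε →
      |s - τ| ≤ ε → 0 < r → r < ε →
      F (z + cover (r • V (ν τ) x)) (s + r) - F z s ≤ (M + A * ε) * r) :
    (∫ z, F z b ∂(ν b)) - ∫ z, F z a ∂(ν a) ≤ M * (b - a) := by
  have hB : 0 ≤ B := (abs_nonneg _).trans (hbound 0 0)
  have hstep : ∀ n, (∫ z, regularize F n z b ∂(ν b)) - ∫ z, regularize F n z a ∂(ν a)
      ≤ (M + A * scale n + B * (scale n * C₁)) * (b - a) := fun n => by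
    have hn := scale_pos n
    refine (isProfile_regularize hL hbound hlip n).integral_sub_le hA1 hA2 hν ha hab
      (by positivity) hn fun t hat htb z => ?_
    exact directional_regularize_le hL hbound hlip (hA1 _ (hν.prob t (ha.trans hat.le)) z)
      (by positivity) fun z' s r => hchar _ hn (scale_le_one n) t hat htb z z' s r
  have hlimM : Tendsto (fun n => (M + A * scale n + B * (scale n * C₁)) * (b - a)) atTop
      (𝓝 (M * (b - a))) := by
    have hc : Continuous fun x : ℝ => (M + A * x + B * (x * C₁)) * (b - a) := by fun_prop
    simpa [Function.comp_def] using (hc.tendsto 0).comp tendsto_scale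
  have := hν.prob a ha
  have := hν.prob b (ha.trans hab)
  exact le_of_tendsto_of_tendsto' ((tendsto_integral_regularize hL hbound hlip (ν b) b).sub
    (tendsto_integral_regularize hL hbound hlip (ν a) a)) hlimM hstep

end Transport

end LaxFriedrichs

namespace LaxFriedrichs

/-! ### Uniqueness -/

/-- Discrete Gronwall: the closed form is a supersolution of the recursion `e ↦ (1 + q) e + c`. It
serves both uniqueness and the error of the scheme. -/
theorem discrete_growth_le {q c e₀ : ℝ} (hq : 0 ≤ q) (hc : 0 ≤ c) (n : ℕ) :
    (1 + q) * ((e₀ + n * c) * (1 + q) ^ n) + c ≤ (e₀ + (n + 1 : ℕ) * c) * (1 + q) ^ (n + 1) := by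
  have h : 1 ≤ (1 + q) ^ (n + 1) := one_le_pow₀ (by linarith)
  have := mul_le_mul_of_nonneg_left h hc
  push_cast
  rw [pow_succ] at *
  linarith

theorem one_add_pow_le_exp {q : ℝ} (hq : 0 ≤ q) (n : ℕ) : (1 + q) ^ n ≤ Real.exp (n * q) := by
  rw [Real.exp_nat_mul]
  exact pow_le_pow_left₀ (by linarith) (by linarith [Real.add_one_le_exp q]) n

variable {K₁ K₂ : Factor} {V : Measure (Domain K₁ K₂) → Domain K₁ K₂ → Vec} {C₁ C₂ C₃ : ℝ}
  {μ₀ : Measure (Domain K₁ K₂)} {ν : ℝ → Measure (Domain K₁ K₂)}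

theorem abs_sub_le_dist_of_lipschitzWith_one {X : Type*} [PseudoMetricSpace X] {ψ : X → ℝ}
    (hψ : LipschitzWith 1 ψ) (x y : X) : |ψ x - ψ y| ≤ dist x y := by
  simpa [Real.dist_eq] using hψ.dist_le_mul x y

/-- The weak formulation yields a one-sided inequality for regularized test functions; in the limit
it holds for every admissible `ψ`, which forces `d_W = 0`. -/
theorem IsMeasureValuedSolution.initial_eq [IsProbabilityMeasure μ₀] (hC₁ : 0 ≤ C₁)
    (hA1 : VelocityBound V C₁) (hA2 : VelocityLipschitzInSpace V C₂)
    (hν : IsMeasureValuedSolution V μ₀ ν) : ν 0 = μ₀ := by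
  have := hν.prob 0 le_rfl
  refine (eq_of_dW_eq_zero (le_antisymm ?_ bot_le)).symm
  rw [← ENNReal.ofReal_zero]
  refine dW_le_ofReal fun ψ hψ => sub_nonpos.2 ?_
  have hl : ∀ (z : Domain K₁ K₂) (s : ℝ) z' (s' : ℝ), |ψ z - ψ z'| ≤ 1 * (dist z z' + |s - s'|) :=
    fun z s z' s' => (abs_sub_le_dist_of_lipschitzWith_one hψ z z').trans
      (by linarith [abs_nonneg (s - s')])
  have hb : ∀ (z : Domain K₁ K₂) (_ : ℝ), |ψ z| ≤ ‖ψ‖ := fun z _ => ψ.norm_coe_le_norm z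
  exact le_of_tendsto_of_tendsto'
    (tendsto_integral_regularize (F := fun z _ => ψ z) zero_le_one hb hl (ν 0) 0)
    (tendsto_integral_regularize (F := fun z _ => ψ z) zero_le_one hb hl μ₀ 0) fun n =>
    (isProfile_regularize (F := fun z _ => ψ z) zero_le_one hb hl n).integral_zero_le
      (by positivity) hC₁ hA1 hA2 hν

/-- A 1-Lipschitz function grows at rate at most `C₁` along a field bounded by `C₁`. -/
theorem IsMeasureValuedSolution.dW_le (hC₁ : 0 ≤ C₁) (hA1 : VelocityBound V C₁)
    (hA2 : VelocityLipschitzInSpace V C₂) (hν : IsMeasureValuedSolution V μ₀ ν) {a b : ℝ}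
    (ha : 0 ≤ a) (hab : a ≤ b) : dW (ν a) (ν b) ≤ ENNReal.ofReal (C₁ * (b - a)) := by
  refine dW_le_ofReal fun ψ hψ => ?_
  refine integral_sub_le_of_characteristic hC₁ hA1 hA2 hν (F := fun z _ => ψ z) (A := 0)
    zero_le_one le_rfl hC₁ ha hab (fun z _ => ψ.norm_coe_le_norm z) (fun z s z' s' =>
      (abs_sub_le_dist_of_lipschitzWith_one hψ z z').trans (by linarith [abs_nonneg (s - s')]))
    fun ε _ _ τ hτ _ x z s r _ _ hr _ => ?_
  refine (le_abs_self _).trans ((abs_sub_le_dist_of_lipschitzWith_one hψ _ _).trans ?_)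
  have := dist_add_cover_self_le z (r • V (ν τ) x) 0
  rw [map_zero, add_zero, sub_zero, norm_smul, Real.norm_eq_abs, abs_of_pos hr] at this
  rw [zero_mul, add_zero, mul_comm C₁]
  exact this.trans (mul_le_mul_of_nonneg_left (hA1 _ (hν.prob τ (ha.trans hτ.le)) x) hr.le)

/-- One explicit Euler step in the frozen velocity field is consistent with the equation up to an
error of second order. -/
theorem IsMeasureValuedSolution.integral_sub_euler_le (hC₁ : 0 ≤ C₁) (hC₂ : 0 ≤ C₂) (hC₃ : 0 ≤ C₃)
    (hA1 : VelocityBound V C₁) (hA2 : VelocityLipschitzInSpace V C₂)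
    (hA3 : VelocityLipschitzInMeasure V C₃) (hν : IsMeasureValuedSolution V μ₀ ν) {a h : ℝ}
    (ha : 0 ≤ a) (hh : 0 ≤ h) {ψ : Domain K₁ K₂ →ᵇ ℝ} (hψ : LipschitzWith 1 ψ) :
    (∫ z, ψ z ∂(ν (a + h))) - ∫ z, ψ (z + cover (h • V (ν a) z)) ∂(ν a)
      ≤ (C₃ * C₁ + C₂ * C₁) * h * h := by
  have hprob := hν.prob a ha
  set u := V (ν a) with hu
  have hub : ∀ z, ‖u z‖ ≤ C₁ := hA1 _ hprob
  have hul : ∀ z z', ‖u z - u z'‖ ≤ C₂ * dist z z' := hA2 _ hprob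
  -- The remaining time `a + h - s`, clamped so that the test function is globally Lipschitz. The
  -- clamp is inactive for `a - 1 ≤ s ≤ a + h + 3`, which covers all `s` and `s + r` that occur when
  -- `ε ≤ 1`.
  set c : ℝ → ℝ := fun s => max (-3) (min (a + h - s) (h + 1)) with hc
  have hcl : ∀ s s', |c s - c s'| ≤ |s - s'| := by
    intro s s'
    refine (abs_max_sub_max_le_max _ _ _ _).trans (max_le (by simp) ?_)
    refine (abs_min_sub_min_le_max _ _ _ _).trans (max_le ?_ (by simp))
    rw [sub_sub_sub_cancel_left, abs_sub_comm]
  have hcb : ∀ s, |c s| ≤ h + 3 := by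
    intro s
    rw [abs_le]
    exact ⟨by linarith [le_max_left (-3) (min (a + h - s) (h + 1))],
      max_le (by linarith) ((min_le_right _ _).trans (by linarith))⟩
  have hcs : ∀ s, a - 1 ≤ s → s ≤ a + h + 3 → c s = a + h - s := by
    intro s h1 h2
    simp only [hc]
    rw [min_eq_left (by linarith), max_eq_right (by linarith)]
  -- The test function is `ψ` at time `a + h` and `ψ` after the Euler step at time `a`. Its growth
  -- has two sources: `C₃ C₁ h` because the velocity changes with time, and `C₂ C₁ h` because `u`
  -- changes along the path and acts for the remaining time. `A` collects the terms of order `ε`.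
  have hkey := integral_sub_le_of_characteristic hC₁ hA1 hA2 hν
    (F := fun z s => ψ (z + cover (c s • u z))) (B := ‖ψ‖)
    (L := 1 + (h + 3) * C₂ + C₁) (A := C₃ * C₁ + C₂ * (1 + C₁) + 2 * (C₂ * C₁))
    (M := (C₃ * C₁ + C₂ * C₁) * h) (a := a) (b := a + h)
    (by positivity) (by positivity) (by positivity) ha (by linarith)
    (fun z s => ψ.norm_coe_le_norm _) (fun z s z' s' => ?_)
    (fun ε hε hε1 τ hτ hτb x z s r hzx hsτ hr hrε => ?_)
  · have e1 : c (a + h) = 0 := by rw [hcs _ (by linarith) (by linarith), sub_self]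
    have e2 : c a = h := by rw [hcs _ (by linarith) (by linarith), add_sub_cancel_left]
    simp only [e1, e2, zero_smul, map_zero, add_zero, add_sub_cancel_left] at hkey
    exact hkey
  · refine (abs_sub_le_dist_of_lipschitzWith_one hψ _ _).trans ((dist_add_cover_le _ _ _ _).trans ?_)
    have h1 : c s • u z - c s' • u z' = c s • (u z - u z') + (c s - c s') • u z' := by
      rw [smul_sub, sub_smul]; abel
    have h2 : ‖c s • u z - c s' • u z'‖ ≤ (h + 3) * (C₂ * dist z z') + |s - s'| * C₁ := by
      rw [h1]
      refine (norm_add_le _ _).trans (add_le_add ?_ ?_)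
      · rw [norm_smul]
        exact mul_le_mul (hcb s) (hul _ _) (norm_nonneg _) (by linarith)
      · rw [norm_smul]
        exact mul_le_mul (hcl _ _) (hub _) (norm_nonneg _) (abs_nonneg _)
    have h3 := abs_nonneg (s - s')
    have h4 := dist_nonneg (x := z) (y := z')
    have h5 : 0 ≤ (h + 3) * C₂ * |s - s'| := by positivity
    have h6 : 0 ≤ C₁ * dist z z' := by positivity
    linarith
  · have hprobτ := hν.prob τ (ha.trans hτ.le)
    set v := V (ν τ) x with hv
    have hvb : ‖v‖ ≤ C₁ := hA1 _ hprobτ x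
    set z' : Domain K₁ K₂ := z + cover (r • v) with hz'
    have hs := abs_le.1 hsτ
    have hzz' : dist z' z ≤ r * C₁ := by
      have := dist_add_cover_self_le z (r • v) 0
      rw [map_zero, add_zero, sub_zero, norm_smul, Real.norm_eq_abs, abs_of_pos hr] at this
      exact this.trans (mul_le_mul_of_nonneg_left hvb hr.le)
    have hcsr : c (s + r) = c s - r := by
      rw [hcs _ (by linarith) (by linarith), hcs _ (by linarith) (by linarith)]; ring
    have hcsb : |c s| ≤ h + 2 * ε := by
      rw [hcs _ (by linarith) (by linarith), abs_le]
      constructor <;> linarith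
    have hvu : ‖v - u z'‖ ≤ C₃ * (C₁ * (h + ε)) + C₂ * (ε + ε * C₁) := by
      have h1 : ‖v - u x‖ ≤ C₃ * (C₁ * (τ - a)) := by
        rw [← norm_neg, neg_sub]
        exact hA3.norm_sub_le hC₃ (mul_nonneg hC₁ (by linarith))
          (hν.dW_le hC₁ hA1 hA2 ha hτ.le) x
      have h2 : ‖u x - u z'‖ ≤ C₂ * (ε + ε * C₁) := by
        refine (hul _ _).trans (mul_le_mul_of_nonneg_left ?_ hC₂)
        have h3 : r * C₁ ≤ ε * C₁ := mul_le_mul_of_nonneg_right hrε.le hC₁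
        have h4 := dist_triangle_right x z' z
        rw [dist_comm x z] at h4
        linarith
      have h3 : C₃ * (C₁ * (τ - a)) ≤ C₃ * (C₁ * (h + ε)) := by
        gcongr; linarith
      exact (norm_sub_le_norm_sub_add_norm_sub _ (u x) _).trans (add_le_add (h1.trans h3) h2)
    refine (le_abs_self _).trans ((abs_sub_le_dist_of_lipschitzWith_one hψ _ _).trans ?_)
    rw [hz', add_assoc, ← map_add, ← hz']
    refine (dist_add_cover_self_le _ _ _).trans ?_
    have h1 : r • v + c (s + r) • u z' - c s • u z = r • (v - u z') + c s • (u z' - u z) := by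
      rw [hcsr, sub_smul, smul_sub, smul_sub]; abel
    rw [h1]
    have h2 : ‖r • (v - u z')‖ ≤ r * (C₃ * (C₁ * (h + ε)) + C₂ * (ε + ε * C₁)) := by
      rw [norm_smul, Real.norm_eq_abs, abs_of_pos hr]
      exact mul_le_mul_of_nonneg_left hvu hr.le
    have h3 : ‖c s • (u z' - u z)‖ ≤ (h + 2 * ε) * (C₂ * (r * C₁)) := by
      rw [norm_smul]
      exact mul_le_mul hcsb ((hul _ _).trans (mul_le_mul_of_nonneg_left hzz' hC₂))
        (norm_nonneg _) (by linarith)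
    refine ((norm_add_le _ _).trans (add_le_add h2 h3)).trans (le_of_eq ?_)
    ring

/-- Both solutions are replaced by Euler steps, whence the factor 2. Exchanging `V (ν a)` for `V (μ
a)` costs `C₃ h w`, and the common Euler map has Lipschitz constant `1 + C₂ h`. -/
theorem IsMeasureValuedSolution.dW_step_le (hC₁ : 0 ≤ C₁) (hC₂ : 0 ≤ C₂) (hC₃ : 0 ≤ C₃)
    (hA1 : VelocityBound V C₁) (hA2 : VelocityLipschitzInSpace V C₂)
    (hA3 : VelocityLipschitzInMeasure V C₃) {μ : ℝ → Measure (Domain K₁ K₂)}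
    (hμ : IsMeasureValuedSolution V μ₀ μ) (hν : IsMeasureValuedSolution V μ₀ ν) {a h w : ℝ}
    (ha : 0 ≤ a) (hh : 0 ≤ h) (hw : 0 ≤ w) (hd : dW (μ a) (ν a) ≤ ENNReal.ofReal w) :
    dW (μ (a + h)) (ν (a + h)) ≤ ENNReal.ofReal ((1 + (C₂ + C₃) * h) * w
      + 2 * (C₃ * C₁ + C₂ * C₁) * h ^ 2) := by
  refine dW_le_ofReal fun ψ hψ => ?_
  have hpμ := hμ.prob a ha
  have hpν := hν.prob a ha
  have h1 := hν.integral_sub_euler_le hC₁ hC₂ hC₃ hA1 hA2 hA3 ha hh hψ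
  have h2 := hμ.integral_sub_euler_le hC₁ hC₂ hC₃ hA1 hA2 hA3 ha hh (ψ := -ψ) hψ.neg
  simp only [BoundedContinuousFunction.coe_neg, Pi.neg_apply, integral_neg] at h2
  have hcont : ∀ (ρ : Measure (Domain K₁ K₂)) [IsProbabilityMeasure ρ],
      Continuous fun z => ψ (z + cover (h • V ρ z)) := fun ρ _ =>
    ψ.continuous.comp (continuous_id.add
      (continuous_cover.comp ((hA2.continuous ρ).const_smul h)))
  have hint : ∀ (ρ ρ' : Measure (Domain K₁ K₂)) [IsProbabilityMeasure ρ] [IsProbabilityMeasure ρ'],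
      Integrable (fun z => ψ (z + cover (h • V ρ z))) ρ' := fun ρ ρ' _ _ =>
    Integrable.of_bound (hcont ρ).aestronglyMeasurable ‖ψ‖
      (.of_forall fun z => ψ.norm_coe_le_norm _)
  have h3 : (∫ z, ψ (z + cover (h • V (ν a) z)) ∂(ν a))
      - ∫ z, ψ (z + cover (h • V (μ a) z)) ∂(ν a) ≤ h * (C₃ * w) := by
    rw [← integral_sub (hint _ _) (hint _ _)]
    have : ∫ z, (ψ (z + cover (h • V (ν a) z)) - ψ (z + cover (h • V (μ a) z))) ∂(ν a)
        ≤ ∫ _, h * (C₃ * w) ∂(ν a) := by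
      refine integral_mono ((hint _ _).sub (hint _ _)) (integrable_const _) fun z => ?_
      refine (le_abs_self _).trans ((abs_sub_le_dist_of_lipschitzWith_one hψ _ _).trans ?_)
      refine (dist_add_cover_self_le _ _ _).trans ?_
      rw [← smul_sub, norm_smul, Real.norm_eq_abs, abs_of_nonneg hh, ← norm_neg, neg_sub]
      exact mul_le_mul_of_nonneg_left (hA3.norm_sub_le hC₃ hw hd z) hh
    simpa using this
  have h4 : (∫ z, ψ (z + cover (h • V (μ a) z)) ∂(ν a))
      - ∫ z, ψ (z + cover (h • V (μ a) z)) ∂(μ a) ≤ (1 + h * C₂) * w := by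
    refine integral_sub_le_of_dW_le hw hd (by positivity) (fun z => ψ.norm_coe_le_norm _)
      fun x y => ?_
    refine (abs_sub_le_dist_of_lipschitzWith_one hψ _ _).trans ((dist_add_cover_le _ _ _ _).trans ?_)
    rw [← smul_sub, norm_smul, Real.norm_eq_abs, abs_of_nonneg hh]
    have := mul_le_mul_of_nonneg_left (hA2 _ hpμ x y) hh
    linarith
  linarith

/-- Over `N + 1` steps of length `t / (N + 1)` the errors of second order add up to `O(1 / (N +
1))`. -/
theorem IsMeasureValuedSolution.unique [IsProbabilityMeasure μ₀] (hC₁ : 0 ≤ C₁) (hC₂ : 0 ≤ C₂)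
    (hC₃ : 0 ≤ C₃) (hA1 : VelocityBound V C₁) (hA2 : VelocityLipschitzInSpace V C₂)
    (hA3 : VelocityLipschitzInMeasure V C₃) {μ : ℝ → Measure (Domain K₁ K₂)}
    (hμ : IsMeasureValuedSolution V μ₀ μ) (hν : IsMeasureValuedSolution V μ₀ ν) {t : ℝ}
    (ht : 0 ≤ t) : ν t = μ t := by
  have := hμ.prob t ht
  have := hν.prob t ht
  refine (eq_of_dW_eq_zero ?_).symm
  set K := 2 * (C₃ * C₁ + C₂ * C₁) with hK
  have hK0 : 0 ≤ K := by positivity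
  have hbound : ∀ N : ℕ, dW (μ t) (ν t)
      ≤ ENNReal.ofReal (K * t ^ 2 * Real.exp ((C₂ + C₃) * t) * (1 / ((N : ℝ) + 1))) := by
    intro N
    set h := t / ((N : ℝ) + 1) with hh
    have hN : (0 : ℝ) < (N : ℝ) + 1 := by positivity
    have hh0 : 0 ≤ h := by positivity
    have hq : 0 ≤ (C₂ + C₃) * h := by positivity
    have hind : ∀ k : ℕ, dW (μ (k * h)) (ν (k * h))
        ≤ ENNReal.ofReal ((0 + k * (K * h ^ 2)) * (1 + (C₂ + C₃) * h) ^ k) := by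
      intro k
      induction k with
      | zero =>
        have h0 : dW μ₀ μ₀ = 0 := by simp [dW]
        simp [hμ.initial_eq hC₁ hA1 hA2, hν.initial_eq hC₁ hA1 hA2, h0]
      | succ k ih =>
        have h1 := hμ.dW_step_le hC₁ hC₂ hC₃ hA1 hA2 hA3 hν (by positivity : 0 ≤ (k : ℝ) * h) hh0
          (by positivity) ih
        have h2 : ((k + 1 : ℕ) : ℝ) * h = k * h + h := by push_cast; ring
        rw [h2]
        refine h1.trans (ENNReal.ofReal_le_ofReal ?_)
        exact discrete_growth_le hq (by positivity) k
    have hend := hind (N + 1)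
    have h1 : ((N + 1 : ℕ) : ℝ) * h = t := by
      rw [hh]; push_cast; field_simp
    rw [h1] at hend
    refine hend.trans (ENNReal.ofReal_le_ofReal ?_)
    have h2 := one_add_pow_le_exp hq (N + 1)
    have h3 : ((N + 1 : ℕ) : ℝ) * ((C₂ + C₃) * h) = (C₂ + C₃) * t := by
      rw [← h1]; ring
    rw [h3] at h2
    have h4 : (0 + ((N + 1 : ℕ) : ℝ) * (K * h ^ 2)) = K * t ^ 2 * (1 / ((N : ℝ) + 1)) := by
      rw [hh]; push_cast; field_simp; ring
    rw [h4]
    refine (mul_le_mul_of_nonneg_left h2 (by positivity)).trans (le_of_eq (by ring))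
  have hlim : Tendsto (fun N : ℕ => ENNReal.ofReal
      (K * t ^ 2 * Real.exp ((C₂ + C₃) * t) * (1 / ((N : ℝ) + 1)))) atTop (𝓝 0) := by
    rw [← ENNReal.ofReal_zero]
    refine ENNReal.tendsto_ofReal ?_
    simpa using (tendsto_one_div_add_atTop_nhds_zero_nat (𝕜 := ℝ)).const_mul
      (K * t ^ 2 * Real.exp ((C₂ + C₃) * t))
  exact le_antisymm (ge_of_tendsto' hlim hbound) bot_le

end LaxFriedrichs

namespace LaxFriedrichs

/-! ### Meshes -/

/-- Functions on the nodes: on the torus, periodic with the number of cells as period. -/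
def Mesh.IsPeriodic {K : Factor} (m : Mesh K) {α : Type*} (f : ℤ → α) : Prop :=
  K = Factor.torus → ∀ i, f (i + m.cells) = f i

namespace Mesh

variable {K : Factor} (m : Mesh K)

theorem proj_neg (K : Factor) (x : ℝ) : K.proj (-x) = -K.proj x := by
  have := K.proj_add x (-x)
  rw [add_neg_cancel, Factor.proj_zero] at this
  exact (neg_eq_of_add_eq_zero_right this.symm).symm

theorem proj_sub (K : Factor) (x y : ℝ) : K.proj (x - y) = K.proj x - K.proj y := by
  rw [sub_eq_add_neg, Factor.proj_add, proj_neg, ← sub_eq_add_neg]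

theorem node_add_one (i : ℤ) : m.node (i + 1) = m.node i + K.proj m.step := by
  rw [node, node, ← Factor.proj_add]
  congr 1
  push_cast; ring

theorem node_periodic : m.IsPeriodic m.node := by
  rintro rfl i
  have h : (m.origin + ((i + m.cells : ℤ) : ℝ) * m.step) = m.origin + i * m.step + 2 * Real.pi := by
    rw [← m.fits rfl]; push_cast; ring
  rw [node, node, h, Factor.proj_add]
  have : Factor.torus.proj (2 * Real.pi) = 0 := AddCircle.coe_period _
  rw [this, add_zero]

variable {m} in
theorem IsPeriodic.comp_node {α : Type*} (f : K.Carrier → α) : m.IsPeriodic fun i => f (m.node i) :=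
  fun h i => congrArg f (m.node_periodic h i)

variable {m} in
theorem IsPeriodic.comp_add {α : Type*} {f : ℤ → α} (hf : m.IsPeriodic f) (j : ℤ) :
    m.IsPeriodic fun i => f (i + j) := fun h i => by
  change f (i + m.cells + j) = f (i + j)
  rw [add_right_comm]; exact hf h _

theorem cells_pos (h : K = Factor.torus) : 0 < m.cells := by
  rcases Nat.eq_zero_or_pos m.cells with h0 | h0
  · have := m.fits h
    rw [h0, Nat.cast_zero, zero_mul] at this
    linarith [Real.pi_pos]
  · exact h0

theorem tsum_index_torus (m : Mesh Factor.torus) (f : ℤ → ℝ≥0∞) :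
    ∑' i : m.index, f i = ∑ k ∈ Finset.range m.cells, f (k + 1) := by
  have h1 : ∑' i : m.index, f i = ∑ i ∈ Finset.Icc (1 : ℤ) m.cells, f i := by
    rw [← Finset.tsum_subtype (Finset.Icc (1 : ℤ) m.cells) f]
    have : m.index = ((Finset.Icc (1 : ℤ) m.cells : Finset ℤ) : Set ℤ) := by
      rw [Finset.coe_Icc]; rfl
    rw [this]
    rfl
  rw [h1]
  refine (Finset.sum_bij (fun (k : ℕ) _ => (k : ℤ) + 1) (fun k hk => ?_) (fun a _ b _ h => ?_)
    (fun b hb => ?_) fun k _ => rfl).symm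
  · rw [Finset.mem_range] at hk
    rw [Finset.mem_Icc]; omega
  · omega
  · rw [Finset.mem_Icc] at hb
    exact ⟨(b - 1).toNat, by rw [Finset.mem_range]; omega, by omega⟩

/-- Shift invariance, which lies behind conservation of mass: a bijection of `ℤ` on the line, and on
the torus a cyclic shift in which one end term is traded for the other by periodicity. -/
theorem tsum_index_add_one {f : ℤ → ℝ≥0∞} (hf : m.IsPeriodic f) :
    ∑' i : m.index, f (i + 1) = ∑' i : m.index, f i := by
  cases K with
  | line =>
    have h : ∀ g : ℤ → ℝ≥0∞, ∑' i : m.index, g i = ∑' i, g i := fun g => tsum_univ g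
    rw [h fun i => f (i + 1), h]
    exact (Equiv.addRight (1 : ℤ)).tsum_eq f
  | torus =>
    rw [tsum_index_torus m fun i => f (i + 1), tsum_index_torus]
    obtain ⟨M, hM⟩ := Nat.exists_eq_succ_of_ne_zero (m.cells_pos rfl).ne'
    have hp := hf rfl 1
    rw [hM] at hp ⊢
    rw [Finset.sum_range_succ, Finset.sum_range_succ']
    refine congrArg₂ _ (Finset.sum_congr rfl fun k _ => ?_) ?_
    · push_cast; rfl
    · rw [Nat.cast_zero, zero_add, ← hp]
      congr 1
      push_cast; ring

theorem tsum_index_add {f : ℤ → ℝ≥0∞} (hf : m.IsPeriodic f) (j : ℤ) :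
    ∑' i : m.index, f (i + j) = ∑' i : m.index, f i := by
  induction j with
  | zero => simp
  | succ k ih =>
    refine Eq.trans (tsum_congr fun i => ?_) ((m.tsum_index_add_one (hf.comp_add k)).trans ih)
    exact congrArg f (by ring)
  | pred k ih =>
    refine (m.tsum_index_add_one (hf.comp_add (-k - 1))).symm.trans (Eq.trans ?_ ih)
    exact tsum_congr fun i => congrArg f (by ring)

/-! #### Hat functions -/

theorem hat_nonneg (i : ℤ) (x : K.Carrier) : 0 ≤ m.hat i x := le_max_left _ _

theorem hat_le_one (i : ℤ) (x : K.Carrier) : m.hat i x ≤ 1 :=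
  max_le zero_le_one (sub_le_self _ (div_nonneg dist_nonneg m.step_pos.le))

theorem hat_periodic (x : K.Carrier) : m.IsPeriodic fun i => m.hat i x :=
  IsPeriodic.comp_node fun y => max 0 (1 - dist x y / m.step)

theorem continuous_hat (i : ℤ) : Continuous (m.hat i) :=
  continuous_const.max (continuous_const.sub ((continuous_id.dist continuous_const).div_const _))

theorem hat_mul_dist_sq_le (i : ℤ) (x : K.Carrier) :
    m.hat i x * dist x (m.node i) ^ 2 ≤ m.hat i x * m.step ^ 2 := by
  rcases le_or_gt (dist x (m.node i)) m.step with h | h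
  · have := m.hat_nonneg i x
    gcongr
  · have : m.hat i x = 0 := max_eq_left (by
      have := (one_lt_div m.step_pos).2 h
      linarith)
    rw [this, zero_mul, zero_mul]

theorem hat_eq_zero {i : ℤ} {x : K.Carrier} (h : m.step ≤ dist x (m.node i)) : m.hat i x = 0 :=
  max_eq_left (by
    have := (one_le_div m.step_pos).2 h
    linarith)

theorem norm_proj_eq {x : ℝ} (hx : K = Factor.torus → |x| ≤ Real.pi) : ‖K.proj x‖ = |x| := by
  cases K
  · rfl
  · have hp : (0 : ℝ) < 2 * Real.pi := by positivity
    refine (AddCircle.norm_coe_eq_abs_iff (2 * Real.pi) hp.ne').2 ?_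
    rw [abs_of_pos hp]
    linarith [hx rfl]

theorem le_norm_proj {s x : ℝ} (h1 : s ≤ x)
    (h2 : x ≤ 2 * Real.pi - s) : s ≤ ‖Factor.torus.proj x‖ := by
  obtain ⟨r, hr, hr'⟩ := Factor.torus.exists_lift (Factor.torus.proj x)
  rw [← hr']
  obtain ⟨l, hl⟩ := (QuotientAddGroup.eq_iff_sub_mem (N := AddSubgroup.zmultiples (2 * Real.pi))).1 hr
  have hl' : (l : ℝ) * (2 * Real.pi) = r - x := by simpa using hl
  by_contra hcon
  have hlt := abs_lt.1 (not_le.1 hcon)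
  rcases le_or_gt 0 l with h | h
  · have : (0 : ℝ) ≤ l := by exact_mod_cast h
    have := mul_nonneg this (by positivity : (0 : ℝ) ≤ 2 * Real.pi)
    linarith [hlt.2]
  · have : (l : ℝ) ≤ -1 := by exact_mod_cast Int.le_sub_one_of_lt h
    have := mul_le_mul_of_nonneg_right this (by positivity : (0 : ℝ) ≤ 2 * Real.pi)
    linarith [hlt.1]

theorem dist_node (y : ℝ) (i : ℤ) :
    dist (K.proj (m.origin + y * m.step)) (m.node i) = ‖K.proj ((y - i) * m.step)‖ := by
  rw [dist_eq_norm, node, ← proj_sub]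
  congr 2
  ring

/-- Only the two nodes around `x` contribute, with weights `1 - Int.fract y` and `Int.fract y`. On
the torus `step ≤ 1` keeps these two nodes distinct and their distances to `x` below half a period.
-/
theorem tsum_hat (hm : m.step ≤ 1) (x : K.Carrier) :
    ∑' i : m.index, ENNReal.ofReal (m.hat i x) = 1 := by
  obtain ⟨x', rfl, -⟩ := K.exists_lift x
  have hs := m.step_pos
  set y : ℝ := (x' - m.origin) / m.step with hy
  have hx : x' = m.origin + y * m.step := by
    rw [hy, div_mul_cancel₀ _ hs.ne']; ring
  have hf0 := Int.fract_nonneg y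
  have hf1 := (Int.fract_lt_one y).le
  have hpi := Real.pi_gt_three
  have hfr : y - (⌊y⌋ : ℤ) = Int.fract y := rfl
  have h0 : m.hat ⌊y⌋ (K.proj x') = 1 - Int.fract y := by
    rw [hat, hx, dist_node, hfr, norm_proj_eq, abs_of_nonneg (by positivity),
      mul_div_cancel_right₀ _ hs.ne', max_eq_right (by linarith)]
    intro _
    rw [abs_of_nonneg (by positivity)]
    nlinarith
  have h1 : m.hat (⌊y⌋ + 1) (K.proj x') = Int.fract y := by
    have he : (y - ((⌊y⌋ + 1 : ℤ) : ℝ)) * m.step = -((1 - Int.fract y) * m.step) := by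
      rw [← hfr]; push_cast; ring
    have h2 : 0 ≤ (1 - Int.fract y) * m.step := mul_nonneg (by linarith) hs.le
    rw [hat, hx, dist_node, he, norm_proj_eq, abs_neg, abs_of_nonneg h2,
      mul_div_cancel_right₀ _ hs.ne', max_eq_right (by linarith)]
    · ring
    · intro _
      rw [abs_neg, abs_of_nonneg h2]
      nlinarith
  have hsum : ENNReal.ofReal (m.hat ⌊y⌋ (K.proj x'))
      + ENNReal.ofReal (m.hat (⌊y⌋ + 1) (K.proj x')) = 1 := by
    rw [h0, h1, ← ENNReal.ofReal_add (by linarith) hf0, sub_add_cancel, ENNReal.ofReal_one]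
  have hper : m.IsPeriodic fun i => ENNReal.ofReal (m.hat i (K.proj x')) := fun h i =>
    congrArg ENNReal.ofReal (m.hat_periodic _ h i)
  cases K with
  | line =>
    have huniv : ∀ g : ℤ → ℝ≥0∞, ∑' i : m.index, g i = ∑' i, g i := fun g => tsum_univ g
    rw [huniv fun i => ENNReal.ofReal (m.hat i (Factor.line.proj x')),
      tsum_eq_sum (s := {⌊y⌋, ⌊y⌋ + 1}), Finset.sum_pair (by omega), hsum]
    intro i hi
    rw [m.hat_eq_zero, ENNReal.ofReal_zero]
    rw [hx, dist_node, norm_proj_eq (by simp), abs_mul, abs_of_pos hs]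
    refine le_mul_of_one_le_left hs.le ?_
    simp only [Finset.mem_insert, Finset.mem_singleton, not_or] at hi
    rcases lt_or_gt_of_ne hi.1 with h | h
    · have : (i : ℝ) ≤ ⌊y⌋ - 1 := by exact_mod_cast Int.le_sub_one_of_lt h
      rw [abs_of_nonneg (by linarith)]
      linarith
    · have : ((⌊y⌋ + 1 + 1 : ℤ) : ℝ) ≤ i := by
        exact_mod_cast Int.add_one_le_of_lt (lt_of_le_of_ne (Int.add_one_le_of_lt h) (Ne.symm hi.2))
      push_cast at this
      rw [abs_of_nonpos (by linarith)]
      linarith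
  | torus =>
    have hfits := m.fits rfl
    -- The indices run from 1, so this shift makes the two contributing nodes the first two terms.
    rw [← m.tsum_index_add hper (⌊y⌋ - 1),
      tsum_index_torus m fun i => ENNReal.ofReal (m.hat (i + (⌊y⌋ - 1)) (Factor.torus.proj x'))]
    have hN : 2 ≤ m.cells := by
      by_contra hcon
      have h2 : (m.cells : ℝ) ≤ 1 := by exact_mod_cast Nat.le_of_lt_succ (not_le.1 hcon)
      nlinarith
    obtain ⟨M, hM⟩ := Nat.exists_eq_add_of_le' hN
    have hMs : ((M : ℝ) + 2) * m.step = 2 * Real.pi := by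
      rw [← hfits, hM]; push_cast; rfl
    rw [hM, Finset.sum_range_succ', Finset.sum_range_succ', Finset.sum_eq_zero, zero_add]
    · have e0 : (((0 : ℕ) : ℤ) + 1 + (⌊y⌋ - 1)) = ⌊y⌋ := by push_cast; ring
      have e1 : (((0 + 1 : ℕ) : ℤ) + 1 + (⌊y⌋ - 1)) = ⌊y⌋ + 1 := by push_cast; ring
      rw [e0, e1, add_comm, hsum]
    · intro k hk
      rw [Finset.mem_range] at hk
      have hk' : (k : ℝ) + 1 ≤ M := by exact_mod_cast hk
      rw [m.hat_eq_zero, ENNReal.ofReal_zero]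
      have he : (y - ((((k + 1 + 1 : ℕ) : ℤ) + 1 + (⌊y⌋ - 1) : ℤ) : ℝ)) * m.step
          = -((k + 2 - Int.fract y) * m.step) := by
        rw [← hfr]; push_cast; ring
      rw [hx, dist_node, he, proj_neg, norm_neg]
      refine le_norm_proj ?_ ?_
      · refine le_mul_of_one_le_left hs.le ?_
        linarith [k.cast_nonneg (α := ℝ)]
      · rw [← hMs]
        nlinarith

end Mesh

/-! ### Grid measures -/

section Grid

variable {K₁ K₂ : Factor} (m₁ : Mesh K₁) (m₂ : Mesh K₂)

theorem lintegral_gridMeasure (w : ℤ → ℤ → ℝ) (f : Domain K₁ K₂ → ℝ≥0∞) :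
    ∫⁻ z, f z ∂(gridMeasure m₁ m₂ w) = ∑' (i : m₁.index) (j : m₂.index),
      ENNReal.ofReal (w i j) * f (pt (m₁.node i) (m₂.node j)) := by
  rw [gridMeasure, lintegral_sum_measure]
  simp only [lintegral_smul_measure, lintegral_dirac, smul_eq_mul]
  exact ENNReal.tsum_prod (f := fun (i : m₁.index) (j : m₂.index) =>
    ENNReal.ofReal (w i j) * f (pt (m₁.node i) (m₂.node j)))

theorem tsum_tsum_add {f : ℤ → ℤ → ℝ≥0∞} (h₁ : ∀ j, m₁.IsPeriodic fun i => f i j)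
    (h₂ : ∀ i, m₂.IsPeriodic (f i)) (k l : ℤ) :
    ∑' (i : m₁.index) (j : m₂.index), f (i + k) (j + l)
      = ∑' (i : m₁.index) (j : m₂.index), f i j := by
  have h : ∀ i : ℤ, ∑' j : m₂.index, f i (j + l) = ∑' j : m₂.index, f i j := fun i =>
    m₂.tsum_index_add (h₂ i) l
  simp_rw [h]
  exact m₁.tsum_index_add (f := fun i => ∑' j : m₂.index, f i j)
    (fun ht i => tsum_congr fun j => h₁ j ht i) k

end Grid

end LaxFriedrichs

namespace LaxFriedrichs

/-! ### The scheme as a Markov chain -/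

section Chain

variable {K₁ K₂ : Factor} (m₁ : Mesh K₁) (m₂ : Mesh K₂) (Δt : ℝ)

/-- The four displacements by which the scheme moves mass. -/
noncomputable def jump : Fin 4 → Vec :=
  ![WithLp.toLp 2 (m₁.step, 0), WithLp.toLp 2 (-m₁.step, 0), WithLp.toLp 2 (0, m₂.step),
    WithLp.toLp 2 (0, -m₂.step)]

/-- The fractions of mass moved by the four displacements, for the velocity `v`. -/
noncomputable def jumpProb (v : Vec) : Fin 4 → ℝ :=
  ![1 / 4 + Δt * (v.fst / (2 * m₁.step)), 1 / 4 - Δt * (v.fst / (2 * m₁.step)),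
    1 / 4 + Δt * (v.snd / (2 * m₂.step)), 1 / 4 - Δt * (v.snd / (2 * m₂.step))]

theorem sum_jumpProb (v : Vec) : ∑ k, jumpProb m₁ m₂ Δt v k = 1 := by
  simp only [Fin.sum_univ_four, jumpProb, Matrix.cons_val]
  ring

/-- Decomposition into mean and variance: the jump has mean `Δt • v` and second moment `(Δx² +
Δy²)/2`. -/
theorem sum_jumpProb_mul_norm_sq (v d : Vec) :
    ∑ k, jumpProb m₁ m₂ Δt v k * ‖d + jump m₁ m₂ k‖ ^ 2
      = ‖d + Δt • v‖ ^ 2 - Δt ^ 2 * ‖v‖ ^ 2 + (m₁.step ^ 2 + m₂.step ^ 2) / 2 := by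
  have h1 := m₁.step_pos.ne'
  have h2 := m₂.step_pos.ne'
  have e1 : ∀ k, (jump m₁ m₂ k).fst = ![m₁.step, -m₁.step, 0, 0] k := by
    intro k; fin_cases k <;> rfl
  have e2 : ∀ k, (jump m₁ m₂ k).snd = ![0, 0, m₂.step, -m₂.step] k := by
    intro k; fin_cases k <;> rfl
  simp only [Fin.sum_univ_four, jumpProb, WithLp.prod_norm_sq_eq_of_L2, WithLp.add_fst,
    WithLp.add_snd, WithLp.smul_fst, WithLp.smul_snd, Real.norm_eq_abs, sq_abs, smul_eq_mul, e1, e2,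
    Matrix.cons_val]
  field_simp
  ring

variable {Δt} in
theorem CFL.pos {C₁ lam₀ : ℝ} (hlam : 0 < lam₀) (hC₁ : 0 < C₁) (h : CFL C₁ lam₀ m₁ m₂ Δt) :
    0 < Δt := by
  have hmin : 0 < min m₁.step m₂.step := lt_min m₁.step_pos m₂.step_pos
  have h1 : 0 < Δt / min m₁.step m₂.step := pos_of_mul_pos_left (hlam.trans_le h.1) hC₁.le
  exact (div_pos_iff_of_pos_right hmin).1 h1

variable {Δt} in
-- The upper CFL bound `1/2` is what keeps the drift terms `Δt * (v / (2 * step))` within `1/4`.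
theorem jumpProb_nonneg {C₁ lam₀ : ℝ} (hlam : 0 < lam₀) (hC₁ : 0 < C₁)
    (h : CFL C₁ lam₀ m₁ m₂ Δt) {v : Vec} (hv : ‖v‖ ≤ C₁) (k : Fin 4) :
    0 ≤ jumpProb m₁ m₂ Δt v k := by
  have hΔ := CFL.pos m₁ m₂ hlam hC₁ h
  have hmin : 0 < min m₁.step m₂.step := lt_min m₁.step_pos m₂.step_pos
  have h1 : Δt * C₁ ≤ 1 / 2 * min m₁.step m₂.step := by
    have := h.2
    rwa [div_mul_eq_mul_div, div_le_iff₀ hmin] at this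
  have key : ∀ (x s : ℝ), 0 < s → min m₁.step m₂.step ≤ s → |x| ≤ C₁ →
      |Δt * (x / (2 * s))| ≤ 1 / 4 := by
    intro x s hs hms hx
    rw [abs_mul, abs_div, abs_of_pos hΔ, abs_of_pos (by positivity : (0 : ℝ) < 2 * s), ← mul_div_assoc,
      div_le_iff₀ (by positivity)]
    have := mul_le_mul_of_nonneg_left hx hΔ.le
    linarith
  have k1 := abs_le.1 (key v.fst m₁.step m₁.step_pos (min_le_left _ _)
    ((WithLp.norm_fst_le _ v).trans hv))
  have k2 := abs_le.1 (key v.snd m₂.step m₂.step_pos (min_le_right _ _)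
    ((WithLp.norm_snd_le _ v).trans hv))
  fin_cases k
  · change 0 ≤ 1 / 4 + _; linarith
  · change 0 ≤ 1 / 4 - _; linarith
  · change 0 ≤ 1 / 4 + _; linarith
  · change 0 ≤ 1 / 4 - _; linarith

theorem continuous_jumpProb (k : Fin 4) : Continuous fun v : Vec => jumpProb m₁ m₂ Δt v k := by
  fin_cases k <;> simp only [jumpProb, Fin.zero_eta, Fin.mk_one, Fin.reduceFinMk, Matrix.cons_val] <;>
    fun_prop

theorem pt_add_cover_left (i j : ℤ) (s : ℝ) (i' : ℤ) (h : m₁.node i = m₁.node i' + K₁.proj s) :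
    (pt (m₁.node i') (m₂.node j) + cover (WithLp.toLp 2 (s, 0)) : Domain K₁ K₂)
      = pt (m₁.node i) (m₂.node j) := by
  have : (cover (WithLp.toLp 2 (s, 0)) : Domain K₁ K₂) = pt (K₁.proj s) 0 := by
    rw [← K₂.proj_zero]; rfl
  rw [this, h]
  conv_rhs => rw [← add_zero (m₂.node j)]
  rfl

theorem pt_add_cover_right (i j : ℤ) (s : ℝ) (j' : ℤ) (h : m₂.node j = m₂.node j' + K₂.proj s) :
    (pt (m₁.node i) (m₂.node j') + cover (WithLp.toLp 2 (0, s)) : Domain K₁ K₂)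
      = pt (m₁.node i) (m₂.node j) := by
  have : (cover (WithLp.toLp 2 (0, s)) : Domain K₁ K₂) = pt 0 (K₂.proj s) := by
    rw [← K₁.proj_zero]; rfl
  rw [this, h]
  conv_rhs => rw [← add_zero (m₁.node i)]
  rfl

/-- One step of the scheme moves mass according to the transition probabilities `jumpProb`. -/
theorem lintegral_gridMeasure_step {w w' : ℤ → ℤ → ℝ} {u : Domain K₁ K₂ → Vec}
    (hw : ∀ i j, 0 ≤ w i j) (hw₁ : ∀ j, m₁.IsPeriodic fun i => w i j)
    (hw₂ : ∀ i, m₂.IsPeriodic (w i))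
    (hp : ∀ z k, 0 ≤ jumpProb m₁ m₂ Δt (u z) k)
    (hw' : ∀ i j, w' i j = ∑ k, ![
      jumpProb m₁ m₂ Δt (u (pt (m₁.node (i + -1)) (m₂.node j))) 0 * w (i + -1) j,
      jumpProb m₁ m₂ Δt (u (pt (m₁.node (i + 1)) (m₂.node j))) 1 * w (i + 1) j,
      jumpProb m₁ m₂ Δt (u (pt (m₁.node i) (m₂.node (j + -1)))) 2 * w i (j + -1),
      jumpProb m₁ m₂ Δt (u (pt (m₁.node i) (m₂.node (j + 1)))) 3 * w i (j + 1)] k)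
    (f : Domain K₁ K₂ → ℝ≥0∞) :
    ∫⁻ z, f z ∂(gridMeasure m₁ m₂ w') = ∑ k, ∫⁻ z, ENNReal.ofReal (jumpProb m₁ m₂ Δt (u z) k)
      * f (z + cover (jump m₁ m₂ k)) ∂(gridMeasure m₁ m₂ w) := by
  set P : ℤ → ℤ → Domain K₁ K₂ := fun i j => pt (m₁.node i) (m₂.node j) with hP
  -- The contribution that leaves the node `(i, j)` by the `k`-th jump. The scheme collects incoming
  -- contributions, and shifting the four double sums passes from targets to sources.
  set g : Fin 4 → ℤ → ℤ → ℝ≥0∞ := fun k i j => ENNReal.ofReal (w i j) *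
    (ENNReal.ofReal (jumpProb m₁ m₂ Δt (u (P i j)) k) * f (P i j + cover (jump m₁ m₂ k))) with hg
  have hg₁ : ∀ k j, m₁.IsPeriodic fun i => g k i j := fun k j ht i => by
    have h1 := hw₁ j ht i
    have h2 := m₁.node_periodic ht i
    simp only [hg, hP, h2, h1]
  have hg₂ : ∀ k i, m₂.IsPeriodic (g k i) := fun k i ht j => by
    have h1 := hw₂ i ht j
    have h2 := m₂.node_periodic ht j
    simp only [hg, hP, h2, h1]
  have hn₁ : ∀ i, m₁.node i = m₁.node (i + -1) + K₁.proj m₁.step := fun i => by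
    rw [← m₁.node_add_one, neg_add_cancel_right]
  have hn₁' : ∀ i, m₁.node i = m₁.node (i + 1) + K₁.proj (-m₁.step) := fun i => by
    rw [m₁.node_add_one, Mesh.proj_neg, add_neg_cancel_right]
  have hn₂ : ∀ i, m₂.node i = m₂.node (i + -1) + K₂.proj m₂.step := fun i => by
    rw [← m₂.node_add_one, neg_add_cancel_right]
  have hn₂' : ∀ i, m₂.node i = m₂.node (i + 1) + K₂.proj (-m₂.step) := fun i => by
    rw [m₂.node_add_one, Mesh.proj_neg, add_neg_cancel_right]
  have hterm : ∀ i j : ℤ, ENNReal.ofReal (w' i j) * f (P i j)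
      = g 0 (i + -1) (j + 0) + g 1 (i + 1) (j + 0) + g 2 (i + 0) (j + -1) + g 3 (i + 0) (j + 1) := by
    intro i j
    have e0 : P (i + -1) j + cover (jump m₁ m₂ 0) = P i j :=
      pt_add_cover_left m₁ m₂ i j m₁.step _ (hn₁ i)
    have e1 : P (i + 1) j + cover (jump m₁ m₂ 1) = P i j :=
      pt_add_cover_left m₁ m₂ i j (-m₁.step) _ (hn₁' i)
    have e2 : P i (j + -1) + cover (jump m₁ m₂ 2) = P i j :=
      pt_add_cover_right m₁ m₂ i j m₂.step _ (hn₂ j)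
    have e3 : P i (j + 1) + cover (jump m₁ m₂ 3) = P i j :=
      pt_add_cover_right m₁ m₂ i j (-m₂.step) _ (hn₂' j)
    simp only [hg, add_zero]
    rw [e0, e1, e2, e3, hw' i j]
    simp only [Fin.sum_univ_four, Matrix.cons_val]
    rw [ENNReal.ofReal_add, ENNReal.ofReal_add, ENNReal.ofReal_add, ENNReal.ofReal_mul (hp _ _),
      ENNReal.ofReal_mul (hp _ _), ENNReal.ofReal_mul (hp _ _), ENNReal.ofReal_mul (hp _ _)]
    · ring
    all_goals
      have a0 := mul_nonneg (hp (P (i + -1) j) 0) (hw (i + -1) j)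
      have a1 := mul_nonneg (hp (P (i + 1) j) 1) (hw (i + 1) j)
      have a2 := mul_nonneg (hp (P i (j + -1)) 2) (hw i (j + -1))
      have a3 := mul_nonneg (hp (P i (j + 1)) 3) (hw i (j + 1))
      simp only [hP] at a0 a1 a2 a3
      linarith
  have hsum : ∀ k, ∫⁻ z, ENNReal.ofReal (jumpProb m₁ m₂ Δt (u z) k)
      * f (z + cover (jump m₁ m₂ k)) ∂(gridMeasure m₁ m₂ w)
      = ∑' (i : m₁.index) (j : m₂.index), g k i j := fun k => lintegral_gridMeasure m₁ m₂ w _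
  rw [lintegral_gridMeasure]
  simp_rw [hsum, Fin.sum_univ_four]
  rw [← tsum_tsum_add m₁ m₂ (hg₁ 0) (hg₂ 0) (-1) 0, ← tsum_tsum_add m₁ m₂ (hg₁ 1) (hg₂ 1) 1 0,
    ← tsum_tsum_add m₁ m₂ (hg₁ 2) (hg₂ 2) 0 (-1), ← tsum_tsum_add m₁ m₂ (hg₁ 3) (hg₂ 3) 0 1]
  simp_rw [← ENNReal.tsum_add]
  exact tsum_congr fun i => tsum_congr fun j => hterm i j

variable {V : Measure (Domain K₁ K₂) → Domain K₁ K₂ → Vec} {μ₀ : Measure (Domain K₁ K₂)}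

/-- Regrouped by source node, every coefficient depends on the velocity at the source alone, hence
is a transition probability. The form `i + -1` matches the shifts in `tsum_tsum_add`. -/
theorem weight_succ (n : ℕ) (i j : ℤ) :
    weight V μ₀ m₁ m₂ Δt (n + 1) i j = ∑ k, ![
      jumpProb m₁ m₂ Δt (V (stepMeasure V μ₀ m₁ m₂ Δt n) (pt (m₁.node (i + -1)) (m₂.node j))) 0
        * weight V μ₀ m₁ m₂ Δt n (i + -1) j,
      jumpProb m₁ m₂ Δt (V (stepMeasure V μ₀ m₁ m₂ Δt n) (pt (m₁.node (i + 1)) (m₂.node j))) 1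
        * weight V μ₀ m₁ m₂ Δt n (i + 1) j,
      jumpProb m₁ m₂ Δt (V (stepMeasure V μ₀ m₁ m₂ Δt n) (pt (m₁.node i) (m₂.node (j + -1)))) 2
        * weight V μ₀ m₁ m₂ Δt n i (j + -1),
      jumpProb m₁ m₂ Δt (V (stepMeasure V μ₀ m₁ m₂ Δt n) (pt (m₁.node i) (m₂.node (j + 1)))) 3
        * weight V μ₀ m₁ m₂ Δt n i (j + 1)] k := by
  rw [weight]
  simp only [Fin.sum_univ_four, jumpProb, Matrix.cons_val, stepMeasure, ← sub_eq_add_neg]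
  ring

theorem weight_periodic (n : ℕ) : (∀ j, m₁.IsPeriodic fun i => weight V μ₀ m₁ m₂ Δt n i j) ∧
    ∀ i, m₂.IsPeriodic (weight V μ₀ m₁ m₂ Δt n i) := by
  induction n with
  | zero =>
    refine ⟨fun j ht i => ?_, fun i ht j => ?_⟩
    · have h : ∀ x, m₁.hat (i + m₁.cells) x = m₁.hat i x := fun x => m₁.hat_periodic x ht i
      simp only [weight, h]
    · have h : ∀ x, m₂.hat (j + m₂.cells) x = m₂.hat j x := fun x => m₂.hat_periodic x ht j
      simp only [weight, h]
  | succ n ih =>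
    refine ⟨fun j ht i => ?_, fun i ht j => ?_⟩
    · have h1 : ∀ i j, weight V μ₀ m₁ m₂ Δt n (i + m₁.cells) j = weight V μ₀ m₁ m₂ Δt n i j :=
        fun i j => ih.1 j ht i
      have h2 := m₁.node_periodic ht
      simp only [weight_succ, add_right_comm i (m₁.cells : ℤ), h1, h2]
    · have h1 : ∀ i j, weight V μ₀ m₁ m₂ Δt n i (j + m₂.cells) = weight V μ₀ m₁ m₂ Δt n i j :=
        fun i j => ih.2 i ht j
      have h2 := m₂.node_periodic ht
      simp only [weight_succ, add_right_comm j (m₂.cells : ℤ), h1, h2]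

/-- The projection of the initial measure to the grid splits the mass at each point between the
neighbouring nodes. -/
theorem lintegral_stepMeasure_zero [IsProbabilityMeasure μ₀] (f : Domain K₁ K₂ → ℝ≥0∞) :
    ∫⁻ z, f z ∂(stepMeasure V μ₀ m₁ m₂ Δt 0) = ∫⁻ z, ∑' p : m₁.index × m₂.index,
      ENNReal.ofReal (m₁.hat p.1 z.fst * m₂.hat p.2 z.snd)
        * f (pt (m₁.node p.1) (m₂.node p.2)) ∂μ₀ := by
  have hcont : ∀ p : m₁.index × m₂.index,
      Continuous fun z : Domain K₁ K₂ => m₁.hat p.1 z.fst * m₂.hat p.2 z.snd := fun p =>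
    ((m₁.continuous_hat _).comp (by fun_prop)).mul ((m₂.continuous_hat _).comp (by fun_prop))
  rw [lintegral_tsum fun p => ((hcont p).measurable.ennreal_ofReal.mul_const _).aemeasurable,
    stepMeasure, lintegral_gridMeasure]
  refine (ENNReal.tsum_prod (f := fun (i : m₁.index) (j : m₂.index) =>
    ENNReal.ofReal (weight V μ₀ m₁ m₂ Δt 0 i j) * f (pt (m₁.node i) (m₂.node j)))).symm.trans ?_
  refine tsum_congr fun p => ?_
  rw [lintegral_mul_const _ (hcont p).measurable.ennreal_ofReal]
  congr 1
  refine ofReal_integral_eq_lintegral_ofReal (Integrable.of_bound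
    (hcont p).aestronglyMeasurable 1 (.of_forall fun z => ?_)) (.of_forall fun z =>
      mul_nonneg (m₁.hat_nonneg _ _) (m₂.hat_nonneg _ _))
  rw [Real.norm_eq_abs, abs_mul, abs_of_nonneg (m₁.hat_nonneg _ _),
    abs_of_nonneg (m₂.hat_nonneg _ _)]
  exact mul_le_one₀ (m₁.hat_le_one _ _) (m₂.hat_nonneg _ _) (m₂.hat_le_one _ _)

theorem tsum_hat_mul_hat (h₁ : m₁.step ≤ 1) (h₂ : m₂.step ≤ 1) (z : Domain K₁ K₂) :
    ∑' p : m₁.index × m₂.index, ENNReal.ofReal (m₁.hat p.1 z.fst * m₂.hat p.2 z.snd) = 1 := by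
  rw [ENNReal.tsum_prod (f := fun (i : m₁.index) (j : m₂.index) =>
    ENNReal.ofReal (m₁.hat i z.fst * m₂.hat j z.snd))]
  simp_rw [ENNReal.ofReal_mul (m₁.hat_nonneg _ _), ENNReal.tsum_mul_left, m₂.tsum_hat h₂, mul_one]
  exact m₁.tsum_hat h₁ _

end Chain

/-! ### Couplings -/

section Coupling

variable {X : Type*} [MeasurableSpace X]

/-- The mass at `x` is sent to `y p` with probability `q p x`; the explicit sum of push-forwards of
densities is the coupling. -/
theorem exists_coupling_of_split {ι : Type*} [Countable ι] {μ ρ : Measure X} {q : ι → X → ℝ≥0∞}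
    (hq : ∀ p, Measurable (q p)) (hsum : ∀ x, ∑' p, q p x = 1) (y : ι → X)
    (hρ : ∀ f : X → ℝ≥0∞, Measurable f → ∫⁻ z, f z ∂ρ = ∫⁻ x, ∑' p, q p x * f (y p) ∂μ) :
    ∃ π : Measure (X × X), π.map Prod.fst = μ ∧ π.map Prod.snd = ρ ∧
      ∀ g : X × X → ℝ≥0∞, Measurable g →
        ∫⁻ r, g r ∂π = ∫⁻ x, ∑' p, q p x * g (x, y p) ∂μ := by
  have key : ∀ g : X × X → ℝ≥0∞, Measurable g →
      ∫⁻ r, g r ∂(Measure.sum fun p => (μ.withDensity (q p)).map fun x => (x, y p))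
        = ∫⁻ x, ∑' p, q p x * g (x, y p) ∂μ := by
    intro g hg
    have hm : ∀ p, Measurable fun x : X => (x, y p) := fun p =>
      measurable_id.prodMk measurable_const
    have hqg : ∀ p, AEMeasurable (fun x => q p x * g (x, y p)) μ := fun p =>
      ((hq p).mul (hg.comp (hm p))).aemeasurable
    rw [lintegral_sum_measure, lintegral_tsum hqg]
    refine tsum_congr fun p => ?_
    exact (lintegral_map hg (hm p)).trans
      (lintegral_withDensity_eq_lintegral_mul _ (hq p) (hg.comp (hm p)))
  refine ⟨_, Measure.ext_of_lintegral _ fun f hf => ?_, Measure.ext_of_lintegral _ fun f hf => ?_,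
    key⟩
  · rw [lintegral_map hf measurable_fst, key (fun r => f r.1) (hf.comp measurable_fst)]
    simp_rw [ENNReal.tsum_mul_right, hsum, one_mul]
  · rw [lintegral_map hf measurable_snd, key (fun r => f r.2) (hf.comp measurable_snd), hρ f hf]

/-- The second component jumps and the first stays. As the jump probabilities depend on the second
component only, its law makes one step of the chain; no disintegration is needed. -/
theorem exists_coupling_of_step {ι : Type*} [Fintype ι] {μ ρ ρ' : Measure X} {π : Measure (X × X)}
    (h₁ : π.map Prod.fst = μ) (h₂ : π.map Prod.snd = ρ) {q : ι → X → ℝ≥0∞}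
    (hq : ∀ k, Measurable (q k)) (hsum : ∀ x, ∑ k, q k x = 1) {τ : ι → X → X}
    (hτ : ∀ k, Measurable (τ k))
    (hρ : ∀ f : X → ℝ≥0∞, Measurable f → ∫⁻ z, f z ∂ρ' = ∑ k, ∫⁻ z, q k z * f (τ k z) ∂ρ) :
    ∃ π' : Measure (X × X), π'.map Prod.fst = μ ∧ π'.map Prod.snd = ρ' ∧
      ∀ g : X × X → ℝ≥0∞, Measurable g →
        ∫⁻ r, g r ∂π' = ∫⁻ r, ∑ k, q k r.2 * g (r.1, τ k r.2) ∂π := by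
  have hm : ∀ k, Measurable fun r : X × X => (r.1, τ k r.2) := fun k =>
    measurable_fst.prodMk ((hτ k).comp measurable_snd)
  have hqm : ∀ k, Measurable fun r : X × X => q k r.2 := fun k => (hq k).comp measurable_snd
  have key : ∀ g : X × X → ℝ≥0∞, Measurable g →
      ∫⁻ r, g r ∂(Measure.sum fun k =>
        (π.withDensity fun r => q k r.2).map fun r => (r.1, τ k r.2))
        = ∫⁻ r, ∑ k, q k r.2 * g (r.1, τ k r.2) ∂π := by
    intro g hg
    have hqg : ∀ k ∈ Finset.univ, Measurable fun r : X × X => q k r.2 * g (r.1, τ k r.2) :=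
      fun k _ => (hqm k).mul (hg.comp (hm k))
    rw [lintegral_sum_measure, tsum_fintype, lintegral_finsetSum _ hqg]
    refine Finset.sum_congr rfl fun k _ => ?_
    exact (lintegral_map hg (hm k)).trans
      (lintegral_withDensity_eq_lintegral_mul _ (hqm k) (hg.comp (hm k)))
  refine ⟨_, Measure.ext_of_lintegral _ fun f hf => ?_, Measure.ext_of_lintegral _ fun f hf => ?_,
    key⟩
  · rw [lintegral_map hf measurable_fst, key (fun r => f r.1) (hf.comp measurable_fst), ← h₁,
      lintegral_map hf measurable_fst]
    simp_rw [← Finset.sum_mul, hsum, one_mul]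
  · rw [lintegral_map hf measurable_snd, key (fun r => f r.2) (hf.comp measurable_snd), hρ f hf, ← h₂]
    have hqf : ∀ k, Measurable fun z => q k z * f (τ k z) := fun k =>
      (hq k).mul (hf.comp (hτ k))
    refine (lintegral_finsetSum _ fun k _ => (hqf k).comp measurable_snd).trans ?_
    exact Finset.sum_congr rfl fun k _ => (lintegral_map (hqf k) measurable_snd).symm

end Coupling

end LaxFriedrichs

namespace LaxFriedrichs

/-! ### The error of the scheme -/

/-- The inequality `d ≤ d² / (2s) + s / 2` takes the place of Cauchy–Schwarz. -/
theorem dW_map_le_of_lintegral_dist_sq_le {X : Type*} [PseudoMetricSpace X] [MeasurableSpace X]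
    [OpensMeasurableSpace X] [SecondCountableTopology X] {Ω : Type*} [MeasurableSpace Ω]
    {π : Measure Ω} [IsProbabilityMeasure π] {f g : Ω → X} (hf : Measurable f) (hg : Measurable g)
    {s : ℝ} (hs : 0 < s)
    (h : ∫⁻ q, ENNReal.ofReal (dist (f q) (g q) ^ 2) ∂π ≤ ENNReal.ofReal (s ^ 2)) :
    dW (π.map f) (π.map g) ≤ ENNReal.ofReal s := by
  refine dW_map_le hf hg hs.le ?_
  have hpt : ∀ q, ENNReal.ofReal (dist (f q) (g q))
      ≤ ENNReal.ofReal (1 / (2 * s)) * ENNReal.ofReal (dist (f q) (g q) ^ 2)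
        + ENNReal.ofReal (s / 2) := fun q => by
    rw [← ENNReal.ofReal_mul (by positivity), ← ENNReal.ofReal_add (by positivity) (by positivity)]
    refine ENNReal.ofReal_le_ofReal ?_
    rw [one_div_mul_eq_div, div_add' _ _ _ (by positivity), le_div_iff₀ (by positivity)]
    nlinarith [sq_nonneg (dist (f q) (g q) - s)]
  have hm : Measurable fun q => ENNReal.ofReal (dist (f q) (g q) ^ 2) :=
    ((hf.dist hg).pow_const 2).ennreal_ofReal
  calc ∫⁻ q, ENNReal.ofReal (dist (f q) (g q)) ∂π
      ≤ ∫⁻ q, (ENNReal.ofReal (1 / (2 * s)) * ENNReal.ofReal (dist (f q) (g q) ^ 2)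
        + ENNReal.ofReal (s / 2)) ∂π := lintegral_mono hpt
    _ = ENNReal.ofReal (1 / (2 * s)) * ∫⁻ q, ENNReal.ofReal (dist (f q) (g q) ^ 2) ∂π
        + ENNReal.ofReal (s / 2) := by
      rw [lintegral_add_right _ measurable_const, lintegral_const_mul _ hm, lintegral_const,
        measure_univ, mul_one]
    _ ≤ ENNReal.ofReal (1 / (2 * s)) * ENNReal.ofReal (s ^ 2) + ENNReal.ofReal (s / 2) := by gcongr
    _ = ENNReal.ofReal s := by
      rw [← ENNReal.ofReal_mul (by positivity),
        ← ENNReal.ofReal_add (by positivity) (by positivity)]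
      congr 1
      field_simp
      ring

/-- The cross term is split by Young's inequality with weight `Δt`, so the old error is amplified by
only `1 + O(Δt)`; `Δt ≤ 1` absorbs the quadratic terms. -/
theorem sq_add_le {R d a C Δt : ℝ} (hΔ : 0 ≤ Δt) (hΔ₁ : Δt ≤ 1) (hR : 0 ≤ R) (hd : 0 ≤ d)
    (h : d ≤ Δt * (a + C * R)) :
    (R + d) ^ 2 ≤ (1 + (1 + 2 * C + 2 * C ^ 2) * Δt) * R ^ 2 + 3 * Δt * a ^ 2 := by
  have h1 : R * d ≤ R * (Δt * (a + C * R)) := mul_le_mul_of_nonneg_left h hR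
  have h2 : d ^ 2 ≤ (Δt * (a + C * R)) ^ 2 := pow_le_pow_left₀ hd h 2
  have h3 : (Δt * (a + C * R)) ^ 2 ≤ Δt * (2 * a ^ 2 + 2 * C ^ 2 * R ^ 2) := by
    have h4 : (a + C * R) ^ 2 ≤ 2 * a ^ 2 + 2 * C ^ 2 * R ^ 2 := by
      nlinarith [sq_nonneg (a - C * R)]
    rw [mul_pow]
    exact mul_le_mul (by nlinarith) h4 (sq_nonneg _) hΔ
  have h5 : 2 * (R * (Δt * a)) ≤ Δt * R ^ 2 + Δt * a ^ 2 := by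
    nlinarith [mul_nonneg hΔ (sq_nonneg (R - a))]
  nlinarith

section

variable {K₁ K₂ : Factor} (m₁ : Mesh K₁) (m₂ : Mesh K₂) (Δt : ℝ)

/-- The difference `z - x` is lifted to a shortest vector, and the identity for the mean square is
used in the plane; `cover` does not increase lengths. -/
theorem sum_jumpProb_mul_dist_sq_le {v : Vec} (hp : ∀ k, 0 ≤ jumpProb m₁ m₂ Δt v k)
    (x z : Domain K₁ K₂) (u : Vec) :
    ∑ k, jumpProb m₁ m₂ Δt v k * dist (x + cover u) (z + cover (jump m₁ m₂ k)) ^ 2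
      ≤ (dist x z + ‖u - Δt • v‖) ^ 2 + (m₁.step ^ 2 + m₂.step ^ 2) / 2 := by
  obtain ⟨r, hr, hrn⟩ := exists_cover_eq (z - x)
  rw [← dist_eq_norm, dist_comm] at hrn
  have hk : ∀ k, dist (x + cover u) (z + cover (jump m₁ m₂ k)) ≤ ‖(r - u) + jump m₁ m₂ k‖ := by
    intro k
    rw [dist_comm, dist_eq_norm]
    have : z + cover (jump m₁ m₂ k) - (x + cover u)
        = (cover ((r - u) + jump m₁ m₂ k) : Domain K₁ K₂) := by
      rw [map_add, map_sub, hr]; abel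
    rw [this]
    exact norm_cover_le _
  calc _ ≤ ∑ k, jumpProb m₁ m₂ Δt v k * ‖(r - u) + jump m₁ m₂ k‖ ^ 2 :=
        Finset.sum_le_sum fun k _ =>
          mul_le_mul_of_nonneg_left (pow_le_pow_left₀ dist_nonneg (hk k) 2) (hp k)
    _ ≤ ‖(r - u) + Δt • v‖ ^ 2 + (m₁.step ^ 2 + m₂.step ^ 2) / 2 := by
        rw [sum_jumpProb_mul_norm_sq]
        have : 0 ≤ Δt ^ 2 * ‖v‖ ^ 2 := by positivity
        linarith
    _ ≤ _ := by
        gcongr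
        rw [← hrn, sub_add]
        exact norm_sub_le _ _

variable {V : Measure (Domain K₁ K₂) → Domain K₁ K₂ → Vec} {μ₀ : Measure (Domain K₁ K₂)}

theorem measurable_dist_sq_shift (D : Domain K₁ K₂ →ᵇ Vec) :
    Measurable fun r : Domain K₁ K₂ × Domain K₁ K₂ =>
      ENNReal.ofReal (dist (shift D r.1) r.2 ^ 2) :=
  ((((continuous_shift D).measurable.comp measurable_fst).dist measurable_snd).pow_const
    2).ennreal_ofReal

theorem isProbabilityMeasure_of_map_fst {X Y : Type*} [MeasurableSpace X] [MeasurableSpace Y]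
    {μ : Measure X} [IsProbabilityMeasure μ] {π : Measure (X × Y)} (h : π.map Prod.fst = μ) :
    IsProbabilityMeasure π := ⟨by
  rw [← measure_univ (μ := μ), ← h, Measure.map_apply measurable_fst .univ, preimage_univ]⟩

/-- The positions of the particles that follow the displacement `D` can be coupled with the `n`-th
step of the scheme at mean square distance at most `e`. -/
def IsCoupled (V : Measure (Domain K₁ K₂) → Domain K₁ K₂ → Vec) (μ₀ : Measure (Domain K₁ K₂))
    (m₁ : Mesh K₁) (m₂ : Mesh K₂) (Δt : ℝ) (n : ℕ) (D : Domain K₁ K₂ →ᵇ Vec) (e : ℝ) : Prop :=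
  ∃ π : Measure (Domain K₁ K₂ × Domain K₁ K₂), π.map Prod.fst = μ₀ ∧
    π.map Prod.snd = stepMeasure V μ₀ m₁ m₂ Δt n ∧
    ∫⁻ r, ENNReal.ofReal (dist (shift D r.1) r.2 ^ 2) ∂π ≤ ENNReal.ofReal e

namespace IsCoupled

variable {m₁ m₂ Δt} {n : ℕ} {D : Domain K₁ K₂ →ᵇ Vec} {e : ℝ} [IsProbabilityMeasure μ₀]

theorem isProbabilityMeasure (h : IsCoupled V μ₀ m₁ m₂ Δt n D e) :
    IsProbabilityMeasure (stepMeasure V μ₀ m₁ m₂ Δt n) := by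
  obtain ⟨π, h1, h2, -⟩ := h
  have := isProbabilityMeasure_of_map_fst h1
  rw [← h2]
  exact Measure.isProbabilityMeasure_map measurable_snd.aemeasurable

theorem dW_le (h : IsCoupled V μ₀ m₁ m₂ Δt n D e) (he : 0 < e) :
    dW (stepMeasure V μ₀ m₁ m₂ Δt n) (μ₀.map (shift D)) ≤ ENNReal.ofReal (√e) := by
  obtain ⟨π, h1, h2, h3⟩ := h
  have := isProbabilityMeasure_of_map_fst h1
  have hs := (continuous_shift D).measurable
  rw [← h2, ← h1, Measure.map_map hs measurable_fst]
  refine dW_map_le_of_lintegral_dist_sq_le measurable_snd (hs.comp measurable_fst)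
    (Real.sqrt_pos.2 he) ?_
  rw [Real.sq_sqrt he.le]
  simp_rw [dist_comm (Prod.snd _)]
  exact h3

/-- Mass moves only to nodes whose hat does not vanish, so each coordinate changes by at most one
mesh length. -/
theorem zero (h₁ : m₁.step ≤ 1) (h₂ : m₂.step ≤ 1) :
    IsCoupled V μ₀ m₁ m₂ Δt 0 0 (m₁.step ^ 2 + m₂.step ^ 2) := by
  have hcont : ∀ p : m₁.index × m₂.index,
      Continuous fun z : Domain K₁ K₂ => m₁.hat p.1 z.fst * m₂.hat p.2 z.snd := fun p =>
    ((m₁.continuous_hat _).comp (by fun_prop)).mul ((m₂.continuous_hat _).comp (by fun_prop))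
  obtain ⟨π, h1, h2, h3⟩ := exists_coupling_of_split (μ := μ₀)
    (ρ := stepMeasure V μ₀ m₁ m₂ Δt 0)
    (q := fun (p : m₁.index × m₂.index) (z : Domain K₁ K₂) =>
      ENNReal.ofReal (m₁.hat p.1 z.fst * m₂.hat p.2 z.snd))
    (fun p => (hcont p).measurable.ennreal_ofReal) (tsum_hat_mul_hat m₁ m₂ h₁ h₂)
    (fun p => pt (m₁.node p.1) (m₂.node p.2)) (fun f _ => lintegral_stepMeasure_zero m₁ m₂ Δt f)
  refine ⟨π, h1, h2, ?_⟩
  rw [h3 _ (measurable_dist_sq_shift 0)]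
  have hle : ∀ x : Domain K₁ K₂, ∑' p : m₁.index × m₂.index,
      ENNReal.ofReal (m₁.hat p.1 x.fst * m₂.hat p.2 x.snd)
        * ENNReal.ofReal (dist (shift 0 x) (pt (m₁.node p.1) (m₂.node p.2)) ^ 2)
      ≤ ENNReal.ofReal (m₁.step ^ 2 + m₂.step ^ 2) := by
    intro x
    have hx : shift (0 : Domain K₁ K₂ →ᵇ Vec) x = x := by
      simp [shift]
    calc _ ≤ ∑' p : m₁.index × m₂.index, ENNReal.ofReal (m₁.hat p.1 x.fst * m₂.hat p.2 x.snd)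
          * ENNReal.ofReal (m₁.step ^ 2 + m₂.step ^ 2) := by
          refine ENNReal.tsum_le_tsum fun p => ?_
          have n1 := m₁.hat_nonneg p.1 x.fst
          have n2 := m₂.hat_nonneg p.2 x.snd
          rw [hx, ← ENNReal.ofReal_mul (by positivity), ← ENNReal.ofReal_mul (by positivity)]
          refine ENNReal.ofReal_le_ofReal ?_
          rw [WithLp.prod_dist_eq_of_L2, Real.sq_sqrt (by positivity)]
          have a1 := mul_le_mul_of_nonneg_left (m₁.hat_mul_dist_sq_le p.1 x.fst) n2
          have a2 := mul_le_mul_of_nonneg_left (m₂.hat_mul_dist_sq_le p.2 x.snd) n1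
          change _ * (dist x.fst (m₁.node p.1) ^ 2 + dist x.snd (m₂.node p.2) ^ 2) ≤ _
          linarith
      _ = _ := by rw [ENNReal.tsum_mul_right, tsum_hat_mul_hat m₁ m₂ h₁ h₂, one_mul]
  calc _ ≤ ∫⁻ _, ENNReal.ofReal (m₁.step ^ 2 + m₂.step ^ 2) ∂μ₀ := lintegral_mono hle
    _ = _ := by rw [lintegral_const, measure_univ, mul_one]

/-- The mean displacements of the two components differ by at most `Δt * (a + C₂ * dist)`, while the
centred part of the jump adds its variance only. With first moments the noise would add up linearly
in the number of steps and would not vanish. -/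
theorem succ {C₁ C₂ lam₀ a : ℝ} (hlam : 0 < lam₀) (hC₁ : 0 < C₁) (hC₂ : 0 ≤ C₂)
    (he : 0 ≤ e) (hcfl : CFL C₁ lam₀ m₁ m₂ Δt) (hΔ₁ : Δt ≤ 1) (hA1 : VelocityBound V C₁)
    (hA2 : VelocityLipschitzInSpace V C₂) (hw : ∀ i j, 0 ≤ weight V μ₀ m₁ m₂ Δt n i j)
    {D' : Domain K₁ K₂ →ᵇ Vec}
    (hD : ∀ x, ‖D' x - D x - Δt • V (stepMeasure V μ₀ m₁ m₂ Δt n) (shift D x)‖ ≤ Δt * a)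
    (h : IsCoupled V μ₀ m₁ m₂ Δt n D e) :
    (∀ i j, 0 ≤ weight V μ₀ m₁ m₂ Δt (n + 1) i j) ∧
    IsCoupled V μ₀ m₁ m₂ Δt (n + 1) D' ((1 + (1 + 2 * C₂ + 2 * C₂ ^ 2) * Δt) * e
      + (3 * Δt * a ^ 2 + (m₁.step ^ 2 + m₂.step ^ 2) / 2)) := by
  have hprob := h.isProbabilityMeasure
  obtain ⟨π, h1, h2, h3⟩ := h
  have hπ := isProbabilityMeasure_of_map_fst h1
  have hΔ := CFL.pos m₁ m₂ hlam hC₁ hcfl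
  set ρ := stepMeasure V μ₀ m₁ m₂ Δt n with hρ
  have hp : ∀ z k, 0 ≤ jumpProb m₁ m₂ Δt (V ρ z) k := fun z k =>
    jumpProb_nonneg m₁ m₂ hlam hC₁ hcfl (hA1 ρ hprob z) k
  have hVc : Continuous (V ρ) := hA2.continuous ρ
  have hw' := weight_succ m₁ m₂ Δt (V := V) (μ₀ := μ₀) n
  refine ⟨fun i j => ?_, ?_⟩
  · rw [hw' i j]
    refine Finset.sum_nonneg fun k _ => ?_
    fin_cases k <;> exact mul_nonneg (hp _ _) (hw _ _)
  obtain ⟨π', g1, g2, g3⟩ := exists_coupling_of_step (ρ' := stepMeasure V μ₀ m₁ m₂ Δt (n + 1))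
    h1 h2
    (q := fun k z => ENNReal.ofReal (jumpProb m₁ m₂ Δt (V ρ z) k))
    (fun k => ((continuous_jumpProb m₁ m₂ Δt k).comp hVc).measurable.ennreal_ofReal)
    (fun z => by
      rw [← ENNReal.ofReal_sum_of_nonneg fun k _ => hp z k, sum_jumpProb, ENNReal.ofReal_one])
    (τ := fun k z => z + cover (jump m₁ m₂ k))
    (fun k => (by fun_prop : Continuous fun z : Domain K₁ K₂ =>
      z + cover (jump m₁ m₂ k)).measurable)
    (fun f _ => lintegral_gridMeasure_step m₁ m₂ Δt hw (weight_periodic m₁ m₂ Δt n).1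
      (weight_periodic m₁ m₂ Δt n).2 hp hw' f)
  refine ⟨π', g1, g2, ?_⟩
  rw [g3 _ (measurable_dist_sq_shift D')]
  have hpt : ∀ r : Domain K₁ K₂ × Domain K₁ K₂,
      ∑ k, ENNReal.ofReal (jumpProb m₁ m₂ Δt (V ρ r.2) k)
        * ENNReal.ofReal (dist (shift D' r.1) (r.2 + cover (jump m₁ m₂ k)) ^ 2)
      ≤ ENNReal.ofReal (1 + (1 + 2 * C₂ + 2 * C₂ ^ 2) * Δt)
          * ENNReal.ofReal (dist (shift D r.1) r.2 ^ 2)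
        + ENNReal.ofReal (3 * Δt * a ^ 2 + (m₁.step ^ 2 + m₂.step ^ 2) / 2) := by
    rintro ⟨x, z⟩
    simp_rw [← ENNReal.ofReal_mul (hp z _)]
    rw [← ENNReal.ofReal_sum_of_nonneg fun k _ => mul_nonneg (hp z k) (sq_nonneg _),
      ← ENNReal.ofReal_mul (by positivity), ← ENNReal.ofReal_add (by positivity) (by positivity)]
    refine ENNReal.ofReal_le_ofReal ?_
    have hshift : shift D' x = shift D x + cover (D' x - D x) := by
      simp only [shift, map_sub]; abel
    have hvel : ‖D' x - D x - Δt • V ρ z‖ ≤ Δt * (a + C₂ * dist (shift D x) z) := by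
      have e1 : D' x - D x - Δt • V ρ z = (D' x - D x - Δt • V ρ (shift D x))
          + Δt • (V ρ (shift D x) - V ρ z) := by
        rw [smul_sub]; abel
      rw [e1]
      refine (norm_add_le _ _).trans ?_
      rw [norm_smul, Real.norm_of_nonneg hΔ.le, mul_add]
      exact add_le_add (hD x) (mul_le_mul_of_nonneg_left (hA2 ρ hprob _ _) hΔ.le)
    have k1 := sum_jumpProb_mul_dist_sq_le m₁ m₂ Δt (hp z) (shift D x) z (D' x - D x)
    have k2 := sq_add_le hΔ.le hΔ₁ dist_nonneg (norm_nonneg _) hvel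
    simp only [hshift]
    linarith
  calc _ ≤ ∫⁻ r : Domain K₁ K₂ × Domain K₁ K₂,
        (ENNReal.ofReal (1 + (1 + 2 * C₂ + 2 * C₂ ^ 2) * Δt)
          * ENNReal.ofReal (dist (shift D r.1) r.2 ^ 2)
        + ENNReal.ofReal (3 * Δt * a ^ 2 + (m₁.step ^ 2 + m₂.step ^ 2) / 2)) ∂π :=
        lintegral_mono hpt
    _ = ENNReal.ofReal (1 + (1 + 2 * C₂ + 2 * C₂ ^ 2) * Δt)
          * ∫⁻ r, ENNReal.ofReal (dist (shift D r.1) r.2 ^ 2) ∂π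
        + ENNReal.ofReal (3 * Δt * a ^ 2 + (m₁.step ^ 2 + m₂.step ^ 2) / 2) := by
        rw [lintegral_add_right _ measurable_const,
          lintegral_const_mul _ (measurable_dist_sq_shift D), lintegral_const, measure_univ,
          mul_one]
    _ ≤ ENNReal.ofReal (1 + (1 + 2 * C₂ + 2 * C₂ ^ 2) * Δt) * ENNReal.ofReal e
        + ENNReal.ofReal (3 * Δt * a ^ 2 + (m₁.step ^ 2 + m₂.step ^ 2) / 2) := by gcongr
    _ = _ := by
        rw [← ENNReal.ofReal_mul (by positivity),
          ← ENNReal.ofReal_add (by positivity) (by positivity)]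

end IsCoupled

/-- The mean square error of the first `n` steps of the scheme. -/
theorem isCoupled_solution {C₁ C₂ C₃ lam₀ : ℝ} [IsProbabilityMeasure μ₀] {m₁ : Mesh K₁}
    {m₂ : Mesh K₂} {Δt : ℝ} (hlam : 0 < lam₀) (hC₁ : 0 < C₁) (hC₂ : 0 < C₂) (hC₃ : 0 < C₃)
    (hcfl : CFL C₁ lam₀ m₁ m₂ Δt) (hΔ₁ : Δt ≤ 1) (h₁ : m₁.step ≤ 1) (h₂ : m₂.step ≤ 1)
    (hA1 : VelocityBound V C₁) (hA2 : VelocityLipschitzInSpace V C₂)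
    (hA3 : VelocityLipschitzInMeasure V C₃)
    {F : (Domain K₁ K₂ →ᵇ Vec) → (Domain K₁ K₂ →ᵇ Vec)}
    (hF : ∀ D x, F D x = V (μ₀.map (shift D)) (shift D x))
    (hFL : LipschitzWith (C₂ + C₃).toNNReal F) (hFb : ∀ D, ‖F D‖ ≤ C₁)
    {D : ℝ → Domain K₁ K₂ →ᵇ Vec} (hD0 : D 0 = 0) (hD : ∀ t, HasDerivAt D (F (D t)) t) (n : ℕ) :
    (∀ i j, 0 ≤ weight V μ₀ m₁ m₂ Δt n i j) ∧
    IsCoupled V μ₀ m₁ m₂ Δt n (D (n * Δt)) ((m₁.step ^ 2 + m₂.step ^ 2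
      + n * (6 * ((C₂ + C₃) * C₁) ^ 2 * Δt ^ 3 + (m₁.step ^ 2 + m₂.step ^ 2) / 2))
      * (1 + (1 + 2 * C₂ + 2 * C₂ ^ 2 + 6 * C₃ ^ 2) * Δt) ^ n) := by
  have hΔ := CFL.pos m₁ m₂ hlam hC₁ hcfl
  have hs₁ := m₁.step_pos
  have hs₂ := m₂.step_pos
  induction n with
  | zero =>
    refine ⟨fun i j => integral_nonneg fun z => mul_nonneg (m₁.hat_nonneg _ _)
      (m₂.hat_nonneg _ _), ?_⟩
    simpa [hD0] using IsCoupled.zero (V := V) (μ₀ := μ₀) (Δt := Δt) h₁ h₂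
  | succ n ih =>
    obtain ⟨hw, hc⟩ := ih
    set q := (1 + 2 * C₂ + 2 * C₂ ^ 2 + 6 * C₃ ^ 2) * Δt with hq
    set c := 6 * ((C₂ + C₃) * C₁) ^ 2 * Δt ^ 3 + (m₁.step ^ 2 + m₂.step ^ 2) / 2 with hcdef
    set e := (m₁.step ^ 2 + m₂.step ^ 2 + n * c) * (1 + q) ^ n with hedef
    have he : 0 < e := by positivity
    have hprob := hc.isProbabilityMeasure
    have hprob' := isProbabilityMeasure_map_shift μ₀ (D (n * Δt))
    have hW := hc.dW_le he
    -- The first term is the Euler error of the particle flow; the second is the velocity error,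
    -- since the distance between the two measures is at most `√e` by the coupling itself.
    have hstep : ∀ x, ‖D ((n + 1 : ℕ) * Δt) x - D (n * Δt) x
        - Δt • V (stepMeasure V μ₀ m₁ m₂ Δt n) (shift (D (n * Δt)) x)‖
        ≤ Δt * ((C₂ + C₃) * C₁ * Δt + C₃ * √e) := by
      intro x
      have k1 := norm_sub_euler_le_of_solution hFL hFb hD (n * Δt) hΔ.le
      have k2 := ((D (n * Δt + Δt) - D (n * Δt) - Δt • F (D (n * Δt))).norm_coe_le_norm x).trans k1
      have k3 := hA3.norm_sub_le hC₃.le (Real.sqrt_nonneg e) hW (shift (D (n * Δt)) x)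
      have e1 : ((n + 1 : ℕ) : ℝ) * Δt = n * Δt + Δt := by push_cast; ring
      rw [e1]
      rw [Real.coe_toNNReal _ (by positivity)] at k2
      have e2 : D (n * Δt + Δt) x - D (n * Δt) x
          - Δt • V (stepMeasure V μ₀ m₁ m₂ Δt n) (shift (D (n * Δt)) x)
          = (D (n * Δt + Δt) - D (n * Δt) - Δt • F (D (n * Δt))) x
            - Δt • (V (stepMeasure V μ₀ m₁ m₂ Δt n) (shift (D (n * Δt)) x)
              - V (μ₀.map (shift (D (n * Δt)))) (shift (D (n * Δt)) x)) := by
        rw [← hF, smul_sub]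
        simp only [BoundedContinuousFunction.coe_sub, BoundedContinuousFunction.coe_smul,
          Pi.sub_apply]
        abel
      rw [e2]
      refine (norm_sub_le _ _).trans ?_
      rw [norm_smul, Real.norm_of_nonneg hΔ.le]
      have := mul_le_mul_of_nonneg_left k3 hΔ.le
      linarith
    obtain ⟨w', π, g1, g2, g3⟩ := hc.succ hlam hC₁ hC₂.le he.le hcfl hΔ₁ hA1 hA2 hw
      hstep
    refine ⟨w', π, g1, g2, g3.trans (ENNReal.ofReal_le_ofReal ?_)⟩
    refine le_trans ?_ (discrete_growth_le (by positivity) (by positivity) n)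
    rw [← hedef]
    -- Multiplied by `3 * Δt`, the part `2 * (C₃ ^ 2 * e)` yields the summand `6 * C₃ ^ 2` of the
    -- growth rate and the other part yields the source of order `Δt ^ 3`.
    have hsq : ((C₂ + C₃) * C₁ * Δt + C₃ * √e) ^ 2
        ≤ 2 * ((C₂ + C₃) * C₁ * Δt) ^ 2 + 2 * (C₃ ^ 2 * e) := by
      have := sq_nonneg ((C₂ + C₃) * C₁ * Δt - C₃ * √e)
      have h2 : (C₃ * √e) ^ 2 = C₃ ^ 2 * e := by rw [mul_pow, Real.sq_sqrt he.le]
      rw [← h2]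
      linarith
    have := mul_le_mul_of_nonneg_left hsq (by positivity : (0 : ℝ) ≤ 3 * Δt)
    rw [hq, hcdef]
    linarith

end

end LaxFriedrichs

/-! ### Interpolation in time and the choice of the mesh bound -/

namespace LaxFriedrichs

section

variable {X : Type*} [PseudoMetricSpace X] [MeasurableSpace X]

theorem dW_le_add {ν₁ ν₂ ν₃ : Measure X} {v w : ℝ} (hv : 0 ≤ v) (hw : 0 ≤ w)
    (h : dW ν₁ ν₂ ≤ ENNReal.ofReal v) (h' : dW ν₂ ν₃ ≤ ENNReal.ofReal w) :
    dW ν₁ ν₃ ≤ ENNReal.ofReal (v + w) :=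
  dW_le_ofReal fun ψ hψ => by
    have h1 := integral_sub_le_of_dW_le_of_lipschitz hv h hψ
    have h2 := integral_sub_le_of_dW_le_of_lipschitz hw h' hψ
    linarith

theorem dW_convexCombination_le [OpensMeasurableSpace X] {ρ₁ ρ₂ ν : Measure X} [IsProbabilityMeasure ρ₁]
    [IsProbabilityMeasure ρ₂] {a b w : ℝ} (ha : 0 ≤ a) (hb : 0 ≤ b) (hab : a + b = 1) (hw : 0 ≤ w)
    (h₁ : dW ρ₁ ν ≤ ENNReal.ofReal w) (h₂ : dW ρ₂ ν ≤ ENNReal.ofReal w) :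
    dW (ENNReal.ofReal a • ρ₁ + ENNReal.ofReal b • ρ₂) ν ≤ ENNReal.ofReal w :=
  dW_le_ofReal fun ψ hψ => by
    have k1 := mul_le_mul_of_nonneg_left (integral_sub_le_of_dW_le_of_lipschitz hw h₁ hψ) ha
    have k2 := mul_le_mul_of_nonneg_left (integral_sub_le_of_dW_le_of_lipschitz hw h₂ hψ) hb
    rw [integral_add_measure ((ψ.integrable _).smul_measure ENNReal.ofReal_ne_top)
      ((ψ.integrable _).smul_measure ENNReal.ofReal_ne_top), integral_smul_measure,
      integral_smul_measure, ENNReal.toReal_ofReal ha, ENNReal.toReal_ofReal hb, smul_eq_mul,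
      smul_eq_mul]
    have e1 : ∫ x, ψ x ∂ν = a * ∫ x, ψ x ∂ν + b * ∫ x, ψ x ∂ν := by rw [← add_mul, hab, one_mul]
    have e2 : w = a * w + b * w := by rw [← add_mul, hab, one_mul]
    linarith

end

theorem isProbabilityMeasure_convexCombination {X : Type*} [MeasurableSpace X]
    {ρ₁ ρ₂ : Measure X} [IsProbabilityMeasure ρ₁] [IsProbabilityMeasure ρ₂] {a b : ℝ} (ha : 0 ≤ a) (hb : 0 ≤ b) (hab : a + b = 1) :
    IsProbabilityMeasure (ENNReal.ofReal a • ρ₁ + ENNReal.ofReal b • ρ₂) := ⟨by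
  simp [← ENNReal.ofReal_add ha hb, hab]⟩

variable {K₁ K₂ : Factor} {V : Measure (Domain K₁ K₂) → Domain K₁ K₂ → Vec}
  {μ₀ : Measure (Domain K₁ K₂)}

/-- The interpolant is a convex combination of two steps whose times are within `Δt` of `t`, and
balls of `d_W` are convex. -/
theorem approx_of_stepMeasure {m₁ : Mesh K₁} {m₂ : Mesh K₂} {Δt : ℝ} (hΔ : 0 < Δt)
    (hprob : ∀ n, IsProbabilityMeasure (stepMeasure V μ₀ m₁ m₂ Δt n)) {t : ℝ} (ht : 0 ≤ t) :
    IsProbabilityMeasure (approx V μ₀ m₁ m₂ Δt t) ∧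
    ∀ (ν : Measure (Domain K₁ K₂)) (w : ℝ), 0 ≤ w →
      (∀ n : ℕ, |t - n * Δt| ≤ Δt →
        dW (stepMeasure V μ₀ m₁ m₂ Δt n) ν ≤ ENNReal.ofReal w) →
      dW (approx V μ₀ m₁ m₂ Δt t) ν ≤ ENNReal.ofReal w := by
  have h1 : (⌊t / Δt⌋₊ : ℝ) * Δt ≤ t := by
    rw [← le_div_iff₀ hΔ]; exact Nat.floor_le (by positivity)
  have h2 : t < ((⌊t / Δt⌋₊ : ℝ) + 1) * Δt := by
    rw [← div_lt_iff₀ hΔ]; exact Nat.lt_floor_add_one _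
  have ha : 0 ≤ (((⌊t / Δt⌋₊ : ℝ) + 1) * Δt - t) / Δt := div_nonneg (by linarith) hΔ.le
  have hb : 0 ≤ (t - (⌊t / Δt⌋₊ : ℝ) * Δt) / Δt := div_nonneg (by linarith) hΔ.le
  have hab : (((⌊t / Δt⌋₊ : ℝ) + 1) * Δt - t) / Δt + (t - (⌊t / Δt⌋₊ : ℝ) * Δt) / Δt = 1 := by
    field_simp; ring
  have i1 := hprob ⌊t / Δt⌋₊
  have i2 := hprob (⌊t / Δt⌋₊ + 1)
  refine ⟨isProbabilityMeasure_convexCombination ha hb hab, fun ν w hw h =>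
    dW_convexCombination_le ha hb hab hw (h _ ?_) (h _ ?_)⟩
  · rw [abs_le]; constructor <;> linarith
  · push_cast
    rw [abs_le]; constructor <;> linarith

/-- The square of the larger step is controlled by the mixed ratio, that of the smaller one by its
own smallness. -/
theorem sq_add_sq_div_min_le {a b δ : ℝ} (ha : 0 < a) (hb : 0 < b) (ha' : a < δ) (hb' : b < δ)
    (hab : a ^ 2 / b < δ) (hba : b ^ 2 / a < δ) : a ^ 2 + b ^ 2 ≤ 2 * δ * min a b := by
  rw [div_lt_iff₀ hb] at hab
  rw [div_lt_iff₀ ha] at hba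
  rcases le_total a b with h | h
  · rw [min_eq_left h]; nlinarith
  · rw [min_eq_right h]; nlinarith

/-- Convergence of the scheme to the solution given by the particle paths. -/
theorem approx_tendsto_solution {C₁ C₂ C₃ : ℝ} [IsProbabilityMeasure μ₀] (hC₁ : 0 < C₁)
    (hC₂ : 0 < C₂) (hC₃ : 0 < C₃) (hA1 : VelocityBound V C₁) (hA2 : VelocityLipschitzInSpace V C₂)
    (hA3 : VelocityLipschitzInMeasure V C₃)
    {F : (Domain K₁ K₂ →ᵇ Vec) → (Domain K₁ K₂ →ᵇ Vec)}
    (hF : ∀ D x, F D x = V (μ₀.map (shift D)) (shift D x))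
    (hFL : LipschitzWith (C₂ + C₃).toNNReal F) (hFb : ∀ D, ‖F D‖ ≤ C₁)
    {D : ℝ → Domain K₁ K₂ →ᵇ Vec} (hD0 : D 0 = 0) (hD : ∀ t, HasDerivAt D (F (D t)) t)
    {lam₀ T ε : ℝ} (hlam : 0 < lam₀) (hT : 0 < T) (hε : 0 < ε) :
    ∃ δ : ℝ, 0 < δ ∧ ∀ (m₁ : Mesh K₁) (m₂ : Mesh K₂) (Δt : ℝ), CFL C₁ lam₀ m₁ m₂ Δt →
      m₁.step < δ → m₂.step < δ → m₁.step ^ 2 / m₂.step < δ → m₂.step ^ 2 / m₁.step < δ →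
      (∀ t ∈ Icc (0 : ℝ) T, IsProbabilityMeasure (approx V μ₀ m₁ m₂ Δt t)) ∧
      (⨆ t ∈ Icc (0 : ℝ) T, dW (approx V μ₀ m₁ m₂ Δt t) (μ₀.map (shift (D t))))
        ≤ ENNReal.ofReal ε := by
  set A : ℝ := 1 + 2 * C₂ + 2 * C₂ ^ 2 + 6 * C₃ ^ 2 with hA
  set B : ℝ := (C₂ + C₃) * C₁ with hB
  -- The terms bound the initial projection, the Euler errors and the accumulated variance, in this
  -- order. The horizon is `T + 1` because the interpolation uses a step after time `T`, and `Δt ≤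
  -- 1`.
  set E : ℝ → ℝ := fun δ => (2 * δ ^ 2 + (T + 1) * (6 * B ^ 2 * (δ / (2 * C₁)) ^ 2
    + C₁ * δ / lam₀)) * Real.exp (A * (T + 1)) with hE
  have hlim : Tendsto (fun δ => √(E δ) + δ) (𝓝[>] 0) (𝓝 0) := by
    have hc : Continuous fun δ => √(E δ) + δ := by
      simp only [hE]; fun_prop
    have := hc.tendsto 0
    simp only [hE] at this ⊢
    norm_num at this
    exact this.mono_left nhdsWithin_le_nhds
  have hsmall : ∀ r : ℝ, 0 < r → ∀ᶠ δ in 𝓝[>] (0 : ℝ), δ < r := fun r hr =>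
    (eventually_lt_nhds hr).filter_mono nhdsWithin_le_nhds
  obtain ⟨δ, hδε, hδ₁, hδC, hδ⟩ := ((hlim.eventually_lt_const hε).and
    ((hsmall 1 one_pos).and ((hsmall (2 * C₁) (by positivity)).and self_mem_nhdsWithin))).exists
  have hδ : 0 < δ := hδ
  refine ⟨δ, hδ, fun m₁ m₂ Δt hcfl h₁ h₂ h₁₂ h₂₁ => ?_⟩
  have hΔ := CFL.pos m₁ m₂ hlam hC₁ hcfl
  have hs₁ := m₁.step_pos
  have hs₂ := m₂.step_pos
  have hmin : 0 < min m₁.step m₂.step := lt_min hs₁ hs₂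
  have hlow : lam₀ * min m₁.step m₂.step ≤ C₁ * Δt := by
    have := hcfl.1
    rwa [div_mul_eq_mul_div, le_div_iff₀ hmin, mul_comm Δt] at this
  have hΔδ : Δt ≤ δ / (2 * C₁) := by
    have := hcfl.2
    rw [div_mul_eq_mul_div, div_le_iff₀ hmin] at this
    rw [le_div_iff₀ (by positivity)]
    linarith [min_le_left m₁.step m₂.step]
  have hΔ₁ : Δt ≤ 1 := hΔδ.trans ((div_le_one (by positivity)).2 hδC.le)
  have hcoup := isCoupled_solution hlam hC₁ hC₂ hC₃ hcfl hΔ₁ (h₁.trans hδ₁).le (h₂.trans hδ₁).le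
    hA1 hA2 hA3 hF hFL hFb hD0 hD
  have hsq := sq_add_sq_div_min_le hs₁ hs₂ h₁ h₂ h₁₂ h₂₁
  -- The lower CFL bound enters here: the variance of one step is at most `δ` times the smaller mesh
  -- length, hence `O(δ Δt)`, and stays small after summation over the steps.
  have hcost : (m₁.step ^ 2 + m₂.step ^ 2) / 2 ≤ Δt * (C₁ * δ / lam₀) := by
    have : Δt * (C₁ * δ / lam₀) = δ * (C₁ * Δt) / lam₀ := by ring
    rw [this, le_div_iff₀ hlam]
    nlinarith [mul_le_mul_of_nonneg_left hlow hδ.le]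
  have herr : ∀ n : ℕ, n * Δt ≤ T + 1 → (m₁.step ^ 2 + m₂.step ^ 2
      + n * (6 * B ^ 2 * Δt ^ 3 + (m₁.step ^ 2 + m₂.step ^ 2) / 2)) * (1 + A * Δt) ^ n ≤ E δ := by
    intro n hn
    have hexp : (1 + A * Δt) ^ n ≤ Real.exp (A * (T + 1)) := by
      refine (one_add_pow_le_exp (by positivity) n).trans (Real.exp_le_exp.2 ?_)
      have : A * (n * Δt) ≤ A * (T + 1) := mul_le_mul_of_nonneg_left hn (by positivity)
      linarith
    refine mul_le_mul (add_le_add ?_ ?_) hexp (by positivity) (by positivity)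
    · nlinarith
    · calc (n : ℝ) * (6 * B ^ 2 * Δt ^ 3 + (m₁.step ^ 2 + m₂.step ^ 2) / 2)
          ≤ n * (Δt * (6 * B ^ 2 * Δt ^ 2 + C₁ * δ / lam₀)) := by
            refine mul_le_mul_of_nonneg_left ?_ (by positivity)
            linarith
        _ = n * Δt * (6 * B ^ 2 * Δt ^ 2 + C₁ * δ / lam₀) := by ring
        _ ≤ (T + 1) * (6 * B ^ 2 * (δ / (2 * C₁)) ^ 2 + C₁ * δ / lam₀) := by gcongr
  have happrox := fun (t : ℝ) (ht : t ∈ Icc (0 : ℝ) T) => approx_of_stepMeasure (V := V) (μ₀ := μ₀)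
    (m₁ := m₁) (m₂ := m₂) hΔ (fun n => (hcoup n).2.isProbabilityMeasure) ht.1
  refine ⟨fun t ht => (happrox t ht).1, iSup₂_le fun t ht =>
    ((happrox t ht).2 (μ₀.map (shift (D t))) (√(E δ) + δ) (by positivity) fun n hn => ?_).trans
      (ENNReal.ofReal_le_ofReal hδε.le)⟩
  -- The scheme is compared with the flow at the grid time, and the flow then moves by at most `C₁ *
  -- Δt` up to time `t`.
  refine dW_le_add (Real.sqrt_nonneg _) hδ.le (ν₂ := μ₀.map (shift (D (n * Δt)))) ?_ ?_
  · refine ((hcoup n).2.dW_le (by positivity)).trans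
      (ENNReal.ofReal_le_ofReal (Real.sqrt_le_sqrt (herr n ?_)))
    linarith [(abs_le.1 hn).1, ht.2]
  · refine dW_map_le_of_dist_le (continuous_shift _).measurable (continuous_shift _).measurable
      hδ.le fun x => (dist_shift_le _ _ x).trans ?_
    refine (norm_sub_le_of_solution hFb hD t (n * Δt)).trans ?_
    rw [abs_sub_comm]
    calc C₁ * |t - n * Δt| ≤ C₁ * (δ / (2 * C₁)) := by gcongr; exact hn.trans hΔδ
      _ = δ / 2 := by field_simp
      _ ≤ δ := by linarith

end LaxFriedrichs

/-! ### Assembly of existence, uniqueness and convergence -/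

theorem theorem2p9 (K₁ K₂ : LaxFriedrichs.Factor)
    (V : Measure (LaxFriedrichs.Domain K₁ K₂) → LaxFriedrichs.Domain K₁ K₂ → LaxFriedrichs.Vec)
    (C₁ : ℝ) (hC₁ : 0 < C₁) (hA1 : LaxFriedrichs.VelocityBound V C₁)
    (hA2 : ∃ C₂ : ℝ, 0 < C₂ ∧ LaxFriedrichs.VelocityLipschitzInSpace V C₂)
    (hA3 : ∃ C₃ : ℝ, 0 < C₃ ∧ LaxFriedrichs.VelocityLipschitzInMeasure V C₃)
    (μ₀ : Measure (LaxFriedrichs.Domain K₁ K₂)) (hμ₀ : IsProbabilityMeasure μ₀)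
    (hsupp : IsCompact μ₀.support) :
    ∃ μ : ℝ → Measure (LaxFriedrichs.Domain K₁ K₂),
      LaxFriedrichs.IsMeasureValuedSolution V μ₀ μ ∧
      (∀ ν : ℝ → Measure (LaxFriedrichs.Domain K₁ K₂),
        LaxFriedrichs.IsMeasureValuedSolution V μ₀ ν → ∀ t, 0 ≤ t → ν t = μ t) ∧
      ∀ lam₀ : ℝ, 0 < lam₀ → ∀ T : ℝ, 0 < T → ∀ ε : ℝ, 0 < ε → ∃ δ : ℝ, 0 < δ ∧
        ∀ (m₁ : LaxFriedrichs.Mesh K₁) (m₂ : LaxFriedrichs.Mesh K₂) (Δt : ℝ),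
          LaxFriedrichs.CFL C₁ lam₀ m₁ m₂ Δt →
          m₁.step < δ → m₂.step < δ →
          m₁.step ^ 2 / m₂.step < δ → m₂.step ^ 2 / m₁.step < δ →
          (∀ t ∈ Icc (0 : ℝ) T,
            IsProbabilityMeasure (LaxFriedrichs.approx V μ₀ m₁ m₂ Δt t)) ∧
          (⨆ t ∈ Icc (0 : ℝ) T,
            LaxFriedrichs.dW (LaxFriedrichs.approx V μ₀ m₁ m₂ Δt t) (μ t)) ≤ ENNReal.ofReal ε := by
  open LaxFriedrichs in
  obtain ⟨C₂, hC₂, hA2⟩ := hA2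
  obtain ⟨C₃, hC₃, hA3⟩ := hA3
  obtain ⟨F, hF, hFL, hFb⟩ := exists_velocity_operator hC₁ hC₂ hC₃ hA1 hA2 hA3 μ₀
  obtain ⟨D, hD0, hD⟩ := exists_global_solution hFL hC₁.le hFb 0
  have hsol := isMeasureValuedSolution_of_flow hA1 hA2 μ₀ hF hD0 hD
  exact ⟨_, hsol, fun ν hν t ht => hsol.unique hC₁.le hC₂.le hC₃.le hA1 hA2 hA3 hν ht,
    fun lam₀ hlam T hT ε hε =>
      approx_tendsto_solution hC₁ hC₂ hC₃ hA1 hA2 hA3 hF hFL hFb hD0 hD hlam hT hε⟩
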